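/- Let $k$ be a field of characteristic $p>0$. A *$p$-morphism* of $k[x_1,x_2]$ is a finite composition of $k$-algebra endomorphisms of the following two kinds: (1) $x_1\mapsto a_{11}x_1+a_{12}x_2+a_{13}$, $x_2\mapsto a_{21}x_1+a_{22}x_2+a_{23}$ with $a_{ij}\in k$ and $a_{11}a_{22}-a_{12}a_{21}\neq 0$; (2*) $x_1\mapsto x_1$, $x_2\mapsto x_2+h(x_1,x_2^p)$ with $h\in k[x_1,x_2]$. A $k$-algebra endomorphism $\phi$ of $k[x_1,x_2]$ is *of type (b)* if $\phi(x_1)=x_1h_1(u)$ and $\phi(x_2)=x_2h_2(u)$ for some nonzero homogeneous $u\in k[x_1,x_2]$ of positive degree and some one-variable polynomials $h_1,h_2\in k[x]$ of positive degree, and $\partial(\phi(x_1),\phi(x_2))/\partial(x_1,x_2)\in k^*$. Let $\rho$ be a $k$-algebra endomorphism of $k[x_1,x_2]$ that is a finite composition of $p$-morphisms and endomorphisms of type (b), in any order. If $\rho$ is not a $k$-algebra automorphism of $k[x_1,x_2]$, then $$\max\{\deg\rho(x_1),\deg\rho(x_2)\}\ge p,$$ where $\deg$ is the total degree. Consequently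 the Low Degree Jacobian Conjecture 1 holds for this class: if $\deg\rho(x_1)<p$ and $\deg\rho(x_2)<p$, then $\partial(\rho(x_1),\rho(x_2))/\partial(x_1,x_2)\in k^*$ if and only if $k[x_1,x_2]=k[\rho(x_1),\rho(x_2)]$. -/

import Mathlib

open MvPolynomial

/-- The Jacobian determinant `∂(f₁, f₂)/∂(x₁, x₂)`; the variables `x₁, x₂` are `X 0, X 1`. -/
noncomputable def jacobianDet {k : Type*} [Field k] (f₁ f₂ : MvPolynomial (Fin 2) k) :
    MvPolynomial (Fin 2) k :=
  pderiv 0 f₁ * pderiv 1 f₂ - pderiv 1 f₁ * pderiv 0 f₂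

/-- `(f₁, f₂)` is a Jacobian pair: its Jacobian determinant is a nonzero constant. -/
def IsJacobianPair {k : Type*} [Field k] (f₁ f₂ : MvPolynomial (Fin 2) k) : Prop :=
  ∃ c : k, c ≠ 0 ∧ jacobianDet f₁ f₂ = C c

/-- Type (1): an invertible affine substitution. -/
def IsAffineMap {k : Type*} [Field k]
    (φ : MvPolynomial (Fin 2) k →ₐ[k] MvPolynomial (Fin 2) k) : Prop :=
  ∃ a₁₁ a₁₂ a₁₃ a₂₁ a₂₂ a₂₃ : k, a₁₁ * a₂₂ - a₁₂ * a₂₁ ≠ 0 ∧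
    φ (X 0) = C a₁₁ * X 0 + C a₁₂ * X 1 + C a₁₃ ∧
    φ (X 1) = C a₂₁ * X 0 + C a₂₂ * X 1 + C a₂₃

/-- Type (2*): `x₁ ↦ x₁`, `x₂ ↦ x₂ + h(x₁, x₂ ^ p)`. -/
def IsTypeTwoStar {k : Type*} [Field k] (p : ℕ)
    (φ : MvPolynomial (Fin 2) k →ₐ[k] MvPolynomial (Fin 2) k) : Prop :=
  ∃ h : MvPolynomial (Fin 2) k,
    φ (X 0) = X 0 ∧ φ (X 1) = X 1 + aeval ![X 0, X 1 ^ p] h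

/-- Type (a), the `p`-morphisms: finite compositions of maps of types (1) and (2*).
Multiplication of `k`-endomorphisms is composition. -/
def IsPMorphism {k : Type*} [Field k] (p : ℕ)
    (φ : MvPolynomial (Fin 2) k →ₐ[k] MvPolynomial (Fin 2) k) : Prop :=
  φ ∈ Submonoid.closure
    {ψ : MvPolynomial (Fin 2) k →ₐ[k] MvPolynomial (Fin 2) k |
      IsAffineMap ψ ∨ IsTypeTwoStar p ψ}

/-- Type (b): `xᵢ ↦ xᵢ hᵢ(u)` with `u` a nonzero form of positive degree and `h₁, h₂` one-variable
polynomials of positive degree, such that the images of `x₁, x₂` are a Jacobian pair. -/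
def IsTypeB {k : Type*} [Field k]
    (φ : MvPolynomial (Fin 2) k →ₐ[k] MvPolynomial (Fin 2) k) : Prop :=
  ∃ (u : MvPolynomial (Fin 2) k) (d : ℕ) (h₁ h₂ : Polynomial k),
    u ≠ 0 ∧ 0 < d ∧ u.IsHomogeneous d ∧ 0 < h₁.natDegree ∧ 0 < h₂.natDegree ∧
    φ (X 0) = X 0 * Polynomial.aeval u h₁ ∧ φ (X 1) = X 1 * Polynomial.aeval u h₂ ∧
    IsJacobianPair (φ (X 0)) (φ (X 1))

/-- Finite compositions of maps of types (a) and (b). -/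
def IsCompositeAB {k : Type*} [Field k] (p : ℕ)
    (ρ : MvPolynomial (Fin 2) k →ₐ[k] MvPolynomial (Fin 2) k) : Prop :=
  ρ ∈ Submonoid.closure
    {ψ : MvPolynomial (Fin 2) k →ₐ[k] MvPolynomial (Fin 2) k | IsPMorphism p ψ ∨ IsTypeB ψ}

/-! ### Chain rule and Jacobian pairs. -/

section ChainRule

variable {k : Type*} [Field k]

/-! A composite of maps of types (a) and (b) is either a `p`-morphism or factors as ρ₁βρ₂ with β of
type (b) and ρ₁, ρ₂ given by Jacobian pairs. In the first case degrees below `p` force bijectivity;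
in the second some component has degree at least `p`.

`p`-morphisms. The polynomial h(x₁, x₂^p) has zero derivative in x₂, so maps (2*) have unitriangular
Jacobian matrices, and the chain rule turns the Jacobian matrix of a `p`-morphism into a continued
fraction A·∏[[qᵢ, 1], [1, 0]]·B with A, B constant and all qᵢ nonconstant
(`IsPMorphism.isSwapProduct`). A linear substitution removes B. A component f then satisfies ∂f/∂x₁
= Uq + V and ∂f/∂x₂ = U, where q is the last partial quotient and, when U ≠ 0, V is no heavier than
U for every weight (1, θ). Positive integers below `p` are invertible in k, so comparing weights
shows that q involves x₁ only (`false_of_last_depends`) and that f has weighted degree below `p` for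
the weights (1, deg q + 1) (`wdeg_lt_of_last_univariate`). Hence q can be integrated, and an
elementary automorphism removes the last factor while the degrees stay below `p`
(`bijective_of_jacMat_prodSwap`). In the end the Jacobian matrix is constant and the map is affine.

Type (b). Since u is a form, the Jacobian condition becomes an ordinary differential equation for
h₁, h₂, one for each monomial x₁^i x₂^j of u. With mᵢ = deg hᵢ it forces i, j > 0 and p ∣ 1 + m₁i +
m₂j, and the residues of i and j mod `p` do not depend on the monomial (`typeB_exponents`). Let a, b
be the components of ρ₁, of degrees n, m, let F be a component of ρ₂ and G = β(F). If all monomials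
of G of top (n, m)-weight are divisible by x₁^A x₂^B, then deg G(a, b) ≥ nA + mB
(`le_totalDegree_aeval`). To see this, restrict (a, b) to lines x₁ = t: because x₁ is algebraic over
k[a, b], suitably chosen lines have images that do not meet near infinity, and an ultrametric Newton
polygon argument gives the bound on one of them. Exponents A and B are read off from the top
monomials of u and F, and arithmetic gives nA + mB ≥ p; when n = m = 1 the map ρ₁ is affine and the
degree is found directly. -/

theorem pderiv_algHom_apply (φ : MvPolynomial (Fin 2) k →ₐ[k] MvPolynomial (Fin 2) k)
    (j : Fin 2) (f : MvPolynomial (Fin 2) k) :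
    pderiv j (φ f) = φ (pderiv 0 f) * pderiv j (φ (X 0)) +
      φ (pderiv 1 f) * pderiv j (φ (X 1)) := by
  induction f using MvPolynomial.induction_on with
  | C a =>
    have : φ (C a) = C a := φ.commutes a
    simp [this]
  | add f g hf hg => simp only [map_add, hf, hg]; ring
  | mul_X f i hf =>
    fin_cases i <;> simp [Derivation.leibniz, hf, pderiv_X] <;> ring

theorem jacobianDet_comp (φ ψ : MvPolynomial (Fin 2) k →ₐ[k] MvPolynomial (Fin 2) k) :
    jacobianDet ((φ * ψ) (X 0)) ((φ * ψ) (X 1)) =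
      φ (jacobianDet (ψ (X 0)) (ψ (X 1))) * jacobianDet (φ (X 0)) (φ (X 1)) := by
  simp only [jacobianDet, AlgHom.mul_apply, pderiv_algHom_apply φ _ (ψ _), map_sub, map_mul]
  ring

theorem isJacobianPair_mul {φ ψ : MvPolynomial (Fin 2) k →ₐ[k] MvPolynomial (Fin 2) k}
    (hφ : IsJacobianPair (φ (X 0)) (φ (X 1))) (hψ : IsJacobianPair (ψ (X 0)) (ψ (X 1))) :
    IsJacobianPair ((φ * ψ) (X 0)) ((φ * ψ) (X 1)) := by
  obtain ⟨c, hc, h1⟩ := hφ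
  obtain ⟨d, hd, h2⟩ := hψ
  refine ⟨d * c, mul_ne_zero hd hc, ?_⟩
  rw [jacobianDet_comp, h1, h2, C_mul]
  congr 1
  exact φ.commutes d

theorem isJacobianPair_one :
    IsJacobianPair ((1 : MvPolynomial (Fin 2) k →ₐ[k] MvPolynomial (Fin 2) k) (X 0))
      ((1 : MvPolynomial (Fin 2) k →ₐ[k] MvPolynomial (Fin 2) k) (X 1)) :=
  ⟨1, one_ne_zero, by simp [jacobianDet, pderiv_X]⟩

/-- Partial derivatives of a substitution instance. -/
theorem pderiv_aeval (g : Fin 2 → MvPolynomial (Fin 2) k)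
    (j : Fin 2) (f : MvPolynomial (Fin 2) k) :
    pderiv j (aeval g f) = aeval g (pderiv 0 f) * pderiv j (g 0) +
      aeval g (pderiv 1 f) * pderiv j (g 1) := by
  have := pderiv_algHom_apply (aeval g) j f
  simpa only [aeval_X] using this

/-- The derivative of the `p`-th power of `X 1` vanishes. This is the only place where the shape of
a map (2*) enters: its Jacobian matrix is unitriangular. -/
theorem pderiv_aeval_pow_char (p : ℕ) [CharP k p] (h : MvPolynomial (Fin 2) k) :
    pderiv 1 (aeval ![X 0, (X 1 : MvPolynomial (Fin 2) k) ^ p] h) = 0 := by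
  rw [pderiv_aeval]
  simp [pderiv_X]

theorem IsTypeTwoStar.isJacobianPair {p : ℕ} [CharP k p]
    {φ : MvPolynomial (Fin 2) k →ₐ[k] MvPolynomial (Fin 2) k} (hφ : IsTypeTwoStar p φ) :
    IsJacobianPair (φ (X 0)) (φ (X 1)) := by
  obtain ⟨h, h0, h1⟩ := hφ
  refine ⟨1, one_ne_zero, ?_⟩
  rw [h0, h1]
  have := pderiv_aeval_pow_char p h
  simp only [jacobianDet, map_add, this]
  simp [pderiv_X]

theorem IsAffineMap.isJacobianPair
    {φ : MvPolynomial (Fin 2) k →ₐ[k] MvPolynomial (Fin 2) k} (hφ : IsAffineMap φ) :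
    IsJacobianPair (φ (X 0)) (φ (X 1)) := by
  obtain ⟨a, b, c, d, e, f, hD, h0, h1⟩ := hφ
  refine ⟨a * e - b * d, hD, ?_⟩
  rw [h0, h1]
  simp [jacobianDet, pderiv_X]

theorem IsPMorphism.isJacobianPair {p : ℕ} [CharP k p]
    {φ : MvPolynomial (Fin 2) k →ₐ[k] MvPolynomial (Fin 2) k} (hφ : IsPMorphism p φ) :
    IsJacobianPair (φ (X 0)) (φ (X 1)) := by
  induction hφ using Submonoid.closure_induction with
  | mem ψ hψ => exact hψ.elim (·.isJacobianPair) (·.isJacobianPair)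
  | one => exact isJacobianPair_one
  | mul a b _ _ ha hb => exact isJacobianPair_mul ha hb

theorem IsTypeB.isJacobianPair
    {φ : MvPolynomial (Fin 2) k →ₐ[k] MvPolynomial (Fin 2) k} (hφ : IsTypeB φ) :
    IsJacobianPair (φ (X 0)) (φ (X 1)) := by
  obtain ⟨_, _, _, _, _, _, _, _, _, _, _, h⟩ := hφ
  exact h

theorem IsCompositeAB.isJacobianPair {p : ℕ} [CharP k p]
    {φ : MvPolynomial (Fin 2) k →ₐ[k] MvPolynomial (Fin 2) k} (hφ : IsCompositeAB p φ) :
    IsJacobianPair (φ (X 0)) (φ (X 1)) := by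
  induction hφ using Submonoid.closure_induction with
  | mem ψ hψ => exact hψ.elim (·.isJacobianPair) (·.isJacobianPair)
  | one => exact isJacobianPair_one
  | mul a b _ _ ha hb => exact isJacobianPair_mul ha hb

/-- A composite is either a `p`-morphism or factors through a map of type (b). -/
theorem IsCompositeAB.isPMorphism_or_factor {p : ℕ}
    {φ : MvPolynomial (Fin 2) k →ₐ[k] MvPolynomial (Fin 2) k} (hφ : IsCompositeAB p φ) :
    IsPMorphism p φ ∨ ∃ ρ₁ β ρ₂ : MvPolynomial (Fin 2) k →ₐ[k] MvPolynomial (Fin 2) k,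
      IsCompositeAB p ρ₁ ∧ IsTypeB β ∧ IsCompositeAB p ρ₂ ∧ φ = ρ₁ * β * ρ₂ := by
  induction hφ using Submonoid.closure_induction with
  | mem ψ hψ =>
    rcases hψ with h | h
    · exact Or.inl h
    · exact Or.inr ⟨1, ψ, 1, Submonoid.one_mem _, h, Submonoid.one_mem _, by simp⟩
  | one => exact Or.inl (Submonoid.one_mem _)
  | mul a b ha' hb' ha hb =>
    rcases ha with ha | ⟨r, β, s, hr, hβ, hs, rfl⟩
    · rcases hb with hb | ⟨r, β, s, hr, hβ, hs, rfl⟩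
      · exact Or.inl (Submonoid.mul_mem _ ha hb)
      · exact Or.inr ⟨a * r, β, s, Submonoid.mul_mem _ ha' hr, hβ, hs, by simp [mul_assoc]⟩
    · exact Or.inr ⟨r, β, s * b, hr, hβ, Submonoid.mul_mem _ hs hb', by simp [mul_assoc]⟩

end ChainRule

set_option linter.unusedSectionVars false

/-! ### Leading monomials for an additive key. -/

section Lead

variable {σ R Γ : Type*} [CommRing R] [IsDomain R]
  [AddCommMonoid Γ] [LinearOrder Γ] [IsOrderedCancelAddMonoid Γ]

/-- `d` is a monomial of `f` at which the additive key `κ` is maximal. -/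
def IsLead (κ : (σ →₀ ℕ) →+ Γ) (f : MvPolynomial σ R) (d : σ →₀ ℕ) : Prop :=
  d ∈ f.support ∧ ∀ e ∈ f.support, κ e ≤ κ d

theorem exists_isLead (κ : (σ →₀ ℕ) →+ Γ) {f : MvPolynomial σ R} (hf : f ≠ 0) :
    ∃ d, IsLead κ f d := by
  obtain ⟨d, hd, h⟩ := f.support.exists_max_image κ (support_nonempty.2 hf)
  exact ⟨d, hd, h⟩

theorem exists_add_of_mem_support_mul {f g : MvPolynomial σ R} {d : σ →₀ ℕ}
    (hd : d ∈ (f * g).support) : ∃ a ∈ f.support, ∃ b ∈ g.support, a + b = d := by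
  classical
  exact Finset.mem_add.1 (support_mul f g hd)

/-- Injectivity of the key leaves a single contributing pair: in any other pair one of the monomials
has a strictly smaller key, so the sum of the keys falls short. -/
theorem IsLead.coeff_mul {κ : (σ →₀ ℕ) →+ Γ} (hκ : Function.Injective κ)
    {f g : MvPolynomial σ R} {d e : σ →₀ ℕ} (hf : IsLead κ f d) (hg : IsLead κ g e) :
    coeff (d + e) (f * g) = coeff d f * coeff e g := by
  classical
  rw [MvPolynomial.coeff_mul]
  refine Finset.sum_eq_single (d, e) ?_ (by simp)
  rintro ⟨a, b⟩ hab hne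
  rw [Finset.HasAntidiagonal.mem_antidiagonal] at hab
  by_contra h0
  have ha : a ∈ f.support := mem_support_iff.2 (left_ne_zero_of_mul h0)
  have hb : b ∈ g.support := mem_support_iff.2 (right_ne_zero_of_mul h0)
  have h1 := hf.2 a ha
  have h2 := hg.2 b hb
  have h3 : κ a + κ b = κ d + κ e := by rw [← map_add, ← map_add]; exact congrArg κ hab
  have h4 : κ a = κ d := by
    by_contra hne'
    exact absurd h3 (add_lt_add_of_lt_of_le (lt_of_le_of_ne h1 hne') h2).ne
  have h5 : a = d := hκ h4
  subst h5
  exact hne (by simpa using hab)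

theorem IsLead.mul {κ : (σ →₀ ℕ) →+ Γ} (hκ : Function.Injective κ)
    {f g : MvPolynomial σ R} {d e : σ →₀ ℕ} (hf : IsLead κ f d) (hg : IsLead κ g e) :
    IsLead κ (f * g) (d + e) := by
  refine ⟨?_, ?_⟩
  · rw [mem_support_iff, hf.coeff_mul hκ hg]
    exact mul_ne_zero (mem_support_iff.1 hf.1) (mem_support_iff.1 hg.1)
  · intro c hc
    obtain ⟨a, ha, b, hb, rfl⟩ := exists_add_of_mem_support_mul hc
    rw [map_add, map_add]
    exact add_le_add (hf.2 a ha) (hg.2 b hb)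

theorem isLead_C (κ : (σ →₀ ℕ) →+ Γ) {c : R} (hc : c ≠ 0) :
    IsLead κ (C c : MvPolynomial σ R) 0 := by
  classical
  refine ⟨by simpa using hc, fun e he => ?_⟩
  rw [mem_support_iff, coeff_C] at he
  have : e = 0 := by by_contra h; exact he (if_neg fun h' => h h'.symm)
  rw [this]

theorem IsLead.pow {κ : (σ →₀ ℕ) →+ Γ} (hκ : Function.Injective κ)
    {f : MvPolynomial σ R} {d : σ →₀ ℕ} (hf : IsLead κ f d) (n : ℕ) :
    IsLead κ (f ^ n) (n • d) := by
  induction n with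
  | zero => simpa using isLead_C κ (one_ne_zero (α := R))
  | succ n ih => rw [pow_succ, succ_nsmul]; exact ih.mul hκ hf

theorem IsLead.add {κ : (σ →₀ ℕ) →+ Γ}
    {f g : MvPolynomial σ R} {d : σ →₀ ℕ} (hf : IsLead κ f d)
    (hg : ∀ e ∈ g.support, κ e < κ d) : IsLead κ (f + g) d := by
  classical
  refine ⟨?_, ?_⟩
  · have h0 : coeff d g = 0 := by
      by_contra h
      exact lt_irrefl _ (hg d (mem_support_iff.2 h))
    rw [mem_support_iff, coeff_add, h0, add_zero]
    exact mem_support_iff.1 hf.1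
  · intro e he
    rcases Finset.mem_union.1 (support_add he) with h | h
    · exact hf.2 e h
    · exact (hg e h).le

/-- If finitely many polynomials have leading monomials with pairwise distinct keys,
the largest of them is the leading monomial of the sum. -/
theorem isLead_sum {ι : Type*} {κ : (σ →₀ ℕ) →+ Γ} {s : Finset ι} {f : ι → MvPolynomial σ R}
    {d : ι → σ →₀ ℕ} {i : ι} (hi : i ∈ s) (hf : ∀ j ∈ s, IsLead κ (f j) (d j))
    (hmax : ∀ j ∈ s, j ≠ i → κ (d j) < κ (d i)) : IsLead κ (∑ j ∈ s, f j) (d i) := by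
  classical
  rw [← Finset.add_sum_erase s f hi]
  refine (hf i hi).add fun e he => ?_
  obtain ⟨j, hj, hje⟩ := Finset.mem_biUnion.1 (support_sum he)
  have hj' := Finset.mem_of_mem_erase hj
  exact ((hf j hj').2 e hje).trans_lt (hmax j hj' (Finset.ne_of_mem_erase hj))

end Lead

/-! ### Weighted degrees in two variables. -/

section Weight

variable {R : Type*} [CommRing R]

/-- The weight of a bivariate monomial, where `X 0` has weight `n` and `X 1` has weight `m`. -/
noncomputable def wt (n m : ℕ) : (Fin 2 →₀ ℕ) →+ ℕ where
  toFun d := n * d 0 + m * d 1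
  map_zero' := by simp
  map_add' a b := by simp only [Finsupp.add_apply]; ring

theorem wt_apply (n m : ℕ) (d : Fin 2 →₀ ℕ) : wt n m d = n * d 0 + m * d 1 := rfl

/-- The weight refined by the exponent of `X 0`. -/
noncomputable def wtLex (n m : ℕ) : (Fin 2 →₀ ℕ) →+ ℕ ×ₗ ℕ where
  toFun d := toLex (wt n m d, d 0)
  map_zero' := by simp
  map_add' a b := by
    rw [map_add, Finsupp.add_apply]; rfl

/-- The weight alone does not separate monomials; with the tie-break it does once `m > 0`, so the
results on leading monomials apply and the weighted degree is additive on products. -/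
theorem wtLex_injective {n m : ℕ} (hm : 0 < m) : Function.Injective (wtLex n m) := by
  intro a b h
  have h' : (wt n m a, a 0) = (wt n m b, b 0) := h
  rw [Prod.mk.injEq, wt_apply, wt_apply] at h'
  obtain ⟨h1, h2⟩ := h'
  ext i
  fin_cases i
  · exact h2
  · rw [h2] at h1
    exact Nat.eq_of_mul_eq_mul_left hm (Nat.add_left_cancel h1)

theorem wt_le_of_wtLex_le {n m : ℕ} {a b : Fin 2 →₀ ℕ} (h : wtLex n m a ≤ wtLex n m b) :
    wt n m a ≤ wt n m b := by
  have h' : toLex (wt n m a, a 0) ≤ toLex (wt n m b, b 0) := h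
  rw [Prod.Lex.toLex_le_toLex] at h'
  rcases h' with h' | h'
  · exact h'.le
  · exact h'.1.le

/-- The weighted degree. -/
noncomputable def wdeg (n m : ℕ) (f : MvPolynomial (Fin 2) R) : ℕ := f.support.sup (wt n m)

theorem le_wdeg {n m : ℕ} {f : MvPolynomial (Fin 2) R} {d : Fin 2 →₀ ℕ} (hd : d ∈ f.support) :
    wt n m d ≤ wdeg n m f := Finset.le_sup (f := wt n m) hd

theorem wdeg_le {n m N : ℕ} {f : MvPolynomial (Fin 2) R}
    (h : ∀ d ∈ f.support, wt n m d ≤ N) : wdeg n m f ≤ N := Finset.sup_le h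

theorem exists_wt_eq_wdeg (n m : ℕ) {f : MvPolynomial (Fin 2) R} (hf : f ≠ 0) :
    ∃ d ∈ f.support, wt n m d = wdeg n m f := by
  obtain ⟨d, hd, h⟩ := Finset.exists_mem_eq_sup f.support (support_nonempty.2 hf) (wt n m)
  exact ⟨d, hd, h.symm⟩

theorem IsLead.wdeg_eq {n m : ℕ} {f : MvPolynomial (Fin 2) R} {d : Fin 2 →₀ ℕ}
    (hd : IsLead (wtLex n m) f d) : wdeg n m f = wt n m d :=
  le_antisymm (wdeg_le fun e he => wt_le_of_wtLex_le (hd.2 e he)) (le_wdeg hd.1)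

theorem wdeg_mul [IsDomain R] {n m : ℕ} (hm : 0 < m) {f g : MvPolynomial (Fin 2) R}
    (hf : f ≠ 0) (hg : g ≠ 0) : wdeg n m (f * g) = wdeg n m f + wdeg n m g := by
  obtain ⟨d, hd⟩ := exists_isLead (wtLex n m) hf
  obtain ⟨e, he⟩ := exists_isLead (wtLex n m) hg
  rw [hd.wdeg_eq, he.wdeg_eq, (hd.mul (wtLex_injective hm) he).wdeg_eq, map_add]

theorem wdeg_add_le (n m : ℕ) (f g : MvPolynomial (Fin 2) R) :
    wdeg n m (f + g) ≤ max (wdeg n m f) (wdeg n m g) := by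
  classical
  refine wdeg_le fun d hd => ?_
  rcases Finset.mem_union.1 (support_add hd) with h | h
  · exact (le_wdeg h).trans (le_max_left _ _)
  · exact (le_wdeg h).trans (le_max_right _ _)

theorem wdeg_C (n m : ℕ) (c : R) : wdeg n m (C c : MvPolynomial (Fin 2) R) = 0 := by
  classical
  refine Nat.eq_zero_of_le_zero (wdeg_le fun d hd => ?_)
  rw [mem_support_iff, coeff_C] at hd
  have : d = 0 := by by_contra h; exact hd (if_neg fun h' => h h'.symm)
  rw [this, map_zero]

theorem wdeg_add_eq_left {n m : ℕ} {f g : MvPolynomial (Fin 2) R} (h : wdeg n m g < wdeg n m f) :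
    wdeg n m (f + g) = wdeg n m f := by
  have hf : f ≠ 0 := by rintro rfl; simp [wdeg] at h
  refine le_antisymm ((wdeg_add_le n m f g).trans (by simp [h.le])) ?_
  obtain ⟨d, hd, hw⟩ := exists_wt_eq_wdeg n m hf
  rw [← hw]
  refine le_wdeg (mem_support_iff.2 ?_)
  rw [coeff_add]
  have : coeff d g = 0 := by
    by_contra h0
    have := le_wdeg (n := n) (m := m) (mem_support_iff.2 h0)
    omega
  rw [this, add_zero]
  exact mem_support_iff.1 hd

theorem totalDegree_eq_wdeg (f : MvPolynomial (Fin 2) R) : f.totalDegree = wdeg 1 1 f := by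
  unfold totalDegree wdeg
  congr 1
  ext d
  rw [Finsupp.sum_fintype _ _ (fun _ => rfl), Fin.sum_univ_two, wt_apply]
  ring

theorem le_totalDegree_fin_two {f : MvPolynomial (Fin 2) R} {d : Fin 2 →₀ ℕ}
    (hd : d ∈ f.support) : d 0 + d 1 ≤ f.totalDegree := by
  have := le_wdeg (n := 1) (m := 1) hd
  rwa [← totalDegree_eq_wdeg, wt_apply, one_mul, one_mul] at this

theorem add_single_mem_support_of_pderiv {i : Fin 2} {f : MvPolynomial (Fin 2) R}
    {d : Fin 2 →₀ ℕ} (hd : d ∈ (pderiv i f).support) : d + Finsupp.single i 1 ∈ f.support := by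
  rw [mem_support_iff, coeff_pderiv] at hd
  exact mem_support_iff.2 (left_ne_zero_of_mul hd)

theorem wdeg_pderiv_zero (n m : ℕ) {f : MvPolynomial (Fin 2) R} (h : pderiv 0 f ≠ 0) :
    wdeg n m (pderiv 0 f) + n ≤ wdeg n m f := by
  obtain ⟨d, hd, hw⟩ := exists_wt_eq_wdeg n m h
  have := le_wdeg (n := n) (m := m) (add_single_mem_support_of_pderiv hd)
  rw [map_add, hw] at this
  simpa [wt_apply] using this

theorem wdeg_pderiv_one (n m : ℕ) {f : MvPolynomial (Fin 2) R} (h : pderiv 1 f ≠ 0) :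
    wdeg n m (pderiv 1 f) + m ≤ wdeg n m f := by
  obtain ⟨d, hd, hw⟩ := exists_wt_eq_wdeg n m h
  have := le_wdeg (n := n) (m := m) (add_single_mem_support_of_pderiv hd)
  rw [map_add, hw] at this
  simpa [wt_apply] using this

/-- The bivariate exponent `(i, j)`. -/
noncomputable def expo (i j : ℕ) : Fin 2 →₀ ℕ := Finsupp.single 0 i + Finsupp.single 1 j

@[simp] theorem expo_zero (i j : ℕ) : expo i j 0 = i := by simp [expo]
@[simp] theorem expo_one (i j : ℕ) : expo i j 1 = j := by simp [expo]

theorem expo_self (d : Fin 2 →₀ ℕ) : expo (d 0) (d 1) = d := by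
  ext i; fin_cases i <;> simp

theorem expo_add (i j i' j' : ℕ) : expo i j + expo i' j' = expo (i + i') (j + j') := by
  ext l; fin_cases l <;> simp

theorem coeff_pderiv_zero_expo (f : MvPolynomial (Fin 2) R) (i j : ℕ) :
    coeff (expo i j) (pderiv 0 f) = coeff (expo (i + 1) j) f * (i + 1) := by
  rw [coeff_pderiv]
  have : expo i j + Finsupp.single 0 1 = expo (i + 1) j := by
    ext l; fin_cases l <;> simp
  rw [this]; simp

theorem coeff_pderiv_one_expo (f : MvPolynomial (Fin 2) R) (i j : ℕ) :
    coeff (expo i j) (pderiv 1 f) = coeff (expo i (j + 1)) f * (j + 1) := by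
  rw [coeff_pderiv]
  have : expo i j + Finsupp.single 1 1 = expo i (j + 1) := by
    ext l; fin_cases l <;> simp
  rw [this]; simp

theorem aeval_eq_sum_fin_two {A : Type*} [CommRing A] [Algebra R A] (x y : A)
    (f : MvPolynomial (Fin 2) R) :
    aeval ![x, y] f = ∑ d ∈ f.support, algebraMap R A (coeff d f) * (x ^ d 0 * y ^ d 1) := by
  rw [aeval_def, eval₂_eq']
  simp [Fin.prod_univ_two]

end Weight

/-! ### Affine substitutions and degrees under substitution. -/

section Affine

variable {k : Type*} [Field k]

theorem algHom_eq_one {φ : MvPolynomial (Fin 2) k →ₐ[k] MvPolynomial (Fin 2) k}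
    (h0 : φ (X 0) = X 0) (h1 : φ (X 1) = X 1) : φ = 1 := by
  refine algHom_ext fun i => ?_
  fin_cases i
  · exact h0
  · exact h1

theorem bijective_of_mul_eq_one {φ ψ : MvPolynomial (Fin 2) k →ₐ[k] MvPolynomial (Fin 2) k}
    (h1 : φ * ψ = 1) (h2 : ψ * φ = 1) : Function.Bijective φ := by
  refine Function.bijective_iff_has_inverse.2 ⟨ψ, fun x => ?_, fun x => ?_⟩
  · exact DFunLike.congr_fun h2 x
  · exact DFunLike.congr_fun h1 x

theorem bijective_of_mul_left {φ ψ ρ : MvPolynomial (Fin 2) k →ₐ[k] MvPolynomial (Fin 2) k}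
    (h1 : φ * ψ = 1) (h2 : ψ * φ = 1) (h : Function.Bijective (ψ * ρ)) :
    Function.Bijective ρ := by
  have : ρ = φ * (ψ * ρ) := by rw [← mul_assoc, h1, one_mul]
  rw [this]
  exact (bijective_of_mul_eq_one h1 h2).comp h

theorem endo_C (φ : MvPolynomial (Fin 2) k →ₐ[k] MvPolynomial (Fin 2) k) (c : k) :
    φ (C c) = C c := φ.commutes c

theorem exists_endo (g₀ g₁ : MvPolynomial (Fin 2) k) :
    ∃ ψ : MvPolynomial (Fin 2) k →ₐ[k] MvPolynomial (Fin 2) k, ψ (X 0) = g₀ ∧ ψ (X 1) = g₁ :=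
  ⟨aeval ![g₀, g₁], by rw [aeval_X, Matrix.cons_val_zero],
    by rw [aeval_X, Matrix.cons_val_one, Matrix.cons_val_zero]⟩

theorem affine_combination (a b e c d f r s t : k) :
    C r * (C a * X 0 + C b * X 1 + C e) + C s * (C c * X 0 + C d * X 1 + C f) + C t =
      (C (r * a + s * c) * X 0 + C (r * b + s * d) * X 1 + C (r * e + s * f + t) :
        MvPolynomial (Fin 2) k) := by
  simp only [C_add, C_mul]; ring

theorem IsAffineMap.exists_inverse {φ : MvPolynomial (Fin 2) k →ₐ[k] MvPolynomial (Fin 2) k}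
    (hφ : IsAffineMap φ) : ∃ ψ : MvPolynomial (Fin 2) k →ₐ[k] MvPolynomial (Fin 2) k,
      IsAffineMap ψ ∧ φ * ψ = 1 ∧ ψ * φ = 1 := by
  obtain ⟨a, b, e, c, d, f, hD, h0, h1⟩ := hφ
  obtain ⟨D, hDdef⟩ : ∃ D, D = a * d - b * c := ⟨_, rfl⟩
  rw [← hDdef] at hD
  have x0 : (C 1 * X 0 + C 0 * X 1 + C 0 : MvPolynomial (Fin 2) k) = X 0 := by simp
  have x1 : (C 0 * X 0 + C 1 * X 1 + C 0 : MvPolynomial (Fin 2) k) = X 1 := by simp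
  -- The inverse affine map, by Cramer's rule with determinant `D`.
  obtain ⟨ψ, hψ0, hψ1⟩ : ∃ ψ : MvPolynomial (Fin 2) k →ₐ[k] MvPolynomial (Fin 2) k,
      ψ (X 0) = C (d / D) * X 0 + C (-b / D) * X 1 + C ((b * f - d * e) / D) ∧
      ψ (X 1) = C (-c / D) * X 0 + C (a / D) * X 1 + C ((c * e - a * f) / D) :=
    exists_endo _ _
  refine ⟨ψ, ⟨_, _, _, _, _, _, ?_, hψ0, hψ1⟩, algHom_eq_one ?_ ?_, algHom_eq_one ?_ ?_⟩
  · have : d / D * (a / D) - -b / D * (-c / D) = 1 / D := by field_simp; rw [hDdef]; ring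
    rw [this]; exact one_div_ne_zero hD
  · rw [AlgHom.mul_apply, hψ0]
    simp only [map_add, map_mul, endo_C, h0, h1]
    rw [affine_combination, ← x0]
    congr 3 <;> congr 1 <;> field_simp <;> (try rw [hDdef]) <;> ring
  · rw [AlgHom.mul_apply, hψ1]
    simp only [map_add, map_mul, endo_C, h0, h1]
    rw [affine_combination, ← x1]
    congr 3 <;> congr 1 <;> field_simp <;> (try rw [hDdef]) <;> ring
  · rw [AlgHom.mul_apply, h0]
    simp only [map_add, map_mul, endo_C, hψ0, hψ1]
    rw [affine_combination, ← x0]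
    congr 3 <;> congr 1 <;> field_simp <;> (try rw [hDdef]) <;> ring
  · rw [AlgHom.mul_apply, h1]
    simp only [map_add, map_mul, endo_C, hψ0, hψ1]
    rw [affine_combination, ← x1]
    congr 3 <;> congr 1 <;> field_simp <;> (try rw [hDdef]) <;> ring

/-- A monomial is sent to a polynomial whose degree is at most the (n, m)-weight of that monomial.
This converts weighted bounds into bounds on the total degree. -/
theorem totalDegree_algHom_le {φ : MvPolynomial (Fin 2) k →ₐ[k] MvPolynomial (Fin 2) k}
    {n m N : ℕ} (h0 : (φ (X 0)).totalDegree ≤ n) (h1 : (φ (X 1)).totalDegree ≤ m)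
    {f : MvPolynomial (Fin 2) k} (hf : wdeg n m f ≤ N) : (φ f).totalDegree ≤ N := by
  have hφ : φ = aeval ![φ (X 0), φ (X 1)] := by
    refine algHom_ext fun i => ?_
    fin_cases i <;> simp
  rw [hφ, aeval_eq_sum_fin_two]
  refine totalDegree_finsetSum_le fun d hd => ?_
  refine (totalDegree_mul _ _).trans ?_
  have e1 : (algebraMap k (MvPolynomial (Fin 2) k) (coeff d f)).totalDegree = 0 := totalDegree_C _
  rw [e1, zero_add]
  refine (totalDegree_mul _ _).trans ?_
  have e2 := (totalDegree_pow (φ (X 0)) (d 0)).trans (Nat.mul_le_mul_left (d 0) h0)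
  have e3 := (totalDegree_pow (φ (X 1)) (d 1)).trans (Nat.mul_le_mul_left (d 1) h1)
  have e4 := (le_wdeg (n := n) (m := m) hd).trans hf
  rw [wt_apply] at e4
  linarith [mul_comm n (d 0), mul_comm m (d 1)]

theorem IsAffineMap.totalDegree_le {φ : MvPolynomial (Fin 2) k →ₐ[k] MvPolynomial (Fin 2) k}
    (hφ : IsAffineMap φ) (f : MvPolynomial (Fin 2) k) :
    (φ f).totalDegree ≤ f.totalDegree := by
  have key : ∀ a b c : k, (C a * X 0 + C b * X 1 + C c : MvPolynomial (Fin 2) k).totalDegree ≤ 1 := by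
    intro a b c
    refine (totalDegree_add _ _).trans (max_le ((totalDegree_add _ _).trans (max_le ?_ ?_)) ?_)
    · refine (totalDegree_mul _ _).trans ?_
      rw [totalDegree_C, totalDegree_X]
    · refine (totalDegree_mul _ _).trans ?_
      rw [totalDegree_C, totalDegree_X]
    · rw [totalDegree_C]; exact Nat.zero_le _
  obtain ⟨a, b, e, c, d, f', hD, h0, h1⟩ := hφ
  refine totalDegree_algHom_le (n := 1) (m := 1) ?_ ?_ (totalDegree_eq_wdeg f).ge
  · rw [h0]; exact key _ _ _
  · rw [h1]; exact key _ _ _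

end Affine

/-! ### Jacobian matrices of `p`-morphisms as continued fractions. -/

section JacobianMatrix

variable {k : Type*} [Field k]

/-- The Jacobian matrix of an endomorphism. -/
noncomputable def jacMat (φ : MvPolynomial (Fin 2) k →ₐ[k] MvPolynomial (Fin 2) k) :
    Matrix (Fin 2) (Fin 2) (MvPolynomial (Fin 2) k) :=
  Matrix.of fun i j => pderiv j (φ (X i))

/-- The order of the factors is reversed: composing with a generator on the right multiplies the
Jacobian matrix on the left. -/
theorem jacMat_mul (φ ψ : MvPolynomial (Fin 2) k →ₐ[k] MvPolynomial (Fin 2) k) :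
    jacMat (φ * ψ) = (jacMat ψ).map φ * jacMat φ := by
  ext1 i j
  simp only [jacMat, Matrix.of_apply, AlgHom.mul_apply, Matrix.mul_apply, Fin.sum_univ_two,
    Matrix.map_apply]
  exact pderiv_algHom_apply φ j (ψ (X i))

/-- `constMat A` is the constant matrix with entries from `A`. -/
noncomputable def constMat (A : Matrix (Fin 2) (Fin 2) k) :
    Matrix (Fin 2) (Fin 2) (MvPolynomial (Fin 2) k) := A.map C

theorem constMat_mul (A B : Matrix (Fin 2) (Fin 2) k) :
    constMat (A * B) = constMat A * constMat B := Matrix.map_mul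

theorem constMat_one : constMat (1 : Matrix (Fin 2) (Fin 2) k) = 1 :=
  Matrix.map_one _ (map_zero _) (map_one _)

theorem constMat_map (A : Matrix (Fin 2) (Fin 2) k)
    (φ : MvPolynomial (Fin 2) k →ₐ[k] MvPolynomial (Fin 2) k) :
    (constMat A).map φ = constMat A := by
  ext1 i j
  simp [constMat]

/-- The matrix `[[q, 1], [1, 0]]`. -/
noncomputable def swapMat (q : MvPolynomial (Fin 2) k) :
    Matrix (Fin 2) (Fin 2) (MvPolynomial (Fin 2) k) := !![q, 1; 1, 0]

/-- The matrix `[[1, q], [0, 1]]`. -/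
noncomputable def elemMat (q : MvPolynomial (Fin 2) k) :
    Matrix (Fin 2) (Fin 2) (MvPolynomial (Fin 2) k) := !![1, q; 0, 1]

noncomputable def prodSwap (L : List (MvPolynomial (Fin 2) k)) :
    Matrix (Fin 2) (Fin 2) (MvPolynomial (Fin 2) k) := (L.map swapMat).prod

theorem prodSwap_map (L : List (MvPolynomial (Fin 2) k))
    (φ : MvPolynomial (Fin 2) k →ₐ[k] MvPolynomial (Fin 2) k) :
    (prodSwap L).map φ = prodSwap (L.map φ) := by
  induction L with
  | nil => simp [prodSwap]
  | cons q L ih =>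
    have e : ∀ q L, prodSwap (k := k) (q :: L) = swapMat q * prodSwap L := fun q L => by
      simp [prodSwap]
    rw [List.map_cons, e, e, Matrix.map_mul, ih]
    congr 1
    ext1 i j
    fin_cases i <;> fin_cases j <;> simp [swapMat]

/-- A polynomial which is not a constant. -/
def IsNonconst (q : MvPolynomial (Fin 2) k) : Prop := ∀ c, q ≠ C c

/-- Constant invertible matrices times products of matrices `swapMat q` with `q` nonconstant. -/
def IsSwapProduct (M : Matrix (Fin 2) (Fin 2) (MvPolynomial (Fin 2) k)) : Prop :=
  ∃ (A B : Matrix (Fin 2) (Fin 2) k) (L : List (MvPolynomial (Fin 2) k)),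
    A.det ≠ 0 ∧ B.det ≠ 0 ∧ (∀ q ∈ L, IsNonconst q) ∧ M = constMat A * prodSwap L * constMat B

theorem IsSwapProduct.const_mul {M : Matrix (Fin 2) (Fin 2) (MvPolynomial (Fin 2) k)}
    (hM : IsSwapProduct M) {A : Matrix (Fin 2) (Fin 2) k} (hA : A.det ≠ 0) :
    IsSwapProduct (constMat A * M) := by
  obtain ⟨A', B, L, hA', hB, hL, rfl⟩ := hM
  refine ⟨A * A', B, L, by rw [Matrix.det_mul]; exact mul_ne_zero hA hA', hB, hL, ?_⟩
  rw [constMat_mul]; simp only [Matrix.mul_assoc]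

theorem prodSwap_cons (q : MvPolynomial (Fin 2) k) (L : List (MvPolynomial (Fin 2) k)) :
    prodSwap (q :: L) = swapMat q * prodSwap L := by simp [prodSwap]

theorem prodSwap_concat (q : MvPolynomial (Fin 2) k) (L : List (MvPolynomial (Fin 2) k)) :
    prodSwap (L ++ [q]) = prodSwap L * swapMat q := by simp [prodSwap]

theorem constMat_eq (a b c d : k) :
    constMat !![a, b; c, d] = !![C a, C b; C c, C d] := by
  ext1 i j
  fin_cases i <;> fin_cases j <;> simp [constMat]

/-- Constant upper triangular matrices normalize the group of the `elemMat q`. -/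
theorem elemMat_mul_upper (q : MvPolynomial (Fin 2) k) (a b d : k) (ha : a ≠ 0) :
    elemMat q * constMat !![a, b; 0, d] = constMat !![a, b; 0, d] * elemMat (C (d / a) * q) := by
  have : (C a * C (d / a) : MvPolynomial (Fin 2) k) = C d := by
    rw [← C_mul]; congr 1; field_simp
  rw [constMat_eq]
  simp only [elemMat, Matrix.mul_fin_two, mul_one, mul_zero, one_mul, zero_mul, zero_add, add_zero,
    map_zero, ← mul_assoc, this]
  congr 3
  ring_nf

/-- Bruhat decomposition: for `c ≠ 0` the constant matrix is `elemMat (a / c)` times an antidiagonal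
matrix times `elemMat (d / c)`. The left unipotent factor merges with `elemMat q`, and commuting it
past the diagonal part leaves one new swap factor. -/
theorem elemMat_mul_lower (q : MvPolynomial (Fin 2) k) (a b c d : k) (hc : c ≠ 0)
    (hD : a * d - b * c ≠ 0) :
    elemMat q * constMat !![a, b; c, d] = constMat !![(b * c - a * d) / c, 0; 0, c] *
      swapMat (C (c / ((b * c - a * d) / c)) * (q + C (a / c))) * elemMat (C (d / c)) := by
  have hD' : b * c - a * d ≠ 0 := fun h => hD (by linear_combination -h)
  set δ := (b * c - a * d) / c with hδ
  have hδ0 : δ ≠ 0 := div_ne_zero hD' hc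
  have e1 : (C δ * C (c / δ) : MvPolynomial (Fin 2) k) = C c := by
    rw [← C_mul]; congr 1; field_simp
  have e2 : (C c * C (a / c) : MvPolynomial (Fin 2) k) = C a := by
    rw [← C_mul]; congr 1; field_simp
  have e3 : (C c * C (d / c) : MvPolynomial (Fin 2) k) = C d := by
    rw [← C_mul]; congr 1; field_simp
  have e4 : (C a * C (d / c) + C δ : MvPolynomial (Fin 2) k) = C b := by
    rw [← C_mul, ← C_add]; congr 1; rw [hδ]; field_simp; ring
  rw [constMat_eq, constMat_eq]
  simp only [elemMat, swapMat, Matrix.mul_fin_two]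
  ext1 i j
  fin_cases i <;> fin_cases j <;> simp
  · linear_combination (-(q + C (a / c))) * e1 - e2
  · linear_combination (-e4 - C (d / c) * e2 - q * e3 - C (d / c) * (q + C (a / c)) * e1)
  · exact e3.symm

theorem elemMat_mul_swapMat (r q : MvPolynomial (Fin 2) k) :
    elemMat r * swapMat q = swapMat (q + r) := by
  simp [elemMat, swapMat]

theorem IsNonconst.add_C {q : MvPolynomial (Fin 2) k} (hq : IsNonconst q) (c : k) :
    IsNonconst (q + C c) := fun d h => hq (d - c) (by rw [C_sub, ← h]; ring)

theorem IsNonconst.C_mul {q : MvPolynomial (Fin 2) k} (hq : IsNonconst q) {c : k} (hc : c ≠ 0) :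
    IsNonconst (C c * q) := fun d h => hq (c⁻¹ * d) (by
  rw [MvPolynomial.C_mul, ← h, ← mul_assoc, ← MvPolynomial.C_mul, inv_mul_cancel₀ hc]; simp)

/-- If `A` is upper triangular, `elemMat q` slides through it and is added to the first partial
quotient; otherwise the Bruhat decomposition of `A` creates a new partial quotient. -/
theorem IsSwapProduct.elem_mul {M : Matrix (Fin 2) (Fin 2) (MvPolynomial (Fin 2) k)}
    (hM : IsSwapProduct M) (q : MvPolynomial (Fin 2) k) :
    IsSwapProduct (elemMat q * M) := by
  by_cases hq : IsNonconst q
  swap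
  · unfold IsNonconst at hq
    push Not at hq
    obtain ⟨c, rfl⟩ := hq
    have : elemMat (C c) = constMat !![1, c; 0, 1] := by rw [constMat_eq]; simp [elemMat]
    rw [this]
    exact hM.const_mul (by simp [Matrix.det_fin_two])
  obtain ⟨A, B, L, hA, hB, hL, rfl⟩ := hM
  cases L with
  | nil =>
    refine ⟨1, !![0, 1; 1, 0] * (A * B), [q], by simp, ?_, by simpa using hq, ?_⟩
    · rw [Matrix.det_mul, Matrix.det_mul]
      refine mul_ne_zero ?_ (mul_ne_zero hA hB)
      simp [Matrix.det_fin_two]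
    · have : elemMat q = swapMat q * constMat !![0, 1; 1, 0] := by
        rw [constMat_eq]; simp [elemMat, swapMat]
      rw [this, constMat_mul, constMat_mul, constMat_one]
      simp [prodSwap, Matrix.mul_assoc]
  | cons q₁ L =>
    obtain ⟨a, b, c, d, rfl⟩ : ∃ a b c d, A = !![a, b; c, d] := ⟨_, _, _, _, Matrix.eta_fin_two A⟩
    rw [Matrix.det_fin_two_of] at hA
    have hL' : ∀ q ∈ L, IsNonconst q := fun q hq => hL q (List.mem_cons_of_mem _ hq)
    have hq₁ : IsNonconst q₁ := hL q₁ (List.mem_cons_self ..)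
    by_cases hc : c = 0
    · subst hc
      have ha : a ≠ 0 := fun h => hA (by rw [h]; ring)
      have e : elemMat q * (constMat !![a, b; 0, d] * prodSwap (q₁ :: L) * constMat B) =
          constMat !![a, b; 0, d] * swapMat (q₁ + C (d / a) * q) * prodSwap L * constMat B := by
        rw [prodSwap_cons, ← elemMat_mul_swapMat]
        simp only [← Matrix.mul_assoc]
        rw [elemMat_mul_upper q a b d ha]
      by_cases h : IsNonconst (q₁ + C (d / a) * q)
      · refine ⟨!![a, b; 0, d], B, (q₁ + C (d / a) * q) :: L, by rwa [Matrix.det_fin_two_of], hB,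
          ?_, ?_⟩
        · intro r hr
          rcases List.mem_cons.1 hr with rfl | hr
          · exact h
          · exact hL' r hr
        · rw [e, prodSwap_cons]; simp only [Matrix.mul_assoc]
      -- The first partial quotient has become a constant, so its swap matrix is constant and
      -- invertible and is absorbed into `A`.
      · unfold IsNonconst at h
        push Not at h
        obtain ⟨c, h⟩ := h
        refine ⟨!![a, b; 0, d] * !![c, 1; 1, 0], B, L, ?_, hB, hL', ?_⟩
        · rw [Matrix.det_mul, Matrix.det_fin_two_of, Matrix.det_fin_two_of]
          simpa using hA
        · rw [e, h, constMat_mul]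
          congr 3
          rw [constMat_eq]; simp [swapMat]
    · have hD' : b * c - a * d ≠ 0 := fun h => hA (by linear_combination -h)
      refine ⟨!![(b * c - a * d) / c, 0; 0, c], B,
        C (c / ((b * c - a * d) / c)) * (q + C (a / c)) :: (q₁ + C (d / c)) :: L, ?_, hB, ?_, ?_⟩
      · rw [Matrix.det_fin_two_of]
        field_simp
        simpa using hD'
      · intro r hr
        rcases List.mem_cons.1 hr with rfl | hr
        · exact (hq.add_C _).C_mul (div_ne_zero hc (div_ne_zero hD' hc))
        rcases List.mem_cons.1 hr with rfl | hr
        · exact hq₁.add_C _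
        · exact hL' r hr
      · rw [prodSwap_cons, prodSwap_cons, prodSwap_cons, ← elemMat_mul_swapMat (C (d / c))]
        simp only [← Matrix.mul_assoc]
        rw [elemMat_mul_lower q a b c d hc hA]

/-- Each generator multiplies the matrix on the left, either by an invertible constant matrix or by
a lower unitriangular one; the latter is an `elemMat` conjugated by the permutation matrix. -/
theorem IsPMorphism.isSwapProduct {p : ℕ} [CharP k p]
    {φ : MvPolynomial (Fin 2) k →ₐ[k] MvPolynomial (Fin 2) k} (hφ : IsPMorphism p φ) :
    IsSwapProduct (jacMat φ) := by
  induction hφ using Submonoid.closure_induction_right with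
  | one =>
    refine ⟨1, 1, [], by simp, by simp, by simp, ?_⟩
    ext1 i j
    fin_cases i <;> fin_cases j <;> simp [jacMat, prodSwap, constMat_one, pderiv_X]
  | mul_right ρ _ ψ hψ ih =>
    rw [jacMat_mul]
    rcases hψ with ⟨a, b, e, c, d, f, hD, h0, h1⟩ | ⟨h, h0, h1⟩
    · have : (jacMat ψ).map ρ = constMat !![a, b; c, d] := by
        rw [constMat_eq]
        ext1 i j
        fin_cases i <;> fin_cases j <;> simp [jacMat, h0, h1, pderiv_X]
      rw [this]
      exact ih.const_mul (by rwa [Matrix.det_fin_two_of])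
    · have e1 := pderiv_aeval_pow_char p h
      have hw : (!![0, 1; 1, 0] : Matrix (Fin 2) (Fin 2) k).det ≠ 0 := by
        simp [Matrix.det_fin_two_of]
      have : (jacMat ψ).map ρ = constMat !![0, 1; 1, 0] *
          elemMat (ρ (pderiv 0 (aeval ![X 0, X 1 ^ p] h))) * constMat !![0, 1; 1, 0] := by
        rw [constMat_eq]
        simp only [elemMat, Matrix.mul_fin_two]
        ext1 i j
        simp only [Matrix.map_apply, jacMat, Matrix.of_apply]
        fin_cases i <;> fin_cases j <;> 
          simp only [Fin.zero_eta, Fin.mk_one, h0, h1, map_add, e1] <;> simp [pderiv_X]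
      rw [this]
      simp only [Matrix.mul_assoc]
      exact ((ih.const_mul hw).elem_mul _).const_mul hw

end JacobianMatrix

/-! ### Rows of swap products and the variable `X 1` in the last factor. -/

section LowDegree

variable {k : Type*} [Field k]

theorem wdeg_pos_of_isNonconst {n m : ℕ} (hn : 0 < n) (hm : 0 < m) {q : MvPolynomial (Fin 2) k}
    (hq : IsNonconst q) : 0 < wdeg n m q := by
  by_contra h
  have h0 : ∀ d ∈ q.support, d = 0 := by
    intro d hd
    have h1 := le_wdeg (n := n) (m := m) hd
    rw [wt_apply] at h1
    have h2 : n * d 0 = 0 := by omega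
    have h3 : m * d 1 = 0 := by omega
    ext i
    fin_cases i
    · simpa [hn.ne'] using h2
    · simpa [hm.ne'] using h3
  refine hq (coeff 0 q) ?_
  ext d
  rw [coeff_C]
  split_ifs with hd
  · rw [hd]
  · by_contra h1
    exact hd (h0 d (mem_support_iff.2 h1)).symm

theorem IsNonconst.ne_zero {q : MvPolynomial (Fin 2) k} (hq : IsNonconst q) : q ≠ 0 :=
  fun h => hq 0 (by rw [h, map_zero])

/-- The rows `(U, V)` of constant multiples of `prodSwap L`. -/
def IsGoodRow (L : List (MvPolynomial (Fin 2) k)) (U V : MvPolynomial (Fin 2) k) : Prop :=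
  (U = 0 ∧ V ≠ 0 ∧ L = []) ∨ (U ≠ 0 ∧ ∀ θ, 0 < θ → wdeg 1 θ V ≤ wdeg 1 θ U)

/-- As for convergents of a continued fraction, appending a factor replaces `(U, V)` by `(U q + V,
U)`, and `U q` dominates because a nonconstant `q` has positive weight. A row with `U = 0` can occur
only before the first factor. -/
theorem isGoodRow_prodSwap {A : Matrix (Fin 2) (Fin 2) k} (hA : A.det ≠ 0) (i : Fin 2) :
    ∀ L : List (MvPolynomial (Fin 2) k), (∀ q ∈ L, IsNonconst q) →
      IsGoodRow L ((constMat A * prodSwap L) i 0) ((constMat A * prodSwap L) i 1) := by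
  intro L
  induction L using List.reverseRecOn with
  | nil =>
    intro _
    simp only [prodSwap, List.map_nil, List.prod_nil, Matrix.mul_one, constMat, Matrix.map_apply]
    by_cases h : A i 0 = 0
    · refine Or.inl ⟨by rw [h, map_zero], fun h1 => hA ?_, rfl⟩
      have h1 : A i 1 = 0 := by simpa using h1
      rw [Matrix.det_fin_two]
      fin_cases i <;> simp_all
    · exact Or.inr ⟨by simpa using h, fun θ _ => by rw [wdeg_C, wdeg_C]⟩
  | append_singleton L q ih =>
    intro hL
    have hq : IsNonconst q := hL q (by simp)
    have ih := ih fun r hr => hL r (by simp [hr])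
    rw [prodSwap_concat, ← Matrix.mul_assoc]
    set M := constMat A * prodSwap L with hM
    have e0 : (M * swapMat q) i 0 = M i 0 * q + M i 1 := by
      simp [Matrix.mul_apply, Fin.sum_univ_two, swapMat]
    have e1 : (M * swapMat q) i 1 = M i 0 := by
      simp [Matrix.mul_apply, Fin.sum_univ_two, swapMat]
    rw [e0, e1]
    right
    rcases ih with ⟨h1, h2, -⟩ | ⟨h1, h2⟩
    · rw [h1]
      refine ⟨by simpa using h2, fun θ _ => ?_⟩
      simp [wdeg]
    · have key : ∀ θ, 0 < θ → wdeg 1 θ (M i 0 * q + M i 1) = wdeg 1 θ (M i 0) + wdeg 1 θ q := by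
        intro θ hθ
        have h3 := wdeg_pos_of_isNonconst one_pos hθ hq
        rw [wdeg_add_eq_left, wdeg_mul hθ h1 hq.ne_zero]
        rw [wdeg_mul hθ h1 hq.ne_zero]
        have := h2 θ hθ
        omega
      refine ⟨fun h => ?_, fun θ hθ => ?_⟩
      · have h3 := key 1 one_pos
        have h4 := wdeg_pos_of_isNonconst one_pos one_pos hq
        rw [h] at h3
        simp only [wdeg, support_zero, Finset.sup_empty, bot_eq_zero'] at h3 h4
        omega
      · rw [key θ hθ]; omega

theorem natCast_ne_zero_of_lt (p : ℕ) [CharP k p] {n : ℕ} (h0 : 0 < n) (h : n < p) :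
    (n : k) ≠ 0 := by
  intro h1
  rw [CharP.cast_eq_zero_iff k p] at h1
  exact absurd (Nat.le_of_dvd h0 h1) (by omega)

/-- Positive exponents below `p` are nonzero in `k`, so in low degree a vanishing derivative means
that the variable is absent, as in characteristic zero. -/
theorem apply_one_eq_zero_of_pderiv_one_eq_zero {p : ℕ} [CharP k p] {f : MvPolynomial (Fin 2) k}
    (hf : f.totalDegree < p) (h : pderiv 1 f = 0) {d : Fin 2 →₀ ℕ} (hd : d ∈ f.support) :
    d 1 = 0 := by
  by_contra h1
  obtain ⟨j, hj⟩ := Nat.exists_eq_succ_of_ne_zero h1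
  have h2 := coeff_pderiv_one_expo f (d 0) j
  rw [h, coeff_zero] at h2
  have h3 : expo (d 0) (j + 1) = d := by rw [← Nat.succ_eq_add_one, ← hj, expo_self]
  rw [h3] at h2
  have h4 := le_totalDegree_fin_two hd
  rcases mul_eq_zero.1 h2.symm with h5 | h5
  · exact mem_support_iff.1 hd h5
  · refine natCast_ne_zero_of_lt (k := k) p (n := j + 1) (by omega) (by omega) ?_
    push_cast; exact h5

theorem apply_zero_eq_zero_of_pderiv_zero_eq_zero {p : ℕ} [CharP k p] {f : MvPolynomial (Fin 2) k}
    (hf : f.totalDegree < p) (h : pderiv 0 f = 0) {d : Fin 2 →₀ ℕ} (hd : d ∈ f.support) :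
    d 0 = 0 := by
  by_contra h1
  obtain ⟨j, hj⟩ := Nat.exists_eq_succ_of_ne_zero h1
  have h2 := coeff_pderiv_zero_expo f j (d 1)
  rw [h, coeff_zero] at h2
  have h3 : expo (j + 1) (d 1) = d := by rw [← Nat.succ_eq_add_one, ← hj, expo_self]
  rw [h3] at h2
  have h4 := le_totalDegree_fin_two hd
  rcases mul_eq_zero.1 h2.symm with h5 | h5
  · exact mem_support_iff.1 hd h5
  · refine natCast_ne_zero_of_lt (k := k) p (n := j + 1) (by omega) (by omega) ?_
    push_cast; exact h5

/-- If the last factor involves `X 1`, then the degree cannot be low. -/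
theorem false_of_last_depends {p : ℕ} [CharP k p] {f q U V : MvPolynomial (Fin 2) k} (hp : 0 < p)
    (hf : f.totalDegree < p) (h0 : pderiv 0 f = U * q + V) (h1 : pderiv 1 f = U)
    (hU : U ≠ 0) (hUV : ∀ θ, 0 < θ → wdeg 1 θ V ≤ wdeg 1 θ U)
    {d : Fin 2 →₀ ℕ} (hd : d ∈ q.support) (hd1 : d 1 ≠ 0) : False := by
  have hq0 : q ≠ 0 := by rintro rfl; simp at hd
  -- With weight `p` on `X 1`, the product `U q` exceeds `U` by at least `p`. The aim is that `f`
  -- exceeds `U` by at most `p`, although its derivative in `X 0` equals `U q + V` and is lighter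
  -- than `f`.
  have hqp : p ≤ wdeg 1 p q := by
    refine le_trans ?_ (le_wdeg hd)
    rw [wt_apply]
    nlinarith [Nat.one_le_iff_ne_zero.2 hd1]
  have e1 : wdeg 1 p (U * q + V) = wdeg 1 p U + wdeg 1 p q := by
    rw [wdeg_add_eq_left, wdeg_mul hp hU hq0]
    rw [wdeg_mul hp hU hq0]
    have := hUV p hp
    omega
  have e2 : U * q + V ≠ 0 := by
    intro h
    rw [h] at e1
    simp only [wdeg, support_zero, Finset.sup_empty, bot_eq_zero'] at e1 hqp
    omega
  have e3 := wdeg_pderiv_zero 1 p (f := f) (by rw [h0]; exact e2)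
  rw [h0, e1] at e3
  -- the derivative with respect to `X 1` lowers the weight by exactly `p`
  obtain ⟨a, ha, hw⟩ : ∃ a ∈ f.support, wt 1 p a = wdeg 1 p f :=
    exists_wt_eq_wdeg 1 p (by rintro rfl; simp at h1; exact hU h1.symm)
  have hale := le_totalDegree_fin_two ha
  -- Without `X 1` the top monomial would have weight below `p`, while `U ≠ 0` gives a monomial of
  -- `f` divisible by `X 1`.
  have ha1 : a 1 ≠ 0 := by
    intro ha1
    obtain ⟨b, hb, -⟩ := exists_wt_eq_wdeg 1 p hU
    rw [← h1] at hb
    have h3 := add_single_mem_support_of_pderiv hb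
    have h4 := le_wdeg (n := 1) (m := p) h3
    rw [← hw, wt_apply, wt_apply, ha1] at h4
    simp at h4
    have : p ≤ p * (b 1 + 1) := Nat.le_mul_of_pos_right _ (by omega)
    omega
  obtain ⟨j, hj⟩ := Nat.exists_eq_succ_of_ne_zero ha1
  have h3 : expo (a 0) (j + 1) = a := by rw [← Nat.succ_eq_add_one, ← hj, expo_self]
  have h4 : expo (a 0) j ∈ U.support := by
    rw [← h1, mem_support_iff, coeff_pderiv_one_expo, h3]
    refine mul_ne_zero (mem_support_iff.1 ha) ?_
    have := natCast_ne_zero_of_lt (k := k) p (n := j + 1) (by omega) (by omega)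
    push_cast at this; exact this
  have h5 := le_wdeg (n := 1) (m := p) h4
  rw [wt_apply] at hw h5
  rw [hj] at hw
  simp only [expo_zero, expo_one] at h5
  have : p * j.succ = p * j + p := by rw [Nat.mul_succ]
  omega

end LowDegree

/-! ### A last factor in `X 0` alone, and the descent for `p`-morphisms. -/

section LowDegree

variable {k : Type*} [Field k]

theorem coeff_aeval_X_zero (q : Polynomial k) (d : Fin 2 →₀ ℕ) :
    coeff d (Polynomial.aeval (X 0 : MvPolynomial (Fin 2) k) q) =
      if d 1 = 0 then q.coeff (d 0) else 0 := by
  classical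
  rw [Polynomial.aeval_eq_sum_range, coeff_sum]
  simp only [coeff_smul, coeff_X_pow, smul_eq_mul, mul_ite, mul_one, mul_zero]
  split_ifs with h
  · by_cases h' : d 0 ∈ Finset.range (q.natDegree + 1)
    · rw [Finset.sum_eq_single (d 0)]
      · rw [if_pos]
        ext i; fin_cases i <;> simp [h]
      · intro b _ hb
        rw [if_neg]
        rintro rfl
        simp at hb
      · exact fun h => absurd h' h
    · rw [Finset.mem_range, not_lt] at h'
      rw [Polynomial.coeff_eq_zero_of_natDegree_lt (by omega)]
      refine Finset.sum_eq_zero fun i hi => if_neg ?_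
      rintro rfl
      simp at hi h'
      omega
  · refine Finset.sum_eq_zero fun i _ => if_neg ?_
    rintro rfl
    simp at h

theorem exists_eq_aeval_X_zero {q : MvPolynomial (Fin 2) k} (hq : ∀ d ∈ q.support, d 1 = 0) :
    ∃ r : Polynomial k, q = Polynomial.aeval (X 0) r := by
  refine ⟨∑ d ∈ q.support, Polynomial.monomial (d 0) (coeff d q), ?_⟩
  rw [map_sum]
  conv_lhs => rw [← support_sum_monomial_coeff q]
  refine Finset.sum_congr rfl fun d hd => ?_
  rw [Polynomial.aeval_monomial, monomial_eq, Finsupp.prod_fintype _ _ (fun _ => pow_zero _),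
    Fin.prod_univ_two, hq d hd, pow_zero, mul_one]
  rfl

/-- For the weights `(1, t + 1)` the derivative in `X 1` loses `t + 1` and multiplication by `q`
gains `t`, so both sides of `h0` can meet at weight `W - 1`. On the top edge of `f` this relation
trades a factor `X 1` for `X 0 ^ (t + 1)` until the monomial `X 0 ^ W` appears, whence `W ≤ deg f <
p`. -/
theorem wdeg_lt_of_last_univariate {p : ℕ} [CharP k p] {f U V : MvPolynomial (Fin 2) k}
    {q : Polynomial k} (hq : 0 < q.natDegree) (hf : f.totalDegree < p)
    (h0 : pderiv 0 f = U * Polynomial.aeval (X 0) q + V) (h1 : pderiv 1 f = U)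
    (hU : U ≠ 0) (hUV : ∀ θ, 0 < θ → wdeg 1 θ V ≤ wdeg 1 θ U) :
    wdeg 1 (q.natDegree + 1) f < p := by
  set t := q.natDegree with ht
  set W := wdeg 1 (t + 1) f with hW
  have hUW : wdeg 1 (t + 1) U + (t + 1) ≤ W := by
    rw [← h1]; exact wdeg_pderiv_one 1 (t + 1) (by rwa [h1])
  have hVW := hUV (t + 1) (by omega)
  -- The weight of `V` is at most `W - (t + 1)`, which is less than `W - 1` because `t > 0`.
  have hV : ∀ d : Fin 2 →₀ ℕ, wt 1 (t + 1) d + 1 = W → coeff d V = 0 := by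
    intro d hd
    by_contra h
    have := le_wdeg (n := 1) (m := t + 1) (mem_support_iff.2 h)
    omega
  have hcast : ∀ n : ℕ, n + 1 < p → ((n : k) + 1) ≠ 0 := by
    intro n hn
    have := natCast_ne_zero_of_lt (k := k) p (n := n + 1) (by omega) hn
    push_cast at this; exact this
  have hmemU : ∀ a ∈ U.support, expo (a 0) (a 1 + 1) ∈ f.support := by
    intro a ha
    rw [← h1] at ha
    have := add_single_mem_support_of_pderiv ha
    have e : a + Finsupp.single 1 1 = expo (a 0) (a 1 + 1) := by
      ext i; fin_cases i <;> simp
    rwa [e] at this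
  have hmemq : ∀ b ∈ (Polynomial.aeval (X 0 : MvPolynomial (Fin 2) k) q).support,
      b 1 = 0 ∧ b 0 ≤ t := by
    intro b hb
    rw [mem_support_iff, coeff_aeval_X_zero] at hb
    by_cases hb1 : b 1 = 0
    · rw [if_pos hb1] at hb
      exact ⟨hb1, Polynomial.le_natDegree_of_ne_zero hb⟩
    · rw [if_neg hb1] at hb
      exact absurd rfl hb
  -- moving up along the top edge
  have up : ∀ α β : ℕ, expo (α + 1) β ∈ f.support → α + 1 + (t + 1) * β = W →
      ∃ α', α' < α + 1 ∧ expo α' (β + 1) ∈ f.support ∧ α' + (t + 1) * (β + 1) = W := by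
    intro α β hmem hw
    have hdeg := le_totalDegree_fin_two hmem
    simp only [expo_zero, expo_one] at hdeg
    have e1 : coeff (expo α β) (pderiv 0 f) ≠ 0 := by
      rw [coeff_pderiv_zero_expo]
      exact mul_ne_zero (mem_support_iff.1 hmem) (hcast α (by omega))
    rw [h0, coeff_add, hV (expo α β) (by rw [wt_apply]; simp; omega), add_zero] at e1
    obtain ⟨a, ha, b, hb, hab⟩ := exists_add_of_mem_support_mul (mem_support_iff.2 e1)
    obtain ⟨hb1, hb0⟩ := hmemq b hb
    have hab0 : a 0 + b 0 = α := by
      have := DFunLike.congr_fun hab 0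
      simpa using this
    have hab1 : a 1 = β := by
      have := DFunLike.congr_fun hab 1
      simpa [hb1] using this
    have hm := hmemU a ha
    have hle := le_wdeg (n := 1) (m := t + 1) hm
    rw [wt_apply, ← hW] at hle
    simp only [expo_zero, expo_one, hab1] at hle hm
    have e : (t + 1) * (β + 1) = (t + 1) * β + (t + 1) := by ring
    exact ⟨a 0, by omega, hm, by omega⟩
  -- moving down along the top edge
  have down : ∀ α β : ℕ, expo α (β + 1) ∈ f.support → α + (t + 1) * (β + 1) = W →
      expo (α + t + 1) β ∈ f.support ∧ (α + t + 1) + (t + 1) * β = W := by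
    intro α β hmem hw
    have e : (t + 1) * (β + 1) = (t + 1) * β + (t + 1) := by ring
    refine ⟨?_, by omega⟩
    have hdeg := le_totalDegree_fin_two hmem
    simp only [expo_zero, expo_one] at hdeg
    have e1 : coeff (expo α β) U ≠ 0 := by
      rw [← h1, coeff_pderiv_one_expo]
      exact mul_ne_zero (mem_support_iff.1 hmem) (hcast β (by omega))
    have e2 : coeff (expo (α + t) β) (U * Polynomial.aeval (X 0) q) =
        coeff (expo α β) U * q.coeff t := by
      classical
      rw [coeff_mul, Finset.sum_eq_single (expo α β, expo t 0)]
      · rw [coeff_aeval_X_zero]; simp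
      -- The weight bound gives `a 0 ≤ α` and the degree of `q` gives `b 0 ≤ t`, so only the extreme
      -- pair can add up to `α + t`.
      · rintro ⟨a, b⟩ hab hne
        rw [Finset.HasAntidiagonal.mem_antidiagonal] at hab
        by_contra hc
        obtain ⟨hb1, hb0⟩ := hmemq b (mem_support_iff.2 (right_ne_zero_of_mul hc))
        have hm := hmemU a (mem_support_iff.2 (left_ne_zero_of_mul hc))
        have hle := le_wdeg (n := 1) (m := t + 1) hm
        rw [wt_apply, ← hW] at hle
        have hab0 : a 0 + b 0 = α + t := by
          have := DFunLike.congr_fun hab 0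
          simpa using this
        have hab1 : a 1 = β := by
          have := DFunLike.congr_fun hab 1
          simpa [hb1] using this
        simp only [expo_zero, expo_one, hab1] at hle
        apply hne
        rw [← expo_self a, ← expo_self b, hb1, hab1]
        have : b 0 = t := by omega
        rw [this, show a 0 = α by omega]
      · intro h
        rw [Finset.HasAntidiagonal.mem_antidiagonal, expo_add] at h
        exact absurd rfl h
    have e3 : coeff (expo (α + t) β) (pderiv 0 f) ≠ 0 := by
      rw [h0, coeff_add, hV (expo (α + t) β) (by rw [wt_apply]; simp; omega), add_zero, e2]
      refine mul_ne_zero e1 ?_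
      rw [ht, Polynomial.coeff_natDegree]
      intro h
      rw [Polynomial.leadingCoeff_eq_zero] at h
      rw [h] at ht
      simp at ht
      omega
    rw [coeff_pderiv_zero_expo] at e3
    exact mem_support_iff.2 (left_ne_zero_of_mul e3)
  have exists_vertical : ∀ α β : ℕ, expo α β ∈ f.support → α + (t + 1) * β = W →
      ∃ β', expo 0 β' ∈ f.support ∧ (t + 1) * β' = W := by
    intro α
    induction α using Nat.strong_induction_on with
    | _ α ih =>
      intro β hmem hw
      rcases α with _ | α
      · exact ⟨β, hmem, by omega⟩
      · obtain ⟨α', hlt, hmem', hw'⟩ := up α β hmem hw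
        exact ih α' hlt (β + 1) hmem' hw'
  have exists_horizontal : ∀ β α : ℕ, expo α β ∈ f.support → α + (t + 1) * β = W →
      expo W 0 ∈ f.support := by
    intro β
    induction β with
    | zero => intro α hmem hw; rw [← hw]; simpa using hmem
    | succ β ih =>
      intro α hmem hw
      obtain ⟨h2, h3⟩ := down α β hmem hw
      exact ih _ h2 h3
  have hf0 : f ≠ 0 := by rintro rfl; simp at h1; exact hU h1.symm
  obtain ⟨d, hd, hw⟩ := exists_wt_eq_wdeg 1 (t + 1) hf0
  have hmem : expo (d 0) (d 1) ∈ f.support := by rwa [expo_self]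
  have hlast := exists_horizontal (d 1) (d 0) hmem (by rw [hW, ← hw, wt_apply]; ring)
  have := le_totalDegree_fin_two hlast
  simp at this
  omega

/-- Termwise integration: all denominators are at most `q.natDegree + 1 < p`. -/
theorem exists_polynomial_derivative_eq {p : ℕ} [CharP k p] (q : Polynomial k)
    (hq : q.natDegree + 1 < p) :
    ∃ Q : Polynomial k, Polynomial.derivative Q = q ∧ Q.natDegree ≤ q.natDegree + 1 := by
  refine ⟨∑ i ∈ Finset.range (q.natDegree + 1),
    Polynomial.monomial (i + 1) (q.coeff i / ((i + 1 : ℕ) : k)), ?_, ?_⟩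
  · rw [map_sum]
    conv_rhs => rw [q.as_sum_range]
    refine Finset.sum_congr rfl fun i hi => ?_
    rw [Finset.mem_range] at hi
    rw [Polynomial.derivative_monomial, Nat.add_sub_cancel,
      div_mul_cancel₀ _ (natCast_ne_zero_of_lt (k := k) p (by omega) (by omega))]
  · refine Polynomial.natDegree_sum_le_of_forall_le _ _ fun i hi => ?_
    rw [Finset.mem_range] at hi
    exact (Polynomial.natDegree_monomial_le _).trans (by omega)

theorem pderiv_polynomial_aeval (j : Fin 2) (u : MvPolynomial (Fin 2) k) (Q : Polynomial k) :
    pderiv j (Polynomial.aeval u Q) =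
      Polynomial.aeval u (Polynomial.derivative Q) * pderiv j u := by
  rw [Derivation.map_aeval, smul_eq_mul]

theorem totalDegree_polynomial_aeval_le (Q : Polynomial k) {u : MvPolynomial (Fin 2) k} {d N : ℕ}
    (hu : u.totalDegree ≤ d) (hN : d * Q.natDegree ≤ N) :
    (Polynomial.aeval u Q).totalDegree ≤ N := by
  rw [Polynomial.aeval_eq_sum_range]
  refine totalDegree_finsetSum_le fun i hi => ?_
  rw [Finset.mem_range] at hi
  refine (totalDegree_smul_le _ _).trans ((totalDegree_pow _ _).trans ?_)
  calc i * u.totalDegree ≤ Q.natDegree * d := Nat.mul_le_mul (by omega) hu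
    _ ≤ N := by rwa [mul_comm]

theorem constMat_mul_prodSwap_ne_zero_row {M : Matrix (Fin 2) (Fin 2) (MvPolynomial (Fin 2) k)}
    {φ : MvPolynomial (Fin 2) k →ₐ[k] MvPolynomial (Fin 2) k}
    (hJ : IsJacobianPair (φ (X 0)) (φ (X 1))) (q : MvPolynomial (Fin 2) k)
    (hM : jacMat φ = M * swapMat q) : ∃ i, M i 0 ≠ 0 := by
  by_contra h
  push Not at h
  obtain ⟨c, hc, hJ⟩ := hJ
  have e : ∀ i, pderiv 1 (φ (X i)) = 0 := by
    intro i
    have : jacMat φ i 1 = M i 0 := by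
      rw [hM]; simp [Matrix.mul_apply, Fin.sum_univ_two, swapMat]
    rw [← h i, ← this]; rfl
  rw [jacobianDet, e 0, e 1] at hJ
  simp at hJ
  exact hc (by simpa using hJ.symm)

/-- After the linear part is subtracted, both derivatives vanish and the degree is below `p`, so
only a constant is left and the map is affine. -/
theorem bijective_of_jacMat_const {p : ℕ} [Fact p.Prime] [CharP k p]
    {φ : MvPolynomial (Fin 2) k →ₐ[k] MvPolynomial (Fin 2) k} {A : Matrix (Fin 2) (Fin 2) k}
    (hA : A.det ≠ 0) (hφ : jacMat φ = constMat A) (hlow : ∀ i, (φ (X i)).totalDegree < p) :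
    Function.Bijective φ := by
  have key : ∀ i, φ (X i) = C (A i 0) * X 0 + C (A i 1) * X 1 + C (coeff 0 (φ (X i))) := by
    intro i
    set g := φ (X i) - (C (A i 0) * X 0 + C (A i 1) * X 1) with hg
    have e0 : pderiv 0 (φ (X i)) = C (A i 0) := congrFun (congrFun hφ i) 0
    have e1 : pderiv 1 (φ (X i)) = C (A i 1) := congrFun (congrFun hφ i) 1
    have hp := hlow i
    have g0 : pderiv 0 g = 0 := by simp [hg, e0, pderiv_X]
    have g1 : pderiv 1 g = 0 := by simp [hg, e1, pderiv_X]
    have hp1 : 1 < p := (Fact.out : p.Prime).one_lt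
    have hgp : g.totalDegree < p := by
      rw [hg]
      refine lt_of_le_of_lt (totalDegree_sub _ _) (max_lt hp ?_)
      refine lt_of_le_of_lt (totalDegree_add _ _) (max_lt ?_ ?_)
      all_goals
        refine lt_of_le_of_lt (totalDegree_mul _ _) ?_
        rw [totalDegree_C, totalDegree_X]
        omega
    have hconst : g = C (coeff 0 g) := by
      ext d
      rw [coeff_C]
      split_ifs with hd
      · rw [hd]
      · by_contra h
        have hd' := mem_support_iff.2 h
        refine hd ?_
        ext i
        fin_cases i
        · simpa using (apply_zero_eq_zero_of_pderiv_zero_eq_zero hgp g0 hd').symm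
        · simpa using (apply_one_eq_zero_of_pderiv_one_eq_zero hgp g1 hd').symm
    have hc : coeff 0 g = coeff 0 (φ (X i)) := by
      rw [hg, coeff_sub, coeff_add]
      simp [coeff_C_mul]
    rw [hc] at hconst
    rw [← hconst, hg]; ring
  have haff : IsAffineMap φ := by
    refine ⟨_, _, _, _, _, _, ?_, key 0, key 1⟩
    rw [Matrix.det_fin_two] at hA
    exact hA
  obtain ⟨ψ, -, h1, h2⟩ := haff.exists_inverse
  exact bijective_of_mul_eq_one h1 h2

/-- Descent on the number of swap factors: an automorphism strips off the last one, and both the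
Jacobian pair and the degree bound survive. -/
theorem bijective_of_jacMat_prodSwap {p : ℕ} [Fact p.Prime] [CharP k p]
    {A : Matrix (Fin 2) (Fin 2) k} (hA : A.det ≠ 0) (L : List (MvPolynomial (Fin 2) k)) :
    ∀ (φ : MvPolynomial (Fin 2) k →ₐ[k] MvPolynomial (Fin 2) k), (∀ q ∈ L, IsNonconst q) →
      IsJacobianPair (φ (X 0)) (φ (X 1)) →
      jacMat φ = constMat A * prodSwap L → (∀ i, (φ (X i)).totalDegree < p) →
      Function.Bijective φ := by
  have hp : 0 < p := (Fact.out : p.Prime).pos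
  induction hn : L.length generalizing L with
  | zero =>
    intro φ _ _ hφ hlow
    rw [List.length_eq_zero_iff] at hn
    subst hn
    refine bijective_of_jacMat_const hA ?_ hlow
    rw [hφ]; simp [prodSwap]
  | succ n ih =>
    intro φ hL hJ hφ hlow
    obtain ⟨L, q, rfl⟩ : ∃ L' q, L = L' ++ [q] :=
      ⟨_, _, (List.dropLast_append_getLast (by rintro rfl; simp at hn)).symm⟩
    have hq : IsNonconst q := hL q (by simp)
    have hL' : ∀ r ∈ L, IsNonconst r := fun r hr => hL r (by simp [hr])
    set M := constMat A * prodSwap L with hM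
    have hrow := fun i => isGoodRow_prodSwap hA i L hL'
    rw [← hM] at hrow
    have hφM : jacMat φ = M * swapMat q := by rw [hφ, prodSwap_concat, ← Matrix.mul_assoc]
    have h0 : ∀ i, pderiv 0 (φ (X i)) = M i 0 * q + M i 1 := by
      intro i
      have : jacMat φ i 0 = M i 0 * q + M i 1 := by
        rw [hφM]; simp [Matrix.mul_apply, Fin.sum_univ_two, swapMat]
      rw [← this]; rfl
    have h1 : ∀ i, pderiv 1 (φ (X i)) = M i 0 := by
      intro i
      have : jacMat φ i 1 = M i 0 := by
        rw [hφM]; simp [Matrix.mul_apply, Fin.sum_univ_two, swapMat]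
      rw [← this]; rfl
    obtain ⟨i₀, hi₀⟩ := constMat_mul_prodSwap_ne_zero_row hJ q hφM
    have hgood : ∀ i, M i 0 ≠ 0 → ∀ θ, 0 < θ → wdeg 1 θ (M i 1) ≤ wdeg 1 θ (M i 0) := by
      intro i hi
      rcases hrow i with h | h
      · exact absurd h.1 hi
      · exact h.2
    have hq1 : ∀ d ∈ q.support, d 1 = 0 := by
      intro d hd
      by_contra hd1
      exact false_of_last_depends hp (hlow i₀) (h0 i₀) (h1 i₀) hi₀ (hgood i₀ hi₀) hd hd1
    obtain ⟨r, rfl⟩ := exists_eq_aeval_X_zero hq1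
    have hr : 0 < r.natDegree := by
      by_contra h
      have : r = Polynomial.C (r.coeff 0) := Polynomial.eq_C_of_natDegree_le_zero (by omega)
      refine hq (r.coeff 0) ?_
      rw [this]; simp
    have hW : ∀ i, wdeg 1 (r.natDegree + 1) (φ (X i)) < p := by
      intro i
      by_cases hi : M i 0 = 0
      -- This component does not involve `X 1`, so its weighted degree is its ordinary degree.
      · have hd1 : ∀ d ∈ (φ (X i)).support, d 1 = 0 := fun d hd =>
          apply_one_eq_zero_of_pderiv_one_eq_zero (hlow i) ((h1 i).trans hi) hd
        refine lt_of_le_of_lt (wdeg_le fun d hd => ?_) (hlow i)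
        rw [wt_apply, hd1 d hd]
        have := le_totalDegree_fin_two hd
        omega
      · exact wdeg_lt_of_last_univariate hr (hlow i) (h0 i) (h1 i) hi (hgood i hi)
    have hrp : r.natDegree + 1 < p := by
      have := wdeg_pderiv_one 1 (r.natDegree + 1) (f := φ (X i₀)) (by rwa [h1 i₀])
      have := hW i₀
      omega
    obtain ⟨Q, hQ, hQdeg⟩ := exists_polynomial_derivative_eq (p := p) r hrp
    -- Since `Q' = r`, the Jacobian matrix of `ε` is exactly the last swap factor. Its inverse `δ`
    -- therefore cancels this factor in the chain rule; it sends the variables to degrees at most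
    -- `1` and `r.natDegree + 1`, the weights controlled by `hW`.
    obtain ⟨ε, hε0, hε1⟩ := exists_endo (X 1 + Polynomial.aeval (X 0 : MvPolynomial (Fin 2) k) Q)
      (X 0)
    obtain ⟨δ, hδ0, hδ1⟩ := exists_endo (X 1)
      (X 0 - Polynomial.aeval (X 1 : MvPolynomial (Fin 2) k) Q)
    have hεδ : ε * δ = 1 := by
      refine algHom_eq_one ?_ ?_
      · rw [AlgHom.mul_apply, hδ0, hε1]
      · rw [AlgHom.mul_apply, hδ1, map_sub, hε0, ← Polynomial.aeval_algHom_apply, hε1]; ring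
    have hδε : δ * ε = 1 := by
      refine algHom_eq_one ?_ ?_
      · rw [AlgHom.mul_apply, hε0, map_add, hδ1, ← Polynomial.aeval_algHom_apply, hδ0]; ring
      · rw [AlgHom.mul_apply, hε1, hδ0]
    have hδJ : IsJacobianPair (δ (X 0)) (δ (X 1)) := by
      refine ⟨-1, by simp, ?_⟩
      rw [hδ0, hδ1]
      simp [jacobianDet, pderiv_X]
    have hmat : (swapMat (Polynomial.aeval (X 0 : MvPolynomial (Fin 2) k) r)).map δ * jacMat δ =
        1 := by
      have e : δ (Polynomial.aeval (X 0 : MvPolynomial (Fin 2) k) r) =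
          Polynomial.aeval (X 1 : MvPolynomial (Fin 2) k) r := by
        rw [← Polynomial.aeval_algHom_apply, hδ0]
      ext1 i j
      rw [Matrix.mul_apply, Fin.sum_univ_two]
      simp only [Matrix.map_apply, jacMat, Matrix.of_apply]
      fin_cases i <;> fin_cases j <;>
        simp [swapMat, e, hδ0, hδ1, pderiv_X, hQ]
    refine bijective_of_mul_left hεδ hδε
      (ih (L.map δ) (by simpa using hn) (δ * φ) ?_ (isJacobianPair_mul hδJ hJ) ?_ ?_)
    · intro s hs
      obtain ⟨s, hs', rfl⟩ := List.mem_map.1 hs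
      intro c hc
      refine hL' s hs' c ?_
      have := congrArg ε hc
      rw [endo_C] at this
      rw [← this]
      exact (DFunLike.congr_fun hεδ s).symm
    · rw [jacMat_mul, hφM, Matrix.map_mul, Matrix.mul_assoc, hmat, Matrix.mul_one, hM,
        Matrix.map_mul, constMat_map, prodSwap_map]
    · intro i
      rw [AlgHom.mul_apply]
      refine lt_of_le_of_lt (totalDegree_algHom_le (n := 1) (m := r.natDegree + 1) ?_ ?_ le_rfl)
        (hW i)
      · rw [hδ0, totalDegree_X]
      · rw [hδ1]
        refine (totalDegree_sub _ _).trans (max_le ?_ ?_)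
        · rw [totalDegree_X]; omega
        · exact totalDegree_polynomial_aeval_le Q (d := 1) (totalDegree_X _).le (by omega)

/-- A `p`-morphism whose components have degree less than `p` is an automorphism. -/
theorem IsPMorphism.bijective_of_totalDegree_lt {p : ℕ} [Fact p.Prime] [CharP k p]
    {φ : MvPolynomial (Fin 2) k →ₐ[k] MvPolynomial (Fin 2) k} (hφ : IsPMorphism p φ)
    (hlow : ∀ i, (φ (X i)).totalDegree < p) : Function.Bijective φ := by
  obtain ⟨A, B, L, hA, hB, hL, hM⟩ := hφ.isSwapProduct
  have hunit : IsUnit B.det := isUnit_iff_ne_zero.2 hB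
  have hBinv : (B⁻¹).det ≠ 0 := by
    rw [Matrix.det_nonsing_inv, Ring.inverse_eq_inv']; exact inv_ne_zero hB
  -- The linear map with matrix `B⁻¹` cancels the trailing constant factor.
  obtain ⟨α, hα0, hα1⟩ := exists_endo (C (B⁻¹ 0 0) * X 0 + C (B⁻¹ 0 1) * X 1 + C 0)
    (C (B⁻¹ 1 0) * X 0 + C (B⁻¹ 1 1) * X 1 + C 0)
  have hα : IsAffineMap α := by
    refine ⟨_, _, _, _, _, _, ?_, hα0, hα1⟩
    rwa [Matrix.det_fin_two] at hBinv
  obtain ⟨β, -, h1, h2⟩ := hα.exists_inverse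
  have hαmat : jacMat α = constMat B⁻¹ := by
    ext1 i j
    fin_cases i <;> fin_cases j <;> simp [jacMat, hα0, hα1, pderiv_X, constMat]
  refine bijective_of_mul_left h2 h1 (bijective_of_jacMat_prodSwap (p := p) hA (L.map α) (α * φ) ?_
    (isJacobianPair_mul hα.isJacobianPair hφ.isJacobianPair) ?_ ?_)
  · intro s hs
    obtain ⟨s, hs', rfl⟩ := List.mem_map.1 hs
    intro c hc
    refine hL s hs' c ?_
    have := congrArg β hc
    rw [endo_C] at this
    rw [← this]
    exact (DFunLike.congr_fun h2 s).symm
  · rw [jacMat_mul, hM, Matrix.map_mul, Matrix.map_mul, constMat_map, constMat_map, prodSwap_map,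
      hαmat, Matrix.mul_assoc, ← constMat_mul, Matrix.mul_nonsing_inv _ hunit, constMat_one,
      Matrix.mul_one]
  · intro i
    exact lt_of_le_of_lt (hα.totalDegree_le _) (hlow i)

end LowDegree

/-! ### The form and the polynomials defining a map of type (b). -/

section TypeB

variable {k : Type*} [Field k]

theorem coeff_X_mul_pderiv (i : Fin 2) (f : MvPolynomial (Fin 2) k) (e : Fin 2 →₀ ℕ) :
    coeff e (X i * pderiv i f) = e i * coeff e f := by
  classical
  induction f using MvPolynomial.induction_on' with
  | monomial d a =>
    rw [X_mul_pderiv_monomial, coeff_smul, nsmul_eq_mul, coeff_monomial]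
    split_ifs with h
    · rw [h]
    · simp
  | add f g hf hg =>
    rw [map_add, mul_add, coeff_add, coeff_add, hf, hg]; ring

/-- Over forms of one fixed degree `N`, the form `u` behaves like an indeterminate: the terms of the
sum have distinct degrees `N + D * l` and cannot cancel. -/
theorem eq_zero_of_eval_homogeneous {u : MvPolynomial (Fin 2) k} {D N : ℕ} (hu : u ≠ 0)
    (hD : 0 < D) (hom : u.IsHomogeneous D) {F : Polynomial (MvPolynomial (Fin 2) k)}
    (hF : ∀ l, (F.coeff l).IsHomogeneous N) (h : F.eval u = 0) : F = 0 := by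
  ext1 l
  rw [Polynomial.coeff_zero]
  by_contra hl
  have h1 := congrArg (homogeneousComponent (N + D * l)) h
  rw [map_zero, Polynomial.eval_eq_sum_range, map_sum] at h1
  have hterm : ∀ i, (F.coeff i * u ^ i).IsHomogeneous (N + D * i) := fun i =>
    (hF i).mul (hom.pow i)
  rw [Finset.sum_eq_single l] at h1
  · rw [homogeneousComponent_of_mem (hterm l), if_pos rfl] at h1
    exact mul_ne_zero hl (pow_ne_zero _ hu) h1
  · intro i _ hi
    rw [homogeneousComponent_of_mem (hterm i), if_neg]
    intro h2
    exact hi (Nat.eq_of_mul_eq_mul_left hD (Nat.add_left_cancel h2)).symm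
  · intro h2
    rw [Finset.mem_range, not_lt] at h2
    exact absurd (Polynomial.coeff_eq_zero_of_natDegree_lt (by omega)) hl

/-- With θᵢ = xᵢ∂ᵢu the Jacobian condition reads (h₁h₂)(u) + θ₀(h₁'h₂)(u) + θ₁(h₁h₂')(u) = c. Its
constant term gives h₁h₂ - c = x·s, so the condition is linear in u, θ₀, θ₁, which are all
homogeneous of degree `D`; it thus holds coefficientwise in powers of `u`. At the monomial `e` the
coefficient of θᵢ is `e i` times that of `u`. -/
theorem IsTypeB_ode {u : MvPolynomial (Fin 2) k} {D : ℕ} {h₁ h₂ : Polynomial k} {c : k}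
    (hu : u ≠ 0) (hD : 0 < D) (hom : u.IsHomogeneous D)
    (hJ : jacobianDet (X 0 * Polynomial.aeval u h₁) (X 1 * Polynomial.aeval u h₂) = C c)
    {e : Fin 2 →₀ ℕ} (he : e ∈ u.support) :
    h₁ * h₂ - Polynomial.C c + Polynomial.X *
      ((e 0 : Polynomial k) * (Polynomial.derivative h₁ * h₂) +
       (e 1 : Polynomial k) * (h₁ * Polynomial.derivative h₂)) = 0 := by
  obtain ⟨θ₀, hθ₀⟩ : ∃ θ, θ = X 0 * pderiv 0 u := ⟨_, rfl⟩
  obtain ⟨θ₁, hθ₁⟩ : ∃ θ, θ = X 1 * pderiv 1 u := ⟨_, rfl⟩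
  have hJ' : Polynomial.aeval u (h₁ * h₂) + θ₀ * Polynomial.aeval u (Polynomial.derivative h₁ * h₂)
      + θ₁ * Polynomial.aeval u (h₁ * Polynomial.derivative h₂) = C c := by
    rw [← hJ, jacobianDet]
    simp only [Derivation.leibniz, pderiv_polynomial_aeval, smul_eq_mul, pderiv_X, map_mul]
    simp [hθ₀, hθ₁]
    ring
  have hu0 : constantCoeff u = 0 := by
    rw [constantCoeff_eq]
    exact hom.coeff_eq_zero (by simp; omega)
  have hconst : (h₁ * h₂).coeff 0 = c := by
    have h1 := congrArg constantCoeff hJ'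
    simp only [map_add, map_mul, constantCoeff_C, hθ₀, hθ₁, constantCoeff_X, zero_mul,
      add_zero] at h1
    have h2 : ∀ h : Polynomial k, constantCoeff (Polynomial.aeval u h) = h.coeff 0 := by
      intro h
      rw [Polynomial.aeval_def, Polynomial.hom_eval₂, hu0, Polynomial.coeff_zero_eq_eval_zero,
        Polynomial.eval]
      congr 1
      ext a; simp
    rw [h2, h2] at h1
    rw [Polynomial.mul_coeff_zero]; exact h1
  obtain ⟨s, hs⟩ : Polynomial.X ∣ h₁ * h₂ - Polynomial.C c := by
    rw [Polynomial.X_dvd_iff]; simp [hconst]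
  obtain ⟨ι, hι⟩ : ∃ ι : Polynomial k →+* Polynomial (MvPolynomial (Fin 2) k),
      ι = Polynomial.mapRingHom C := ⟨_, rfl⟩
  have hev : ∀ h : Polynomial k, (ι h).eval u = Polynomial.aeval u h := by
    intro h
    rw [hι, Polynomial.coe_mapRingHom, Polynomial.eval_map, Polynomial.aeval_def]; rfl
  obtain ⟨F, hF⟩ : ∃ F, F = Polynomial.C u * ι s +
      Polynomial.C θ₀ * ι (Polynomial.derivative h₁ * h₂) +
      Polynomial.C θ₁ * ι (h₁ * Polynomial.derivative h₂) := ⟨_, rfl⟩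
  have hcoeff : ∀ l, F.coeff l = C (s.coeff l) * u +
      C ((Polynomial.derivative h₁ * h₂).coeff l) * θ₀ +
      C ((h₁ * Polynomial.derivative h₂).coeff l) * θ₁ := by
    intro l
    simp only [hF, Polynomial.coeff_add, Polynomial.coeff_C_mul, hι, Polynomial.coe_mapRingHom,
      Polynomial.coeff_map]
    ring
  have hθhom : ∀ i, (X i * pderiv i u).IsHomogeneous D := by
    intro i d hd
    rw [coeff_X_mul_pderiv] at hd
    exact hom (right_ne_zero_of_mul hd)
  have hCmul : ∀ (f : MvPolynomial (Fin 2) k) (a : k), f.IsHomogeneous D →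
      (C a * f).IsHomogeneous D := fun f a hf => by
    simpa using (isHomogeneous_C (Fin 2) a).mul hf
  have hF0 : F = 0 := by
    refine eq_zero_of_eval_homogeneous hu hD hom (N := D) (fun l => ?_) ?_
    · rw [hcoeff]
      have i0 := hCmul u (s.coeff l) hom
      have i1 := hCmul θ₀ ((Polynomial.derivative h₁ * h₂).coeff l) (by rw [hθ₀]; exact hθhom 0)
      have i2 := hCmul θ₁ ((h₁ * Polynomial.derivative h₂).coeff l) (by rw [hθ₁]; exact hθhom 1)
      exact (i0.add i1).add i2
    · have h1 : u * Polynomial.aeval u s = Polynomial.aeval u (h₁ * h₂) - C c := by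
        have := congrArg (Polynomial.aeval u) hs
        rw [map_mul, Polynomial.aeval_X, map_sub, Polynomial.aeval_C] at this
        exact this.symm
      simp only [hF, Polynomial.eval_add, Polynomial.eval_mul, Polynomial.eval_C, hev]
      rw [h1]
      linear_combination hJ'
  have hγ := mem_support_iff.1 he
  rw [hs, ← mul_add]
  refine mul_eq_zero_of_right _ ?_
  ext l
  have h2 := congrArg (coeff e) (hcoeff l)
  rw [hF0, Polynomial.coeff_zero, coeff_zero] at h2
  simp only [coeff_add, coeff_C_mul, hθ₀, hθ₁, coeff_X_mul_pderiv] at h2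
  have h3 : coeff e u * (s.coeff l + (e 0 * (Polynomial.derivative h₁ * h₂).coeff l +
      e 1 * (h₁ * Polynomial.derivative h₂).coeff l)) = 0 := by
    rw [h2]; ring
  have h4 := (mul_eq_zero.1 h3).resolve_left hγ
  rw [Polynomial.coeff_add, Polynomial.coeff_add, Polynomial.coeff_natCast_mul,
    Polynomial.coeff_natCast_mul, Polynomial.coeff_zero]
  exact h4

/-- Compare the coefficients in degree `h₁.natDegree + h₂.natDegree`. -/
theorem one_add_eq_zero_of_ode {h₁ h₂ : Polynomial k} {c : k} {i j : ℕ}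
    (hh₁ : 0 < h₁.natDegree) (hh₂ : 0 < h₂.natDegree)
    (h : h₁ * h₂ - Polynomial.C c + Polynomial.X *
      ((i : Polynomial k) * (Polynomial.derivative h₁ * h₂) +
       (j : Polynomial k) * (h₁ * Polynomial.derivative h₂)) = 0) :
    ((1 + h₁.natDegree * i + h₂.natDegree * j : ℕ) : k) = 0 := by
  set m₁ := h₁.natDegree with hm₁
  set m₂ := h₂.natDegree with hm₂
  have hne₁ : h₁.leadingCoeff ≠ 0 := by
    rw [Ne, Polynomial.leadingCoeff_eq_zero]; rintro rfl; simp at hm₁; omega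
  have hne₂ : h₂.leadingCoeff ≠ 0 := by
    rw [Ne, Polynomial.leadingCoeff_eq_zero]; rintro rfl; simp at hm₂; omega
  obtain ⟨a, ha⟩ : ∃ a, m₁ = a + 1 := ⟨m₁ - 1, by omega⟩
  obtain ⟨b, hb⟩ : ∃ b, m₂ = b + 1 := ⟨m₂ - 1, by omega⟩
  have d1 : (Polynomial.derivative h₁).coeff a = m₁ * h₁.leadingCoeff := by
    rw [Polynomial.coeff_derivative, Polynomial.leadingCoeff, ← hm₁, ha]; push_cast; ring
  have d2 : (Polynomial.derivative h₂).coeff b = m₂ * h₂.leadingCoeff := by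
    rw [Polynomial.coeff_derivative, Polynomial.leadingCoeff, ← hm₂, hb]; push_cast; ring
  have n1 := Polynomial.natDegree_derivative_le h₁
  have n2 := Polynomial.natDegree_derivative_le h₂
  have e1 : (h₁ * h₂).coeff (m₁ + m₂) = h₁.leadingCoeff * h₂.leadingCoeff :=
    Polynomial.coeff_mul_degree_add_degree h₁ h₂
  have e2 : (Polynomial.X * (Polynomial.derivative h₁ * h₂)).coeff (m₁ + m₂) =
      m₁ * (h₁.leadingCoeff * h₂.leadingCoeff) := by
    rw [show m₁ + m₂ = (a + m₂) + 1 by omega, Polynomial.coeff_X_mul,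
      Polynomial.coeff_mul_add_eq_of_natDegree_le (by omega) le_rfl, d1, mul_assoc]; rfl
  have e3 : (Polynomial.X * (h₁ * Polynomial.derivative h₂)).coeff (m₁ + m₂) =
      m₂ * (h₁.leadingCoeff * h₂.leadingCoeff) := by
    rw [show m₁ + m₂ = (m₁ + b) + 1 by omega, Polynomial.coeff_X_mul,
      Polynomial.coeff_mul_add_eq_of_natDegree_le le_rfl (by omega), d2, mul_left_comm]; rfl
  have h4 := congrArg (fun q => Polynomial.coeff q (m₁ + m₂)) h
  have e5 : Polynomial.X * ((i : Polynomial k) * (Polynomial.derivative h₁ * h₂) +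
      (j : Polynomial k) * (h₁ * Polynomial.derivative h₂)) =
      (i : Polynomial k) * (Polynomial.X * (Polynomial.derivative h₁ * h₂)) +
      (j : Polynomial k) * (Polynomial.X * (h₁ * Polynomial.derivative h₂)) := by ring
  simp only [e5, Polynomial.coeff_add, Polynomial.coeff_sub, Polynomial.coeff_natCast_mul, e1, e2,
    e3, Polynomial.coeff_C_of_ne_zero (show m₁ + m₂ ≠ 0 by omega), Polynomial.coeff_zero] at h4
  have h5 : ((1 + m₁ * i + m₂ * j : ℕ) : k) * (h₁.leadingCoeff * h₂.leadingCoeff) = 0 := by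
    push_cast
    linear_combination h4
  exact (mul_eq_zero.1 h5).resolve_right (mul_ne_zero hne₁ hne₂)

theorem mul_ne_C_of_natDegree_pos {h g : Polynomial k} {c : k} (hc : c ≠ 0)
    (hh : 0 < h.natDegree) : h * g ≠ Polynomial.C c := by
  intro e
  have h0 : g ≠ 0 := by
    rintro rfl
    rw [mul_zero] at e
    exact hc (Polynomial.C_eq_zero.1 e.symm)
  have h1 : h ≠ 0 := by rintro rfl; simp at hh
  have := congrArg Polynomial.natDegree e
  rw [Polynomial.natDegree_mul h1 h0, Polynomial.natDegree_C] at this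
  omega

/-- The exponents of the form defining a map of type (b). -/
theorem typeB_exponents {p : ℕ} [CharP k p] {u : MvPolynomial (Fin 2) k} {D : ℕ}
    {h₁ h₂ : Polynomial k} {c : k} (hc : c ≠ 0)
    (hu : u ≠ 0) (hD : 0 < D) (hom : u.IsHomogeneous D)
    (hh₁ : 0 < h₁.natDegree) (hh₂ : 0 < h₂.natDegree)
    (hJ : jacobianDet (X 0 * Polynomial.aeval u h₁) (X 1 * Polynomial.aeval u h₂) = C c) :
    (∀ e ∈ u.support, 0 < e 0 ∧ 0 < e 1 ∧ p ∣ 1 + h₁.natDegree * e 0 + h₂.natDegree * e 1) ∧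
    (∀ e ∈ u.support, ∀ e' ∈ u.support, (e 0 : k) = e' 0 ∧ (e 1 : k) = e' 1) := by
  have ode := fun e he => IsTypeB_ode hu hD hom hJ (e := e) he
  constructor
  · intro e he
    refine ⟨?_, ?_, ?_⟩
    · by_contra h0
      have h0 : e 0 = 0 := by omega
      have h1 := ode e he
      rw [h0] at h1
      -- With `e 0 = 0` every other term is a multiple of `h₁`, which would then divide the nonzero
      -- constant `c`.
      refine mul_ne_C_of_natDegree_pos hc hh₁
        (g := h₂ + Polynomial.X * ((e 1 : Polynomial k) * Polynomial.derivative h₂)) ?_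
      push_cast at h1
      linear_combination h1
    · by_contra h0
      have h0 : e 1 = 0 := by omega
      have h1 := ode e he
      rw [h0] at h1
      refine mul_ne_C_of_natDegree_pos hc hh₂
        (g := h₁ + Polynomial.X * ((e 0 : Polynomial k) * Polynomial.derivative h₁)) ?_
      push_cast at h1
      linear_combination h1
    · rw [← CharP.cast_eq_zero_iff k p]
      exact one_add_eq_zero_of_ode hh₁ hh₂ (ode e he)
  · intro e he e' he'
    have hsum : ∀ e ∈ u.support, e 0 + e 1 = D := by
      intro e he
      have := hom (mem_support_iff.1 he)
      rw [← this, Finsupp.weight_apply, Finsupp.sum_fintype _ _ (fun _ => by simp)]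
      simp
    have key : (e 0 : k) = e' 0 := by
      by_contra hne
      have h1 := ode e he
      have h2 := ode e' he'
      have hs : (e 0 : k) + e 1 = e' 0 + e' 1 := by
        exact_mod_cast congrArg (Nat.cast (R := k)) ((hsum e he).trans (hsum e' he').symm)
      have hs' : (e 0 : Polynomial k) + e 1 = e' 0 + e' 1 := by
        have := congrArg Polynomial.C hs
        simpa using this
      -- Both exponents have the same sum `D`, so the difference of the two equations leaves only
      -- h₁'h₂ - h₁h₂'. If this vanishes, the equation again makes `h₁` divide `c`.
      have h3 : Polynomial.X * ((Polynomial.C ((e 0 : k) - e' 0)) *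
          (Polynomial.derivative h₁ * h₂ - h₁ * Polynomial.derivative h₂)) = 0 := by
        rw [map_sub, Polynomial.C_eq_natCast, Polynomial.C_eq_natCast]
        linear_combination h1 - h2 - Polynomial.X * (h₁ * Polynomial.derivative h₂) * hs'
      have h4 := (mul_eq_zero.1 ((mul_eq_zero.1 h3).resolve_left Polynomial.X_ne_zero)).resolve_left
        (fun h => hne (sub_eq_zero.1 (Polynomial.C_eq_zero.1 h)))
      refine mul_ne_C_of_natDegree_pos hc hh₁
        (g := h₂ + Polynomial.X * (((e 0 : Polynomial k) + (e 1 : Polynomial k)) * Polynomial.derivative h₂)) ?_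
      linear_combination h1 - Polynomial.X * (e 0 : Polynomial k) * h4
    refine ⟨key, ?_⟩
    have hs : (e 0 : k) + e 1 = e' 0 + e' 1 := by
      exact_mod_cast congrArg (Nat.cast (R := k)) ((hsum e he).trans (hsum e' he').symm)
    linear_combination hs - key

end TypeB

/-! ### Arithmetic of exponents and weights. -/

section Arithmetic

/-- Write n = ηg and m = μg with η, μ coprime. The weight equation `hxy` becomes ηK = μL, so K = μt
and L = ηt, and m₁K - m₂L is a multiple of 1 + m₁I + m₂J. Hence `p` divides t(m₁μ - m₂η), and either
factor gives the bound. -/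
theorem le_of_weights_aux {n m m₁ m₂ I J p x y : ℕ} (hp : p.Prime)
    (hn : 0 < n) (hm : 0 < m) (hnm : n ≠ m) (hm₁ : 0 < m₁) (hm₂ : 0 < m₂) (hle : m₂ ≤ m₁)
    (hI : 0 < I) (hJ : 0 < J) (hdvd : p ∣ 1 + m₁ * I + m₂ * J) (hx : 0 < x) (hy : 0 < y)
    (hxy : x * (n + m₁ * (n * I + m * J)) = y * (m + m₂ * (n * I + m * J))) :
    p ≤ n * (y * m₂ * I) + m * (x * m₁ * J) := by
  have hMp : p ≤ 1 + m₁ * I + m₂ * J := Nat.le_of_dvd (by omega) hdvd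
  obtain ⟨g, η, μ, hg, hcop, rfl, rfl⟩ : ∃ g η μ, 0 < g ∧ Nat.Coprime η μ ∧ n = η * g ∧ m = μ * g :=
    let ⟨a, b, h1, h2, h3⟩ := Nat.exists_coprime n m
    ⟨_, a, b, Nat.gcd_pos_of_pos_left m hn, h1, h2, h3⟩
  have hη : 0 < η := Nat.pos_of_mul_pos_right hn
  have hμ : 0 < μ := Nat.pos_of_mul_pos_right hm
  have hT1 : η * (m₂ * (y * I)) ≤ η * g * (y * m₂ * I) := by
    calc η * (m₂ * (y * I)) = η * 1 * (y * m₂ * I) := by ring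
      _ ≤ _ := by gcongr; exact hg
  have hT2 : μ * (m₁ * (x * J)) ≤ μ * g * (x * m₁ * J) := by
    calc μ * (m₁ * (x * J)) = μ * 1 * (x * m₁ * J) := by ring
      _ ≤ _ := by gcongr; exact hg
  have hyI : 1 ≤ y * I := Nat.mul_pos hy hI
  have hxJ : 1 ≤ x * J := Nat.mul_pos hx hJ
  suffices h : p ≤ η * (m₂ * (y * I)) + μ * (m₁ * (x * J)) by omega
  obtain ⟨K, hK⟩ : ∃ K : ℤ, K = x * (1 + m₁ * I) - y * m₂ * I := ⟨_, rfl⟩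
  obtain ⟨L, hL⟩ : ∃ L : ℤ, L = y * (1 + m₂ * J) - x * m₁ * J := ⟨_, rfl⟩
  have hKL : (η : ℤ) * K = μ * L := by
    have h1 : ((x * (η * g + m₁ * (η * g * I + μ * g * J)) : ℕ) : ℤ) =
      ((y * (μ * g + m₂ * (η * g * I + μ * g * J)) : ℕ) : ℤ) := congrArg _ hxy
    push_cast at h1
    have hg' : (g : ℤ) ≠ 0 := by exact_mod_cast hg.ne'
    refine mul_left_cancel₀ hg' ?_
    rw [hK, hL]
    linear_combination h1
  have hMKL : (m₁ : ℤ) * K - m₂ * L = (1 + m₁ * I + m₂ * J : ℕ) * (m₁ * x - m₂ * y) := by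
    rw [hK, hL]; push_cast; ring
  -- If `K ≤ 0` then `L ≤ 0`; multiplying the two resulting inequalities gives (1 + m₁I)(1 + m₂J) ≤
  -- m₁m₂IJ, which is absurd.
  have hKpos : 0 < K := by
    by_contra hneg
    push Not at hneg
    have hLneg : L ≤ 0 := by
      by_contra h
      push Not at h
      have h1 : (0 : ℤ) < μ * L := by positivity
      have h2 : (η : ℤ) * K ≤ 0 := mul_nonpos_of_nonneg_of_nonpos (by positivity) hneg
      omega
    have h1 : x * (1 + m₁ * I) ≤ y * m₂ * I := by zify; linarith
    have h2 : y * (1 + m₂ * J) ≤ x * m₁ * J := by zify; linarith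
    have h3 := Nat.mul_le_mul h1 h2
    have h4 : 0 < x * y := Nat.mul_pos hx hy
    have h5 : x * (1 + m₁ * I) * (y * (1 + m₂ * J)) =
        x * y + x * y * (m₁ * I) + x * y * (m₂ * J) + y * m₂ * I * (x * m₁ * J) := by ring
    omega
  obtain ⟨t, ht⟩ : (μ : ℤ) ∣ K := by
    have : (μ : ℤ) ∣ η * K := ⟨L, hKL⟩
    exact (Nat.isCoprime_iff_coprime.2 hcop.symm).dvd_of_dvd_mul_left this
  have htL : L = η * t := by
    have hμ' : (μ : ℤ) ≠ 0 := by exact_mod_cast hμ.ne'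
    refine mul_left_cancel₀ hμ' ?_
    rw [← hKL, ht]; ring
  have htpos : 0 < t := by
    by_contra h
    push Not at h
    have : (μ : ℤ) * t ≤ 0 := mul_nonpos_of_nonneg_of_nonpos (by positivity) h
    omega
  by_cases hpt : (p : ℤ) ∣ t
  · have hpt' : (p : ℤ) ≤ t := Int.le_of_dvd htpos hpt
    have hKp : (p : ℤ) ≤ K := by
      rw [ht]
      have : (1 : ℤ) ≤ μ := by exact_mod_cast hμ
      nlinarith
    have hLp : (p : ℤ) ≤ L := by
      rw [htL]
      have : (1 : ℤ) ≤ η := by exact_mod_cast hη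
      nlinarith
    have hKp' : p + y * m₂ * I ≤ x * (1 + m₁ * I) := by zify; linarith
    have hLp' : p + x * m₁ * J ≤ y * (1 + m₂ * J) := by zify; linarith
    have hT3 : y * m₂ * I ≤ η * (m₂ * (y * I)) := by
      calc y * m₂ * I = 1 * (m₂ * (y * I)) := by ring
        _ ≤ _ := by gcongr; exact hη
    have hT4 : x * m₁ * J ≤ μ * (m₁ * (x * J)) := by
      calc x * m₁ * J = 1 * (m₁ * (x * J)) := by ring
        _ ≤ _ := by gcongr; exact hμ
    have hx' : x ≤ x * m₁ := Nat.le_mul_of_pos_right _ hm₁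
    have hy' : y ≤ y * m₂ := Nat.le_mul_of_pos_right _ hm₂
    rcases lt_trichotomy I J with h | h | h
    · have h1 : x * m₁ * (I + 1) ≤ x * m₁ * J := Nat.mul_le_mul_left _ h
      have h2 : x * (1 + m₁ * I) = x + x * m₁ * I := by ring
      have h3 : x * m₁ * (I + 1) = x * m₁ * I + x * m₁ := by ring
      omega
    · subst h
      have h2 : x * (1 + m₁ * I) = x + x * m₁ * I := by ring
      have h3 : y * (1 + m₂ * I) = y + y * m₂ * I := by ring
      have h4 : x * m₁ ≤ x * m₁ * I := Nat.le_mul_of_pos_right _ hI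
      have h5 : y * m₂ ≤ y * m₂ * I := Nat.le_mul_of_pos_right _ hI
      omega
    · have h1 : y * m₂ * (J + 1) ≤ y * m₂ * I := Nat.mul_le_mul_left _ h
      have h2 : y * (1 + m₂ * J) = y + y * m₂ * J := by ring
      have h3 : y * m₂ * (J + 1) = y * m₂ * J + y * m₂ := by ring
      omega
  · have hdvd' : (p : ℤ) ∣ m₁ * μ - m₂ * η := by
      have h1 : (p : ℤ) ∣ t * (m₁ * μ - m₂ * η) := by
        have : t * (m₁ * μ - m₂ * η) = (m₁ : ℤ) * K - m₂ * L := by rw [ht, htL]; ring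
        rw [this, hMKL]
        exact Dvd.dvd.mul_right (by exact_mod_cast hdvd) _
      exact ((Nat.prime_iff_prime_int.1 hp).dvd_or_dvd h1).resolve_left hpt
    have hA : m₂ * η ≤ η * (m₂ * (y * I)) := by
      calc m₂ * η = η * (m₂ * 1) := by ring
        _ ≤ _ := by gcongr
    have hB : m₁ * μ ≤ μ * (m₁ * (x * J)) := by
      calc m₁ * μ = μ * (m₁ * 1) := by ring
        _ ≤ _ := by gcongr
    rcases lt_trichotomy (m₁ * μ) (m₂ * η) with h | h | h
    · have h1 : (p : ℤ) ∣ m₂ * η - m₁ * μ := by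
        rw [← neg_sub]; exact (dvd_neg).2 hdvd'
      have h2 := Int.le_of_dvd (by zify at h; linarith) h1
      have h3 : p ≤ m₂ * η := by
        zify; have : (0 : ℤ) ≤ m₁ * μ := by positivity
        linarith
      omega
    -- The divisibility is vacuous here. But `n ≠ m` now forces `m₂ < m₁`, and 1 + m₁I + m₂J is
    -- bounded directly.
    · have hne : η ≠ μ := by
        rintro rfl
        exact hnm rfl
      have h1 : m₂ < m₁ := by
        refine lt_of_le_of_ne hle ?_
        rintro rfl
        exact hne (Nat.eq_of_mul_eq_mul_left hm₂ h).symm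
      have h2 : m₁ * I ≤ η * (m₂ * (y * I)) := by
        calc m₁ * I = m₁ * 1 * 1 * I := by ring
          _ ≤ m₁ * μ * y * I := by gcongr <;> assumption
          _ = m₂ * η * y * I := by rw [h]
          _ = _ := by ring
      have h3 : m₁ * J ≤ μ * (m₁ * (x * J)) := by
        calc m₁ * J = 1 * (m₁ * (1 * J)) := by ring
          _ ≤ _ := by gcongr <;> assumption
      have h4 : (m₂ + 1) * J ≤ m₁ * J := Nat.mul_le_mul_right _ h1
      have h5 : (m₂ + 1) * J = m₂ * J + J := by ring
      omega
    · have h2 := Int.le_of_dvd (by zify at h; linarith) hdvd'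
      have h3 : p ≤ m₁ * μ := by
        zify; have : (0 : ℤ) ≤ m₂ * η := by positivity
        linarith
      omega

/-- Two top monomials of the inner polynomial supply the two exponents. If `α₂ ≤ α₁`, the right side
is already at least `W`; otherwise the differences of the exponents are the `x` and `y` of the
preceding lemma. -/
theorem le_of_weights_ne {n m m₁ m₂ I J p α₁ β₁ α₂ β₂ W : ℕ} (hp : p.Prime)
    (hn : 0 < n) (hm : 0 < m) (hnm : n ≠ m) (hm₁ : 0 < m₁) (hm₂ : 0 < m₂) (hle : m₂ ≤ m₁)
    (hI : 0 < I) (hJ : 0 < J) (hdvd : p ∣ 1 + m₁ * I + m₂ * J)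
    (hW₁ : α₁ * (n + m₁ * (n * I + m * J)) + β₁ * (m + m₂ * (n * I + m * J)) = W)
    (hW₂ : α₂ * (n + m₁ * (n * I + m * J)) + β₂ * (m + m₂ * (n * I + m * J)) = W)
    (hW : n + m₁ * (n * I + m * J) ≤ W) :
    p ≤ n * (α₁ + (α₁ * m₁ + β₁ * m₂) * I) + m * (β₂ + (α₂ * m₁ + β₂ * m₂) * J) := by
  have hwQ : 0 < m + m₂ * (n * I + m * J) := by omega
  rcases le_or_gt α₂ α₁ with h | h
  · have hβ : β₁ ≤ β₂ := by
      by_contra hβ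
      push Not at hβ
      have h1 := Nat.mul_le_mul_right (n + m₁ * (n * I + m * J)) h
      have h2 := Nat.mul_lt_mul_of_pos_right hβ hwQ
      omega
    have hMp : p ≤ 1 + m₁ * I + m₂ * J := Nat.le_of_dvd (by omega) hdvd
    have h0 : 1 + m₁ * I + m₂ * J ≤ n + m₁ * (n * I + m * J) := by
      calc 1 + m₁ * I + m₂ * J ≤ 1 + m₁ * I + m₁ * J := by gcongr
        _ = 1 + m₁ * (1 * I + 1 * J) := by ring
        _ ≤ n + m₁ * (n * I + m * J) := by gcongr <;> assumption
    refine hMp.trans (h0.trans (hW.trans ?_))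
    rcases le_total (α₁ * m₁ + β₁ * m₂) (α₂ * m₁ + β₂ * m₂) with he | he
    · calc W = n * (α₁ + (α₁ * m₁ + β₁ * m₂) * I) + m * (β₁ + (α₁ * m₁ + β₁ * m₂) * J) := by
            rw [← hW₁]; ring
        _ ≤ _ := by gcongr
    · calc W = n * (α₂ + (α₂ * m₁ + β₂ * m₂) * I) + m * (β₂ + (α₂ * m₁ + β₂ * m₂) * J) := by
            rw [← hW₂]; ring
        _ ≤ _ := by gcongr
  · have hβ : β₂ < β₁ := by
      by_contra hβ
      push Not at hβ
      have h1 := Nat.mul_lt_mul_of_pos_right h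
        (show 0 < n + m₁ * (n * I + m * J) by omega)
      have h2 := Nat.mul_le_mul_right (m + m₂ * (n * I + m * J)) hβ
      omega
    obtain ⟨x, rfl⟩ := Nat.exists_eq_add_of_lt h
    obtain ⟨y, rfl⟩ := Nat.exists_eq_add_of_lt hβ
    have hxy : (x + 1) * (n + m₁ * (n * I + m * J)) = (y + 1) * (m + m₂ * (n * I + m * J)) := by
      have h1 : (α₁ + x + 1) * (n + m₁ * (n * I + m * J)) = α₁ * (n + m₁ * (n * I + m * J)) +
        (x + 1) * (n + m₁ * (n * I + m * J)) := by ring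
      have h2 : (β₂ + y + 1) * (m + m₂ * (n * I + m * J)) = β₂ * (m + m₂ * (n * I + m * J)) +
        (y + 1) * (m + m₂ * (n * I + m * J)) := by ring
      omega
    refine (le_of_weights_aux hp hn hm hnm hm₁ hm₂ hle hI hJ hdvd (Nat.succ_pos x)
      (Nat.succ_pos y) hxy).trans ?_
    refine add_le_add (Nat.mul_le_mul_left n ?_) (Nat.mul_le_mul_left m ?_)
    · calc y.succ * m₂ * I ≤ (α₁ * m₁ + (β₂ + y + 1) * m₂) * I := by
            gcongr
            have : (β₂ + y + 1) * m₂ = β₂ * m₂ + y.succ * m₂ := by rw [Nat.succ_eq_add_one]; ring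
            omega
        _ ≤ _ := by omega
    · calc x.succ * m₁ * J ≤ ((α₁ + x + 1) * m₁ + β₂ * m₂) * J := by
            gcongr
            have : (α₁ + x + 1) * m₁ = α₁ * m₁ + x.succ * m₁ := by rw [Nat.succ_eq_add_one]; ring
            omega
        _ ≤ _ := by omega

/-- Only α = 0 matters; then 1 + m₁D ≤ βm₂(1 + D), and D/(1 + D) ≥ 2/3. -/
theorem two_mul_le_three_mul_of_weight {m₁ m₂ D α β : ℕ} (hm₂ : 0 < m₂) (hD : 2 ≤ D)
    (h : 1 + m₁ * D ≤ α * (1 + m₁ * D) + β * (1 + m₂ * D)) :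
    2 * m₁ ≤ 3 * (α * m₁ + β * m₂) := by
  rcases Nat.eq_zero_or_pos α with rfl | hα
  · simp only [zero_mul, zero_add] at h ⊢
    have h1 : β * (1 + m₂ * D) ≤ β * m₂ * (1 + D) := by
      have : β ≤ β * m₂ := Nat.le_mul_of_pos_right _ hm₂
      calc β * (1 + m₂ * D) = β + β * m₂ * D := by ring
        _ ≤ β * m₂ + β * m₂ * D := by omega
        _ = _ := by ring
    by_contra hlt
    push Not at hlt
    have h2 : (3 * (β * m₂) + 1) * (1 + D) ≤ 2 * m₁ * (1 + D) := Nat.mul_le_mul_right _ hlt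
    have h3 : m₁ * 2 ≤ m₁ * D := Nat.mul_le_mul_left _ hD
    have h4 : (3 * (β * m₂) + 1) * (1 + D) = 3 * (β * m₂ * (1 + D)) + (1 + D) := by ring
    have h5 : 2 * m₁ * (1 + D) = 2 * m₁ + 2 * (m₁ * D) := by ring
    omega
  · have : m₁ ≤ α * m₁ := Nat.le_mul_of_pos_left _ hα
    omega

/-- For equal weights all of the form `u` is on its top face, so `I` and `J` may come from different
monomials. The factor `n ≥ 2` outweighs the loss of 3/2 in the previous lemma. -/
theorem le_of_weights_eq {n m₁ m₂ D I J p α₁ β₁ α₂ β₂ : ℕ}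
    (hn : 2 ≤ n) (hm₁ : 0 < m₁) (hm₂ : 0 < m₂) (hle : m₂ ≤ m₁) (hD : 2 ≤ D)
    (hI : 0 < I) (hJ : 0 < J) (hdvd : p ∣ 1 + m₁ * I + m₂ * J)
    (hW₁ : 1 + m₁ * D ≤ α₁ * (1 + m₁ * D) + β₁ * (1 + m₂ * D))
    (hW₂ : 1 + m₁ * D ≤ α₂ * (1 + m₁ * D) + β₂ * (1 + m₂ * D)) :
    p ≤ n * (α₁ + (α₁ * m₁ + β₁ * m₂) * I) + n * (β₂ + (α₂ * m₁ + β₂ * m₂) * J) := by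
  have hMp : p ≤ 1 + m₁ * I + m₂ * J := Nat.le_of_dvd (by omega) hdvd
  have e₁ := two_mul_le_three_mul_of_weight hm₂ hD hW₁
  have e₂ := two_mul_le_three_mul_of_weight hm₂ hD hW₂
  generalize α₁ * m₁ + β₁ * m₂ = a at *
  generalize α₂ * m₁ + β₂ * m₂ = b at *
  have h1 : 2 * (a * I) ≤ n * (α₁ + a * I) := Nat.mul_le_mul hn (by omega)
  have h2 : 2 * (b * J) ≤ n * (β₂ + b * J) := Nat.mul_le_mul hn (by omega)
  have h3 : 2 * m₁ * I ≤ 3 * a * I := Nat.mul_le_mul_right I e₁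
  have h4 : 2 * m₁ * J ≤ 3 * b * J := Nat.mul_le_mul_right J e₂
  have h5 : m₂ * J ≤ m₁ * J := Nat.mul_le_mul_right J hle
  have e3 : 2 * m₁ * I = 2 * (m₁ * I) := by ring
  have e4 : 2 * m₁ * J = 2 * (m₁ * J) := by ring
  have e5 : 3 * a * I = 3 * (a * I) := by ring
  have e6 : 3 * b * J = 3 * (b * J) := by ring
  have h6 : 0 < m₁ * I := Nat.mul_pos hm₁ hI
  have h7 : 0 < m₁ * J := Nat.mul_pos hm₁ hJ
  omega

end Arithmetic

/-! ### Top faces under a substitution of type (b). -/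

section Face

variable {k : Type*} [Field k]

theorem IsLead.polynomial_aeval {σ Γ : Type*} [AddCommMonoid Γ] [LinearOrder Γ]
    [IsOrderedCancelAddMonoid Γ] {κ : (σ →₀ ℕ) →+ Γ} (hκ : Function.Injective κ)
    {u : MvPolynomial σ k} {d : σ →₀ ℕ} (hu : IsLead κ u d) (hd : 0 < κ d)
    {h : Polynomial k} (hh : h ≠ 0) : IsLead κ (Polynomial.aeval u h) (h.natDegree • d) := by
  rw [Polynomial.aeval_eq_sum_range, Finset.sum_range_succ, add_comm]
  have hlc : h.coeff h.natDegree ≠ 0 := by simpa using hh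
  have hmon : ∀ (c : k) (l : ℕ), c ≠ 0 → IsLead κ (c • u ^ l) (l • d) := by
    intro c l hc
    rw [smul_eq_C_mul]
    simpa using (isLead_C κ hc).mul hκ (hu.pow hκ l)
  refine (hmon _ _ hlc).add fun e he => ?_
  classical
  obtain ⟨l, hl, hle⟩ := Finset.mem_biUnion.1 (support_sum he)
  rw [Finset.mem_range] at hl
  have hc : h.coeff l ≠ 0 := by
    intro h0
    rw [h0, zero_smul] at hle
    simp at hle
  refine ((hmon _ l hc).2 e hle).trans_lt ?_
  rw [map_nsmul, map_nsmul]
  exact nsmul_lt_nsmul_left hd hl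

/-- All monomials of `f` have weight at most `W`, and those of weight `W` are divisible by
`X 0 ^ i * X 1 ^ j`. -/
def TopMin (n m : ℕ) (f : MvPolynomial (Fin 2) k) (W i j : ℕ) : Prop :=
  ∀ d ∈ f.support, wt n m d ≤ W ∧ (wt n m d = W → i ≤ d 0 ∧ j ≤ d 1)

theorem TopMin.mul {n m : ℕ} {f g : MvPolynomial (Fin 2) k} {W W' i i' j j' : ℕ}
    (hf : TopMin n m f W i j) (hg : TopMin n m g W' i' j') :
    TopMin n m (f * g) (W + W') (i + i') (j + j') := by
  intro d hd
  obtain ⟨a, ha, b, hb, rfl⟩ := exists_add_of_mem_support_mul hd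
  obtain ⟨h1, h2⟩ := hf a ha
  obtain ⟨h3, h4⟩ := hg b hb
  rw [map_add]
  refine ⟨by omega, fun h => ?_⟩
  obtain ⟨h5, h6⟩ := h2 (by omega)
  obtain ⟨h7, h8⟩ := h4 (by omega)
  simp only [Finsupp.add_apply]
  omega

theorem topMin_C (n m : ℕ) (c : k) : TopMin n m (C c : MvPolynomial (Fin 2) k) 0 0 0 := by
  intro d hd
  have := le_wdeg (n := n) (m := m) hd
  rw [wdeg_C] at this
  exact ⟨this, fun _ => ⟨Nat.zero_le _, Nat.zero_le _⟩⟩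

theorem TopMin.pow {n m : ℕ} {f : MvPolynomial (Fin 2) k} {W i j : ℕ}
    (hf : TopMin n m f W i j) (l : ℕ) : TopMin n m (f ^ l) (l * W) (l * i) (l * j) := by
  induction l with
  | zero => simpa using topMin_C n m (1 : k)
  | succ l ih => rw [pow_succ, Nat.succ_mul, Nat.succ_mul, Nat.succ_mul]; exact ih.mul hf

theorem topMin_X_zero (n m : ℕ) : TopMin n m (X 0 : MvPolynomial (Fin 2) k) n 1 0 := by
  intro d hd
  rw [support_X, Finset.mem_singleton] at hd
  subst hd
  simp [wt_apply]

theorem topMin_X_one (n m : ℕ) : TopMin n m (X 1 : MvPolynomial (Fin 2) k) m 0 1 := by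
  intro d hd
  rw [support_X, Finset.mem_singleton] at hd
  subst hd
  simp [wt_apply]

theorem TopMin.polynomial_aeval {n m : ℕ} {u : MvPolynomial (Fin 2) k} {W i j : ℕ}
    (hu : TopMin n m u W i j) (hW : 0 < W) (h : Polynomial k) :
    TopMin n m (Polynomial.aeval u h) (h.natDegree * W) (h.natDegree * i) (h.natDegree * j) := by
  intro d hd
  classical
  rw [Polynomial.aeval_eq_sum_range] at hd
  obtain ⟨l, hl, hle⟩ := Finset.mem_biUnion.1 (support_sum hd)
  rw [Finset.mem_range] at hl
  have hle' : d ∈ (u ^ l).support := support_smul hle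
  obtain ⟨h1, h2⟩ := hu.pow l d hle'
  have h3 : l * W ≤ h.natDegree * W := Nat.mul_le_mul_right _ (by omega)
  refine ⟨h1.trans h3, fun h4 => ?_⟩
  have h5 : l = h.natDegree := Nat.eq_of_mul_eq_mul_right hW (by omega)
  subst h5
  exact h2 h4

theorem isLead_X {σ Γ : Type*} [AddCommMonoid Γ] [LinearOrder Γ]
    [IsOrderedCancelAddMonoid Γ] (κ : (σ →₀ ℕ) →+ Γ) (i : σ) :
    IsLead κ (X i : MvPolynomial σ k) (Finsupp.single i 1) := by
  refine ⟨by simp [support_X], fun e he => ?_⟩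
  rw [support_X, Finset.mem_singleton] at he
  rw [he]

/-- The linear map is the identity plus a map of rank at most one, with determinant 1 + m₁I + m₂J >
0. -/
theorem injective_of_exponents {m₁ m₂ I J α β α' β' : ℕ}
    (h0 : α + (α * m₁ + β * m₂) * I = α' + (α' * m₁ + β' * m₂) * I)
    (h1 : β + (α * m₁ + β * m₂) * J = β' + (α' * m₁ + β' * m₂) * J) : α = α' ∧ β = β' := by
  have e : ((α' * m₁ + β' * m₂ : ℤ) - (α * m₁ + β * m₂)) * (1 + m₁ * I + m₂ * J) = 0 := by
    zify at h0 h1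
    linear_combination -(m₁ : ℤ) * h0 - m₂ * h1
  have hpos : (1 + m₁ * I + m₂ * J : ℤ) ≠ 0 := by positivity
  have e' := (mul_eq_zero.1 e).resolve_right hpos
  have e'' : α * m₁ + β * m₂ = α' * m₁ + β' * m₂ := by zify; linarith
  rw [e''] at h0 h1
  exact ⟨by omega, by omega⟩

/-- Weighted degree and top part of a polynomial in `X 0 * h₁(u)` and `X 1 * h₂(u)`. -/
theorem face_of_typeB_substitution {n m : ℕ} (hm : 0 < m)
    {u : MvPolynomial (Fin 2) k} {h₁ h₂ : Polynomial k} {U I J : ℕ} (hu : u ≠ 0)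
    (hh₁ : h₁ ≠ 0) (hh₂ : h₂ ≠ 0)
    (hU : wdeg n m u = U) (hUpos : 0 < U) (htop : TopMin n m u U I J)
    {F : MvPolynomial (Fin 2) k} (hF : F ≠ 0) :
    aeval ![X 0 * Polynomial.aeval u h₁, X 1 * Polynomial.aeval u h₂] F ≠ 0 ∧
    wdeg n m (aeval ![X 0 * Polynomial.aeval u h₁, X 1 * Polynomial.aeval u h₂] F) =
      wdeg (n + h₁.natDegree * U) (m + h₂.natDegree * U) F ∧
    ∀ d ∈ (aeval ![X 0 * Polynomial.aeval u h₁, X 1 * Polynomial.aeval u h₂] F).support,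
      wt n m d = wdeg (n + h₁.natDegree * U) (m + h₂.natDegree * U) F →
      ∃ s ∈ F.support, wt (n + h₁.natDegree * U) (m + h₂.natDegree * U) s =
          wdeg (n + h₁.natDegree * U) (m + h₂.natDegree * U) F ∧
        s 0 + (s 0 * h₁.natDegree + s 1 * h₂.natDegree) * I ≤ d 0 ∧
        s 1 + (s 0 * h₁.natDegree + s 1 * h₂.natDegree) * J ≤ d 1 := by
  classical
  set m₁ := h₁.natDegree
  set m₂ := h₂.natDegree
  obtain ⟨P, hP⟩ : ∃ P, P = X 0 * Polynomial.aeval u h₁ := ⟨_, rfl⟩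
  obtain ⟨Q, hQ⟩ : ∃ Q, Q = X 1 * Polynomial.aeval u h₂ := ⟨_, rfl⟩
  rw [← hP, ← hQ, aeval_eq_sum_fin_two]
  have hκ : Function.Injective (wtLex n m) := wtLex_injective hm
  obtain ⟨e, he⟩ := exists_isLead (wtLex n m) hu
  have heU : wt n m e = U := by rw [← hU, he.wdeg_eq]
  have hκe : 0 < wtLex n m e := by
    refine lt_of_not_ge fun h => ?_
    have h1 : wt n m e ≤ wt n m 0 := wt_le_of_wtLex_le (by simpa using h)
    rw [heU, map_zero] at h1
    omega
  have hPlead : IsLead (wtLex n m) P (Finsupp.single 0 1 + m₁ • e) := by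
    rw [hP]; exact (isLead_X _ 0).mul hκ (he.polynomial_aeval hκ hκe hh₁)
  have hQlead : IsLead (wtLex n m) Q (Finsupp.single 1 1 + m₂ • e) := by
    rw [hQ]; exact (isLead_X _ 1).mul hκ (he.polynomial_aeval hκ hκe hh₂)
  set L : (Fin 2 →₀ ℕ) → (Fin 2 →₀ ℕ) := fun s =>
    s 0 • (Finsupp.single 0 1 + m₁ • e) + s 1 • (Finsupp.single 1 1 + m₂ • e) with hL
  have hterm : ∀ s ∈ F.support, IsLead (wtLex n m)
      (algebraMap k (MvPolynomial (Fin 2) k) (coeff s F) * (P ^ s 0 * Q ^ s 1)) (L s) := by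
    intro s hs
    have := (isLead_C (wtLex n m) (mem_support_iff.1 hs)).mul hκ
      ((hPlead.pow hκ (s 0)).mul hκ (hQlead.pow hκ (s 1)))
    rwa [zero_add] at this
  -- Distinct monomials of `F` acquire distinct leading monomials, so the largest of them cannot
  -- cancel.
  have hLinj : Function.Injective L := by
    intro s t hst
    have h0 := DFunLike.congr_fun hst 0
    have h1 := DFunLike.congr_fun hst 1
    simp only [hL, Finsupp.add_apply, Finsupp.smul_apply, smul_eq_mul] at h0 h1
    simp at h0 h1
    obtain ⟨h2, h3⟩ := injective_of_exponents (m₁ := m₁) (m₂ := m₂) (I := e 0) (J := e 1)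
      (α := s 0) (β := s 1) (α' := t 0) (β' := t 1) (by linarith) (by linarith)
    rw [← expo_self s, ← expo_self t, h2, h3]
  have hwtL : ∀ s, wt n m (L s) = wt (n + m₁ * U) (m + m₂ * U) s := by
    intro s
    have h0 : wt n m (Finsupp.single 0 1) = n := by simp [wt_apply]
    have h1 : wt n m (Finsupp.single 1 1) = m := by simp [wt_apply]
    simp only [hL, map_add, map_nsmul, h0, h1, heU]
    rw [wt_apply]; simp only [smul_eq_mul]; ring
  obtain ⟨s₀, hs₀, hmax⟩ := F.support.exists_max_image (fun s => wtLex n m (L s))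
    (support_nonempty.2 hF)
  have hlead := isLead_sum hs₀ hterm fun t ht hne =>
    lt_of_le_of_ne (hmax t ht) fun h => hne (hLinj (hκ h))
  have hW : wt n m (L s₀) = wdeg (n + m₁ * U) (m + m₂ * U) F := by
    refine le_antisymm ?_ (wdeg_le fun s hs => ?_)
    · rw [hwtL]; exact le_wdeg hs₀
    · rw [← hwtL]; exact wt_le_of_wtLex_le (hmax s hs)
  refine ⟨?_, ?_, ?_⟩
  · exact support_nonempty.1 ⟨_, hlead.1⟩
  · rw [hlead.wdeg_eq, hW]
  · intro d hd hdW
    obtain ⟨s, hs, hsd⟩ := Finset.mem_biUnion.1 (support_sum hd)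
    have hPtop : TopMin n m P (n + m₁ * U) (1 + m₁ * I) (0 + m₁ * J) := by
      rw [hP]; exact (topMin_X_zero n m).mul (htop.polynomial_aeval hUpos h₁)
    have hQtop : TopMin n m Q (m + m₂ * U) (0 + m₂ * I) (1 + m₂ * J) := by
      rw [hQ]; exact (topMin_X_one n m).mul (htop.polynomial_aeval hUpos h₂)
    obtain ⟨h1, h2⟩ := (topMin_C n m (coeff s F)).mul
      ((hPtop.pow (s 0)).mul (hQtop.pow (s 1))) d hsd
    have hsW : wt (n + m₁ * U) (m + m₂ * U) s =
        0 + (s 0 * (n + m₁ * U) + s 1 * (m + m₂ * U)) := by rw [wt_apply]; ring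
    have hsle := le_wdeg (n := n + m₁ * U) (m := m + m₂ * U) hs
    obtain ⟨h3, h4⟩ := h2 (by omega)
    refine ⟨s, hs, by omega, ?_, ?_⟩
    · calc _ = 0 + (s 0 * (1 + m₁ * I) + s 1 * (0 + m₂ * I)) := by ring
        _ ≤ d 0 := h3
    · calc _ = 0 + (s 0 * (0 + m₁ * J) + s 1 * (1 + m₂ * J)) := by ring
        _ ≤ d 1 := h4

end Face

/-! ### Valuations trivial on constants and the Newton polygon. -/

section Valuation

variable {K Ω Γ : Type*} [Field K] [Field Ω] [Algebra K Ω] [LinearOrderedCommGroupWithZero Γ]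

/-- The valuation is trivial on the constants. -/
def Valuation.TrivialOn (v : Valuation Ω Γ) (K : Type*) [Field K] [Algebra K Ω] : Prop :=
  ∀ c : K, c ≠ 0 → v (algebraMap K Ω c) = 1

theorem Valuation.TrivialOn.le_one {v : Valuation Ω Γ} (hv : v.TrivialOn K) (c : K) :
    v (algebraMap K Ω c) ≤ 1 := by
  by_cases hc : c = 0
  · rw [hc, map_zero, map_zero]; exact zero_le_one
  · exact (hv c hc).le

theorem Valuation.TrivialOn.aeval_eq {v : Valuation Ω Γ} (hv : v.TrivialOn K) {σ : Ω}
    (hσ : 1 < v σ) {q : Polynomial K} (hq : q ≠ 0) :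
    v (Polynomial.aeval σ q) = v σ ^ q.natDegree := by
  have hlc : v (algebraMap K Ω (q.coeff q.natDegree) * σ ^ q.natDegree) = v σ ^ q.natDegree := by
    rw [map_mul, map_pow, hv _ (by simpa using hq), one_mul]
  rw [Polynomial.aeval_eq_sum_range, Finset.sum_range_succ]
  simp only [Algebra.smul_def]
  rw [Valuation.map_add_eq_of_lt_right, hlc]
  rw [hlc]
  refine v.map_sum_lt (pow_ne_zero _ (zero_lt_one.trans hσ).ne') fun i hi => ?_
  rw [Finset.mem_range] at hi
  rw [map_mul, map_pow]
  calc v (algebraMap K Ω (q.coeff i)) * v σ ^ i ≤ 1 * v σ ^ i :=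
        mul_le_mul_left (hv.le_one _) _
    _ = v σ ^ i := one_mul _
    _ < v σ ^ q.natDegree := pow_lt_pow_right₀ hσ hi

theorem Valuation.TrivialOn.aeval_le_one {v : Valuation Ω Γ} (hv : v.TrivialOn K) {σ : Ω}
    (hσ : v σ ≤ 1) (q : Polynomial K) : v (Polynomial.aeval σ q) ≤ 1 := by
  rw [Polynomial.aeval_eq_sum_range]
  refine v.map_sum_le fun i _ => ?_
  rw [Algebra.smul_def, map_mul, map_pow]
  exact mul_le_one' (hv.le_one _) (pow_le_one' hσ i)

theorem Valuation.TrivialOn.one_le_aeval {v : Valuation Ω Γ} (hv : v.TrivialOn K) {σ : Ω}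
    (hσ : 1 < v σ) {q : Polynomial K} (hq : Polynomial.aeval σ q ≠ 0) :
    1 ≤ v (Polynomial.aeval σ q) := by
  have h : q ≠ 0 := by rintro rfl; exact hq (map_zero _)
  rw [hv.aeval_eq hσ h]
  exact one_le_pow₀ hσ.le

/-- The contribution of a root `η` to the Newton estimate at slope `r`. -/
noncomputable def newtonFactor (v : Valuation Ω Γ) (r : Γ) (η : Ω) : Γ :=
  if v η < r then r else if v η = r then 1 else v η

/-- A weak form of the Newton polygon: the Gauss norm at radius `r` of a polynomial is attained at
the indices `J₀` and `J₁`, and the product of the roots outside the disc of radius `r` can be read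
off from it. -/
theorem exists_newton_indices (v : Valuation Ω Γ) {r : Γ} (hr : 0 < r) {g : Ω} (hg : g ≠ 0)
    (s : Multiset Ω) :
    ∃ (J₀ J₁ : ℕ) (N : Γ), 0 < N ∧
      (∀ j, v ((Polynomial.C g * (s.map fun η => Polynomial.X - Polynomial.C η).prod).coeff j) *
        r ^ j ≤ N) ∧
      (∀ j, J₁ < j →
        v ((Polynomial.C g * (s.map fun η => Polynomial.X - Polynomial.C η).prod).coeff j) *
        r ^ j < N) ∧
      (∀ j, j < J₀ →
        v ((Polynomial.C g * (s.map fun η => Polynomial.X - Polynomial.C η).prod).coeff j) *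
        r ^ j < N) ∧
      v ((Polynomial.C g * (s.map fun η => Polynomial.X - Polynomial.C η).prod).coeff J₀) *
        r ^ J₀ = N ∧
      v ((Polynomial.C g * (s.map fun η => Polynomial.X - Polynomial.C η).prod).coeff J₁) *
        r ^ J₁ = N ∧
      (v g * (s.map (newtonFactor v r)).prod) * r ^ J₁ = N * r ^ J₀ := by
  -- `J₀` and `J₁` are the least and the greatest index at which the Gauss norm `N` is attained. A
  -- new root multiplies `N` by the larger of its value and `r`: a small root raises both indices,
  -- one of value `r` raises only `J₁`, and a large one raises neither. The three values of
  -- `newtonFactor` preserve the last identity.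
  induction s using Multiset.induction_on with
  | empty =>
    have hg' : 0 < v g := (Valuation.pos_iff v).2 hg
    refine ⟨0, 0, v g, hg', ?_, ?_, ?_, ?_, ?_, ?_⟩
    · intro j
      rcases Nat.eq_zero_or_pos j with rfl | hj
      · simp
      · simp [Polynomial.coeff_C, hj.ne']
    · intro j hj
      simpa [Polynomial.coeff_C, hj.ne'] using hg'
    · intro j hj; exact absurd hj (Nat.not_lt_zero j)
    · simp
    · simp
    · simp
  | cons η s ih =>
    obtain ⟨J₀, J₁, N, hN, hle, hgt, hlt, h₀, h₁, hc⟩ := ih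
    obtain ⟨f, hf⟩ : ∃ f, f = Polynomial.C g *
      (s.map fun η => Polynomial.X - Polynomial.C η).prod := ⟨_, rfl⟩
    rw [← hf] at hle hgt hlt h₀ h₁
    have hf' : Polynomial.C g * ((η ::ₘ s).map fun η => Polynomial.X - Polynomial.C η).prod =
        f * (Polynomial.X - Polynomial.C η) := by
      rw [Multiset.map_cons, Multiset.prod_cons, hf]; ring
    rw [hf', Multiset.map_cons, Multiset.prod_cons]
    have hco0 : (f * (Polynomial.X - Polynomial.C η)).coeff 0 = - (f.coeff 0 * η) := by
      rw [mul_sub, Polynomial.coeff_sub, Polynomial.coeff_mul_C, Polynomial.mul_coeff_zero]; simp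
    have hco : ∀ j, (f * (Polynomial.X - Polynomial.C η)).coeff (j + 1) =
        f.coeff j - f.coeff (j + 1) * η := by
      intro j
      rw [mul_sub, Polynomial.coeff_sub, Polynomial.coeff_mul_C, Polynomial.coeff_mul_X]
    have s1 : ∀ j, v (f.coeff j) * r ^ (j + 1) = (v (f.coeff j) * r ^ j) * r := by
      intro j; rw [pow_succ, mul_assoc]
    have s2 : ∀ j, v (f.coeff j * η) * r ^ j = (v (f.coeff j) * r ^ j) * v η := by
      intro j; rw [map_mul]; exact mul_right_comm _ _ _
    -- combining two bounds for the two terms of a coefficient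
    have comb_lt : ∀ (j : ℕ) (B : Γ), v (f.coeff j) * r ^ (j + 1) < B →
        v (f.coeff (j + 1) * η) * r ^ (j + 1) < B →
        v ((f * (Polynomial.X - Polynomial.C η)).coeff (j + 1)) * r ^ (j + 1) < B := by
      intro j B h1 h2
      rw [hco]
      rcases le_max_iff.1 (v.map_sub (f.coeff j) (f.coeff (j + 1) * η)) with h | h
      · exact (mul_le_mul_left h _).trans_lt h1
      · exact (mul_le_mul_left h _).trans_lt h2
    have comb_le : ∀ (j : ℕ) (B : Γ), v (f.coeff j) * r ^ (j + 1) ≤ B →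
        v (f.coeff (j + 1) * η) * r ^ (j + 1) ≤ B →
        v ((f * (Polynomial.X - Polynomial.C η)).coeff (j + 1)) * r ^ (j + 1) ≤ B := by
      intro j B h1 h2
      rw [hco]
      rcases le_max_iff.1 (v.map_sub (f.coeff j) (f.coeff (j + 1) * η)) with h | h
      · exact (mul_le_mul_left h _).trans h1
      · exact (mul_le_mul_left h _).trans h2
    have comb_left : ∀ (j : ℕ), v (f.coeff (j + 1) * η) * r ^ (j + 1) <
        v (f.coeff j) * r ^ (j + 1) →
        v ((f * (Polynomial.X - Polynomial.C η)).coeff (j + 1)) * r ^ (j + 1) =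
          v (f.coeff j) * r ^ (j + 1) := by
      intro j h
      rw [hco, Valuation.map_sub_eq_of_lt_left]
      exact lt_of_mul_lt_mul_right' h
    have comb_right : ∀ (j : ℕ), v (f.coeff j) * r ^ (j + 1) <
        v (f.coeff (j + 1) * η) * r ^ (j + 1) →
        v ((f * (Polynomial.X - Polynomial.C η)).coeff (j + 1)) * r ^ (j + 1) =
          v (f.coeff (j + 1) * η) * r ^ (j + 1) := by
      intro j h
      rw [hco, Valuation.map_sub_eq_of_lt_right]
      exact lt_of_mul_lt_mul_right' h
    have zero_eq : v ((f * (Polynomial.X - Polynomial.C η)).coeff 0) * r ^ 0 =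
        (v (f.coeff 0) * r ^ 0) * v η := by
      rw [hco0, Valuation.map_neg, map_mul]; exact mul_right_comm _ _ _
    rcases lt_trichotomy (v η) r with hη | hη | hη
    · -- small root
      have hNη : N * v η < N * r := mul_lt_mul_of_pos_left hη hN
      refine ⟨J₀ + 1, J₁ + 1, N * r, mul_pos hN hr, ?_, ?_, ?_, ?_, ?_, ?_⟩
      · intro j
        rcases j with _ | j
        · rw [zero_eq]; exact (mul_le_mul_left (hle 0) _).trans hNη.le
        · refine comb_le j _ ?_ ?_
          · rw [s1]; exact mul_le_mul_left (hle j) _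
          · rw [s2]; exact (mul_le_mul_left (hle _) _).trans hNη.le
      · intro j hj
        obtain ⟨j, rfl⟩ := Nat.exists_eq_succ_of_ne_zero (by omega : j ≠ 0)
        refine comb_lt j _ ?_ ?_
        · rw [s1]; exact mul_lt_mul_of_pos_right (hgt j (by omega)) hr
        · rw [s2]; exact (mul_le_mul_left (hle _) _).trans_lt hNη
      · intro j hj
        rcases j with _ | j
        · rw [zero_eq]; exact (mul_le_mul_left (hle 0) _).trans_lt hNη
        · refine comb_lt j _ ?_ ?_
          · rw [s1]; exact mul_lt_mul_of_pos_right (hlt j (by omega)) hr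
          · rw [s2]; exact (mul_le_mul_left (hle _) _).trans_lt hNη
      · rw [comb_left, s1, h₀]
        rw [s1, h₀, s2]; exact (mul_le_mul_left (hle _) _).trans_lt hNη
      · rw [comb_left, s1, h₁]
        rw [s1, h₁, s2]; exact (mul_le_mul_left (hle _) _).trans_lt hNη
      · have : newtonFactor v r η = r := by rw [newtonFactor, if_pos hη]
        rw [this]
        calc v g * (r * (s.map (newtonFactor v r)).prod) * r ^ (J₁ + 1) =
            v g * (s.map (newtonFactor v r)).prod * r ^ J₁ * r * r := by
              rw [pow_succ]; ac_rfl
          _ = N * r ^ J₀ * r * r := by rw [hc]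
          _ = _ := by rw [pow_succ]; ac_rfl
    · -- root of absolute value `r`
      refine ⟨J₀, J₁ + 1, N * r, mul_pos hN hr, ?_, ?_, ?_, ?_, ?_, ?_⟩
      · intro j
        rcases j with _ | j
        · rw [zero_eq, hη]; exact mul_le_mul_left (hle 0) _
        · refine comb_le j _ ?_ ?_
          · rw [s1]; exact mul_le_mul_left (hle j) _
          · rw [s2, hη]; exact mul_le_mul_left (hle _) _
      · intro j hj
        obtain ⟨j, rfl⟩ := Nat.exists_eq_succ_of_ne_zero (by omega : j ≠ 0)
        refine comb_lt j _ ?_ ?_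
        · rw [s1]; exact mul_lt_mul_of_pos_right (hgt j (by omega)) hr
        · rw [s2, hη]; exact mul_lt_mul_of_pos_right (hgt _ (by omega)) hr
      · intro j hj
        rcases j with _ | j
        · rw [zero_eq, hη]; exact mul_lt_mul_of_pos_right (hlt _ hj) hr
        · refine comb_lt j _ ?_ ?_
          · rw [s1]; exact mul_lt_mul_of_pos_right (hlt j (by omega)) hr
          · rw [s2, hη]; exact mul_lt_mul_of_pos_right (hlt _ hj) hr
      · rcases J₀ with _ | J₀
        · rw [zero_eq, hη, h₀]
        · rw [comb_right, s2, h₀, hη]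
          rw [s1, s2, h₀, hη]; exact mul_lt_mul_of_pos_right (hlt _ (by omega)) hr
      · rw [comb_left, s1, h₁]
        rw [s1, h₁, s2, hη]; exact mul_lt_mul_of_pos_right (hgt _ (by omega)) hr
      · have : newtonFactor v r η = 1 := by rw [newtonFactor, if_neg hη.not_lt, if_pos hη]
        rw [this, one_mul]
        calc v g * (s.map (newtonFactor v r)).prod * r ^ (J₁ + 1) =
            v g * (s.map (newtonFactor v r)).prod * r ^ J₁ * r := by
              rw [pow_succ]; ac_rfl
          _ = N * r ^ J₀ * r := by rw [hc]
          _ = _ := by ac_rfl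
    · -- large root
      have hNη : N * r < N * v η := mul_lt_mul_of_pos_left hη hN
      have hη0 : 0 < v η := hr.trans hη
      refine ⟨J₀, J₁, N * v η, mul_pos hN hη0, ?_, ?_, ?_, ?_, ?_, ?_⟩
      · intro j
        rcases j with _ | j
        · rw [zero_eq]; exact mul_le_mul_left (hle 0) _
        · refine comb_le j _ ?_ ?_
          · rw [s1]; exact (mul_le_mul_left (hle j) _).trans hNη.le
          · rw [s2]; exact mul_le_mul_left (hle _) _
      · intro j hj
        obtain ⟨j, rfl⟩ := Nat.exists_eq_succ_of_ne_zero (by omega : j ≠ 0)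
        refine comb_lt j _ ?_ ?_
        · rw [s1]; exact (mul_le_mul_left (hle j) _).trans_lt hNη
        · rw [s2]; exact mul_lt_mul_of_pos_right (hgt _ hj) hη0
      · intro j hj
        rcases j with _ | j
        · rw [zero_eq]; exact mul_lt_mul_of_pos_right (hlt _ hj) hη0
        · refine comb_lt j _ ?_ ?_
          · rw [s1]; exact (mul_le_mul_left (hle j) _).trans_lt hNη
          · rw [s2]; exact mul_lt_mul_of_pos_right (hlt _ hj) hη0
      · rcases J₀ with _ | J₀
        · rw [zero_eq, h₀]
        · rw [comb_right, s2, h₀]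
          rw [s1, s2, h₀]; exact (mul_le_mul_left (hle _) _).trans_lt hNη
      · rcases J₁ with _ | J₁
        · rw [zero_eq, h₁]
        · rw [comb_right, s2, h₁]
          rw [s1, s2, h₁]; exact (mul_le_mul_left (hle _) _).trans_lt hNη
      · have : newtonFactor v r η = v η := by
          rw [newtonFactor, if_neg hη.not_gt, if_neg hη.ne']
        rw [this]
        calc v g * (v η * (s.map (newtonFactor v r)).prod) * r ^ J₁ =
            v g * (s.map (newtonFactor v r)).prod * r ^ J₁ * v η := by ac_rfl
          _ = N * r ^ J₀ * v η := by rw [hc]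
          _ = _ := by ac_rfl

end Valuation

/-! ### A valued algebraically closed extension. -/

section Existence

universe w

/-- In the algebraic closure of K(x) the element x is not integral over K. The integral closure is
the intersection of the valuation rings containing K, so one of these omits x; nonzero constants are
units in it. -/
theorem exists_valued_extension (K : Type w) [Field K] [IsAlgClosed K] :
    ∃ (Ω : Type w) (_ : Field Ω) (_ : Algebra K Ω) (_ : IsAlgClosed Ω) (Γ : Type w)
      (_ : LinearOrderedCommGroupWithZero Γ) (v : Valuation Ω Γ) (ξ : Ω),
      v.TrivialOn K ∧ 1 < v ξ := by
  let Ω := AlgebraicClosure (RatFunc K)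
  let ξ : Ω := algebraMap (RatFunc K) Ω RatFunc.X
  have htr : ¬ IsAlgebraic K ξ := by
    intro h
    rw [isAlgebraic_algebraMap_iff (algebraMap (RatFunc K) Ω).injective] at h
    exact RatFunc.transcendental_X h
  have hnot : ξ ∉ (integralClosure (Subring.closure (Set.range (algebraMap K Ω))) Ω).toSubring := by
    intro h
    have h' : IsIntegral (Subring.closure (Set.range (algebraMap K Ω))) ξ := h
    obtain ⟨f, hf, hf0⟩ := h'
    have hR : Subring.closure (Set.range (algebraMap K Ω)) = (algebraMap K Ω).range := by
      rw [← RingHom.coe_range, Subring.closure_eq]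
    have hlift : ∀ x : Subring.closure (Set.range (algebraMap K Ω)), ∃ c : K,
        algebraMap K Ω c = x := by
      rintro ⟨x, hx⟩
      rw [hR] at hx
      exact hx
    choose lift hl using hlift
    let g : Polynomial K := ∑ i ∈ Finset.range (f.natDegree + 1),
      Polynomial.monomial i (lift (f.coeff i))
    have hg0 : g ≠ 0 := by
      intro h0
      have h1 : g.coeff f.natDegree = lift (f.coeff f.natDegree) := by
        simp only [g, Polynomial.finsetSum_coeff, Polynomial.coeff_monomial]
        rw [Finset.sum_ite_eq']
        simp
      rw [h0, Polynomial.coeff_zero] at h1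
      have h2 := hl (f.coeff f.natDegree)
      rw [← h1, map_zero, Polynomial.coeff_natDegree, hf.leadingCoeff] at h2
      simp at h2
    refine htr ⟨g, hg0, ?_⟩
    rw [Polynomial.eval₂_eq_sum_range] at hf0
    simp only [g, map_sum, Polynomial.aeval_monomial, hl]
    exact hf0
  rw [← iInf_valuationSubring_superset, Subring.mem_iInf] at hnot
  push Not at hnot
  obtain ⟨⟨V, hV⟩, hξ⟩ := hnot
  refine ⟨Ω, inferInstance, inferInstance, inferInstance, V.ValueGroup, inferInstance,
    V.valuation, ξ, ?_, ?_⟩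
  · intro c hc
    refine le_antisymm ?_ ?_
    · rw [V.valuation_le_one_iff]; exact hV ⟨c, rfl⟩
    · have h1 : V.valuation (algebraMap K Ω c⁻¹) ≤ 1 := by
        rw [V.valuation_le_one_iff]; exact hV ⟨c⁻¹, rfl⟩
      rw [map_inv₀, map_inv₀] at h1
      have h2 : V.valuation (algebraMap K Ω c) ≠ 0 := by
        rw [Ne, Valuation.zero_iff]; simpa using hc
      exact (inv_le_one₀ (zero_lt_iff.2 h2)).1 h1
  · rw [← not_le, V.valuation_le_one_iff]; exact hξ

end Existence

/-! ### Separation of fibres. -/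

section Separation

variable {K Ω Γ : Type*} [Field K] [Field Ω] [Algebra K Ω] [LinearOrderedCommGroupWithZero Γ]

theorem multiset_prod_map_le {ι : Type*} (s : Multiset ι) {f g : ι → Γ}
    (h : ∀ i ∈ s, f i ≤ g i) : (s.map f).prod ≤ (s.map g).prod := by
  induction s using Multiset.induction_on with
  | empty => simp
  | cons a s ih =>
    rw [Multiset.map_cons, Multiset.map_cons, Multiset.prod_cons, Multiset.prod_cons]
    exact mul_le_mul' (h a (Multiset.mem_cons_self a s))
      (ih fun i hi => h i (Multiset.mem_cons_of_mem hi))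

/-- Let β₀ be a point of the two sets nearest to η. By the ultrametric inequality no point is
farther from β₀ than from η, so the bound at β₀ against the other set passes to η. -/
theorem one_le_prod_sub_or {v : Valuation Ω Γ} {B B' : Multiset Ω}
    (h : ∀ β ∈ B, 1 ≤ (B'.map fun β' => v (β - β')).prod)
    (h' : ∀ β' ∈ B', 1 ≤ (B.map fun β => v (β' - β)).prod) (η : Ω) :
    1 ≤ (B.map fun β => v (η - β)).prod ∨ 1 ≤ (B'.map fun β => v (η - β)).prod := by
  classical
  by_cases hne : (B + B').toFinset.Nonempty
  swap
  · left
    have : B = 0 := by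
      by_contra h0
      obtain ⟨x, hx⟩ := Multiset.exists_mem_of_ne_zero h0
      exact hne ⟨x, by simp [hx]⟩
    simp [this]
  obtain ⟨β₀, hβ₀, hmin⟩ := (B + B').toFinset.exists_min_image (fun β => v (η - β)) hne
  simp only [Multiset.mem_toFinset, Multiset.mem_add] at hβ₀ hmin
  have key : ∀ β, β ∈ B ∨ β ∈ B' → v (β₀ - β) ≤ v (η - β) := by
    intro β hβ
    have e : β₀ - β = (η - β) - (η - β₀) := by ring
    rw [e]
    exact (v.map_sub _ _).trans (max_le le_rfl (hmin β hβ))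
  rcases hβ₀ with hβ₀ | hβ₀
  · right
    exact (h β₀ hβ₀).trans (multiset_prod_map_le _ fun β hβ => key β (Or.inr hβ))
  · left
    exact (h' β₀ hβ₀).trans (multiset_prod_map_le _ fun β hβ => key β (Or.inl hβ))

/-- The points of the parametrized curve where the first coordinate takes the value `ξ`. -/
noncomputable def fiberRoots (a : Polynomial K) (ξ : Ω) : Multiset Ω :=
  (a.map (algebraMap K Ω) - Polynomial.C ξ).roots

theorem natDegree_fiber (a : Polynomial K) (ξ : Ω) :
    (a.map (algebraMap K Ω) - Polynomial.C ξ).natDegree = a.natDegree := by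
  rw [Polynomial.natDegree_sub_C, Polynomial.natDegree_map]

theorem leadingCoeff_fiber {a : Polynomial K} (ha : 0 < a.natDegree) (ξ : Ω) :
    (a.map (algebraMap K Ω) - Polynomial.C ξ).leadingCoeff = algebraMap K Ω a.leadingCoeff := by
  rw [Polynomial.leadingCoeff, natDegree_fiber a, Polynomial.coeff_sub, Polynomial.coeff_map,
    Polynomial.coeff_C_of_ne_zero ha.ne', sub_zero, Polynomial.coeff_natDegree]

theorem aeval_eq_of_mem_fiberRoots {a : Polynomial K} {ξ σ : Ω} (h : σ ∈ fiberRoots a ξ) :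
    Polynomial.aeval σ a = ξ := by
  have := Polynomial.isRoot_of_mem_roots h
  rw [Polynomial.IsRoot, Polynomial.eval_sub, Polynomial.eval_C, sub_eq_zero,
    Polynomial.eval_map_algebraMap] at this
  exact this

theorem card_fiberRoots [IsAlgClosed Ω] (a : Polynomial K) (ξ : Ω) :
    Multiset.card (fiberRoots a ξ) = a.natDegree := by
  rw [fiberRoots, ← (IsAlgClosed.splits _).natDegree_eq_card_roots, natDegree_fiber a]

theorem Valuation.TrivialOn.one_lt_of_mem_fiberRoots {v : Valuation Ω Γ} (hv : v.TrivialOn K)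
    {a : Polynomial K} {ξ σ : Ω} (hξ : 1 < v ξ) (h : σ ∈ fiberRoots a ξ) : 1 < v σ := by
  by_contra hle
  have := hv.aeval_le_one (not_lt.1 hle) a
  rw [aeval_eq_of_mem_fiberRoots h] at this
  exact absurd this (not_le.2 hξ)

/-- Up to a constant of value `1`, the product over the fibre is a resultant, hence a polynomial in
`σ` over `K`. Disjointness makes it nonzero, and a nonzero polynomial at a point of value above `1`
has value at least `1`. -/
theorem Valuation.TrivialOn.one_le_prod_fiber [IsAlgClosed Ω] {v : Valuation Ω Γ}
    (hv : v.TrivialOn K) {ξ : Ω} (hξ : 1 < v ξ) {a b a' b' : Polynomial K}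
    (ha' : 0 < a'.natDegree)
    (hdisj : ∀ σ σ' : Ω, 1 < v σ → 1 < v σ' → Polynomial.aeval σ a = Polynomial.aeval σ' a' →
      Polynomial.aeval σ b ≠ Polynomial.aeval σ' b')
    {σ : Ω} (hσ : σ ∈ fiberRoots a ξ) :
    1 ≤ ((fiberRoots a' ξ).map fun σ' =>
      v (Polynomial.aeval σ b - Polynomial.aeval σ' b')).prod := by
  have hσ1 := hv.one_lt_of_mem_fiberRoots hξ hσ
  have hσa := aeval_eq_of_mem_fiberRoots hσ
  let φ : Polynomial K →+* Ω := (Polynomial.aeval σ : Polynomial K →ₐ[K] Ω).toRingHom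
  have hφC : φ.comp Polynomial.C = algebraMap K Ω := by
    ext c; simp [φ]
  have hmap : ∀ q' q : Polynomial K, (q'.map Polynomial.C - Polynomial.C q).map φ =
      q'.map (algebraMap K Ω) - Polynomial.C (Polynomial.aeval σ q) := by
    intro q' q
    rw [Polynomial.map_sub, Polynomial.map_map, hφC, Polynomial.map_C]; rfl
  have hres := Polynomial.resultant_map_map (a'.map Polynomial.C - Polynomial.C a)
    (b'.map Polynomial.C - Polynomial.C b) a'.natDegree b'.natDegree φ
  rw [hmap, hmap, hσa] at hres
  have hprod := Polynomial.resultant_eq_prod_eval (a'.map (algebraMap K Ω) - Polynomial.C ξ)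
    (b'.map (algebraMap K Ω) - Polynomial.C (Polynomial.aeval σ b)) b'.natDegree
    (by rw [Polynomial.natDegree_sub_C, Polynomial.natDegree_map]) (IsAlgClosed.splits _)
  rw [natDegree_fiber a', hres, leadingCoeff_fiber ha'] at hprod
  have hlc : v (algebraMap K Ω a'.leadingCoeff) = 1 := hv _ (by
    rw [Ne, Polynomial.leadingCoeff_eq_zero]; rintro rfl; simp at ha')
  have hev : ∀ σ', (b'.map (algebraMap K Ω) - Polynomial.C (Polynomial.aeval σ b)).eval σ' =
      Polynomial.aeval σ' b' - Polynomial.aeval σ b := by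
    intro σ'
    rw [Polynomial.eval_sub, Polynomial.eval_C, Polynomial.eval_map_algebraMap]
  have hval : v (φ ((a'.map Polynomial.C - Polynomial.C a).resultant
      (b'.map Polynomial.C - Polynomial.C b) a'.natDegree b'.natDegree)) =
      ((fiberRoots a' ξ).map fun σ' =>
        v (Polynomial.aeval σ b - Polynomial.aeval σ' b')).prod := by
    rw [hprod, map_mul, map_pow, hlc, one_pow, one_mul, map_multiset_prod, Multiset.map_map]
    refine congrArg _ (Multiset.map_congr rfl fun σ' _ => ?_)
    rw [Function.comp_apply, hev, v.map_sub_swap]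
  rw [← hval]
  refine hv.one_le_aeval hσ1 fun h0 => ?_
  have h0' : v (φ ((a'.map Polynomial.C - Polynomial.C a).resultant
      (b'.map Polynomial.C - Polynomial.C b) a'.natDegree b'.natDegree)) = 0 := by
    have : φ ((a'.map Polynomial.C - Polynomial.C a).resultant
      (b'.map Polynomial.C - Polynomial.C b) a'.natDegree b'.natDegree) = 0 := h0
    rw [this, map_zero]
  rw [hval, Multiset.prod_eq_zero_iff, Multiset.mem_map] at h0'
  obtain ⟨σ', hσ', h1⟩ := h0'
  rw [Valuation.zero_iff, sub_eq_zero] at h1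
  refine hdisj σ σ' hσ1 (hv.one_lt_of_mem_fiberRoots hξ hσ') ?_ h1
  rw [hσa, aeval_eq_of_mem_fiberRoots hσ']

end Separation

/-! ### Restriction to the lines `X 0 = ξ`. -/

section Slices

variable {K Ω : Type*} [Field K] [Field Ω] [Algebra K Ω]

/-- The coefficient of `X 1 ^ j`, as a polynomial in `X 0`. -/
noncomputable def sliceCoeff (G : MvPolynomial (Fin 2) K) (j : ℕ) : Polynomial K :=
  ∑ d ∈ G.support with d 1 = j, Polynomial.monomial (d 0) (coeff d G)

theorem coeff_sliceCoeff (G : MvPolynomial (Fin 2) K) (i j : ℕ) :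
    (sliceCoeff G j).coeff i = coeff (expo i j) G := by
  classical
  rw [sliceCoeff, Polynomial.finsetSum_coeff]
  simp only [Polynomial.coeff_monomial]
  by_cases h : expo i j ∈ G.support
  · rw [Finset.sum_eq_single (expo i j)]
    · simp
    · intro d hd hne
      rw [if_neg]
      rintro rfl
      rw [Finset.mem_filter] at hd
      exact hne (by rw [← hd.2, expo_self])
    · intro h'
      exact absurd (Finset.mem_filter.2 ⟨h, expo_one i j⟩) h'
  · rw [notMem_support_iff.1 h]
    refine Finset.sum_eq_zero fun d hd => if_neg ?_
    rintro rfl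
    rw [Finset.mem_filter] at hd
    apply h
    rw [← hd.2, expo_self]
    exact hd.1

/-- The restriction of `G` to the line `X 0 = ξ`. -/
noncomputable def slicePoly (G : MvPolynomial (Fin 2) K) (ξ : Ω) : Polynomial Ω :=
  aeval ![Polynomial.C ξ, Polynomial.X] G

theorem coeff_slicePoly (G : MvPolynomial (Fin 2) K) (ξ : Ω) (j : ℕ) :
    (slicePoly G ξ).coeff j = Polynomial.aeval ξ (sliceCoeff G j) := by
  classical
  rw [slicePoly, aeval_eq_sum_fin_two, Polynomial.finsetSum_coeff, sliceCoeff, map_sum,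
    Finset.sum_filter]
  refine Finset.sum_congr rfl fun d _ => ?_
  rw [Polynomial.algebraMap_apply, Polynomial.coeff_C_mul, ← Polynomial.C_pow,
    Polynomial.coeff_C_mul, Polynomial.coeff_X_pow, Polynomial.aeval_monomial]
  by_cases h : d 1 = j
  · rw [if_pos h.symm, if_pos h, mul_one]
  · rw [if_neg (Ne.symm h), if_neg h, mul_zero, mul_zero]

theorem eval_slicePoly (G : MvPolynomial (Fin 2) K) (ξ η : Ω) :
    (slicePoly G ξ).eval η = aeval ![ξ, η] G := by
  rw [slicePoly, aeval_eq_sum_fin_two, aeval_eq_sum_fin_two, Polynomial.eval_finsetSum]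
  refine Finset.sum_congr rfl fun d _ => ?_
  simp [Polynomial.algebraMap_apply]

theorem natDegree_slicePoly_le (G : MvPolynomial (Fin 2) K) (ξ : Ω) :
    (slicePoly G ξ).natDegree ≤ G.totalDegree := by
  rw [Polynomial.natDegree_le_iff_coeff_eq_zero]
  intro j hj
  rw [coeff_slicePoly]
  have : sliceCoeff G j = 0 := by
    ext i
    rw [coeff_sliceCoeff, Polynomial.coeff_zero]
    by_contra h
    have := le_totalDegree_fin_two (mem_support_iff.2 h)
    simp at this
    omega
  rw [this, map_zero]

theorem aeval_aeval_pair (G : MvPolynomial (Fin 2) K) (a b : Polynomial K) (σ : Ω) :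
    Polynomial.aeval σ (aeval ![a, b] G) =
      aeval ![Polynomial.aeval σ a, Polynomial.aeval σ b] G := by
  rw [aeval_eq_sum_fin_two, aeval_eq_sum_fin_two, map_sum]
  refine Finset.sum_congr rfl fun d _ => ?_
  simp

end Slices

/-! ### The degree estimate on a pencil of curves. -/

section Estimate

variable {K Ω Γ : Type*} [Field K] [Field Ω] [Algebra K Ω] [LinearOrderedCommGroupWithZero Γ]

/-- When `v η ≠ r`, each distance is the larger of the two values. When `v η = r` there may be
cancellation, and only the hypothesis `hη` gives a bound; hence the value `1` in `newtonFactor`. -/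
theorem newtonFactor_pow_le {v : Valuation Ω Γ} {r : Γ} {η : Ω} {B : Multiset Ω}
    (hB : ∀ β ∈ B, v β = r) (hη : 1 ≤ (B.map fun β => v (η - β)).prod) :
    newtonFactor v r η ^ Multiset.card B ≤ (B.map fun β => v (η - β)).prod := by
  rcases lt_trichotomy (v η) r with h | h | h
  · rw [newtonFactor, if_pos h]
    have : B.map (fun β => v (η - β)) = B.map fun _ => r := Multiset.map_congr rfl fun β hβ => by
      rw [v.map_sub_eq_of_lt_right (by rwa [hB β hβ]), hB β hβ]
    rw [this, Multiset.map_const', Multiset.prod_replicate]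
  · rw [newtonFactor, if_neg h.not_lt, if_pos h, one_pow]
    exact hη
  · rw [newtonFactor, if_neg h.not_gt, if_neg h.ne']
    have : B.map (fun β => v (η - β)) = B.map fun _ => v η := Multiset.map_congr rfl fun β hβ => by
      rw [v.map_sub_eq_of_lt_left (by rwa [hB β hβ])]
    rw [this, Multiset.map_const', Multiset.prod_replicate]

theorem prod_prod_sub_comm (v : Valuation Ω Γ) (g : Ω) (S B : Multiset Ω) :
    v g ^ Multiset.card B * (S.map fun η => (B.map fun β => v (η - β)).prod).prod =
      (B.map fun β => v (g * (S.map fun η => β - η).prod)).prod := by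
  induction B using Multiset.induction_on with
  | empty => simp
  | cons β B ih =>
    simp only [Multiset.map_cons, Multiset.prod_cons, Multiset.card_cons]
    rw [← ih, map_mul, map_multiset_prod, Multiset.map_map, Multiset.prod_map_mul, pow_succ]
    have : S.map (v ∘ fun η => β - η) = S.map fun η => v (η - β) :=
      Multiset.map_congr rfl fun η _ => by rw [Function.comp_apply, v.map_sub_swap]
    rw [this]
    ac_rfl

theorem mul_prod_map_pow_le {ι : Type*} {g : Γ} {n : ℕ} (S : Multiset ι) {c d : ι → Γ}
    (h : ∀ η ∈ S, c η ^ n ≤ d η) :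
    (g * (S.map c).prod) ^ n ≤ g ^ n * (S.map d).prod := by
  rw [mul_pow, ← Multiset.prod_map_pow]
  exact mul_le_mul' le_rfl (multiset_prod_map_le S h)

/-- A lower bound for the degree of `G(a, b)` on a pencil of pairwise disjoint curves. -/
theorem le_natDegree_of_disjoint_curves [IsAlgClosed Ω] {v : Valuation Ω Γ}
    (hv : v.TrivialOn K) {ξ : Ω} (hξ : 1 < v ξ) {ι : Type*} {S : Finset ι}
    {a b : ι → Polynomial K} {n m ν A B : ℕ} {G : MvPolynomial (Fin 2) K}
    (hn : 0 < n) (ha : ∀ t ∈ S, (a t).natDegree = n) (hb : ∀ t ∈ S, (b t).natDegree = m)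
    (hm : 0 < m)
    (hdisj : ∀ t ∈ S, ∀ t' ∈ S, t ≠ t' → ∀ σ σ' : Ω, 1 < v σ → 1 < v σ' →
      Polynomial.aeval σ (a t) = Polynomial.aeval σ' (a t') →
      Polynomial.aeval σ (b t) ≠ Polynomial.aeval σ' (b t'))
    (hG : G ≠ 0) (hcard : G.totalDegree < S.card)
    (hw : ∀ t ∈ S, aeval ![a t, b t] G ≠ 0) (hν : ∀ t ∈ S, (aeval ![a t, b t] G).natDegree = ν)
    (htop : ∀ d ∈ G.support, wt n m d = wdeg n m G → A ≤ d 0 ∧ B ≤ d 1) :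
    n * A + m * B ≤ ν := by
  classical
  set f := slicePoly G ξ with hf
  have hξ0 : 0 < v ξ := zero_lt_one.trans hξ
  have hslice : ∀ j, sliceCoeff G j ≠ 0 → v (f.coeff j) = v ξ ^ (sliceCoeff G j).natDegree := by
    intro j hj
    rw [hf, coeff_slicePoly, hv.aeval_eq hξ hj]
  have hf0 : f ≠ 0 := by
    obtain ⟨d, hd⟩ := support_nonempty.2 hG
    have h1 : sliceCoeff G (d 1) ≠ 0 := by
      intro h
      have := coeff_sliceCoeff G (d 0) (d 1)
      rw [h, Polynomial.coeff_zero, expo_self] at this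
      exact mem_support_iff.1 hd this.symm
    intro h
    have := hslice (d 1) h1
    rw [h, Polynomial.coeff_zero, map_zero] at this
    exact pow_ne_zero _ hξ0.ne' this.symm
  have hfac : f = Polynomial.C f.leadingCoeff *
      (f.roots.map fun η => Polynomial.X - Polynomial.C η).prod :=
    (IsAlgClosed.splits f).eq_prod_roots
  -- the fibres
  let Bt : ι → Multiset Ω := fun t => (fiberRoots (a t) ξ).map fun σ => Polynomial.aeval σ (b t)
  have hsep : ∀ t ∈ S, ∀ t' ∈ S, t ≠ t' → ∀ β ∈ Bt t,
      1 ≤ ((Bt t').map fun β' => v (β - β')).prod := by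
    intro t ht t' ht' hne β hβ
    obtain ⟨σ, hσ, rfl⟩ := Multiset.mem_map.1 hβ
    rw [Multiset.map_map]
    exact hv.one_le_prod_fiber hξ (by rw [ha t' ht']; exact hn) (hdisj t ht t' ht' hne) hσ
  -- Pigeonhole: there are more curves than roots of `f`, and no root can be too close to two
  -- different fibres.
  obtain ⟨t, ht, hgood⟩ : ∃ t ∈ S, ∀ η ∈ f.roots, 1 ≤ ((Bt t).map fun β => v (η - β)).prod := by
    by_contra hbad
    push Not at hbad
    choose! bad hbad1 hbad2 using hbad
    have hlt : f.roots.toFinset.card < S.card := by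
      refine lt_of_le_of_lt ?_ hcard
      exact (Multiset.toFinset_card_le _).trans
        ((Polynomial.card_roots' f).trans (natDegree_slicePoly_le G ξ))
    obtain ⟨t, ht, t', ht', hne, heq⟩ := Finset.exists_ne_map_eq_of_card_lt_of_maps_to hlt
      (f := bad) (fun t ht => Multiset.mem_toFinset.2 (hbad1 t ht))
    rcases one_le_prod_sub_or (hsep t ht t' ht' hne) (hsep t' ht' t ht hne.symm) (bad t) with h | h
    · exact absurd h (not_le.2 (hbad2 t ht))
    · rw [heq] at h
      exact absurd h (not_le.2 (hbad2 t' ht'))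
  have hcardt : Multiset.card (fiberRoots (a t) ξ) = n := by rw [card_fiberRoots, ha t ht]
  have hcardB : Multiset.card (Bt t) = n := by rw [Multiset.card_map, hcardt]
  have hbne : b t ≠ 0 := by
    intro h
    have := hb t ht
    rw [h, Polynomial.natDegree_zero] at this
    omega
  have hane : a t ≠ 0 := by
    intro h
    have := ha t ht
    rw [h, Polynomial.natDegree_zero] at this
    omega
  obtain ⟨σ₀, hσ₀⟩ := Multiset.exists_mem_of_ne_zero (s := fiberRoots (a t) ξ) (by
    rintro h; rw [h, Multiset.card_zero] at hcardt; omega)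
  have hpow : ∀ σ ∈ fiberRoots (a t) ξ, v σ ^ n = v ξ := by
    intro σ hσ
    rw [← aeval_eq_of_mem_fiberRoots hσ, hv.aeval_eq (hv.one_lt_of_mem_fiberRoots hξ hσ) hane,
      ha t ht]
  -- All parameters `σ` over `ξ` have the same value `ρ`, with `ρ ^ n = v ξ`; the points of the
  -- fibre have value `ρ ^ m`, the radius used for the Newton polygon.
  obtain ⟨ρ, hρ⟩ : ∃ ρ, ρ = v σ₀ := ⟨_, rfl⟩
  have hρ1 : 1 < ρ := by rw [hρ]; exact hv.one_lt_of_mem_fiberRoots hξ hσ₀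
  have hρ0 : 0 < ρ := zero_lt_one.trans hρ1
  have hρn : ρ ^ n = v ξ := by rw [hρ]; exact hpow σ₀ hσ₀
  have hvσ : ∀ σ ∈ fiberRoots (a t) ξ, v σ = ρ := by
    intro σ hσ
    have : v σ ^ n = ρ ^ n := by rw [hpow σ hσ, hρn]
    exact (pow_left_inj₀ zero_le zero_le hn.ne').1 this
  have hBr : ∀ β ∈ Bt t, v β = ρ ^ m := by
    intro β hβ
    obtain ⟨σ, hσ, rfl⟩ := Multiset.mem_map.1 hβ
    rw [hv.aeval_eq (hv.one_lt_of_mem_fiberRoots hξ hσ) hbne, hb t ht, hvσ σ hσ]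
  have hr : 0 < ρ ^ m := pow_pos hρ0 m
  -- comparison with the Newton polygon
  have hupper : v f.leadingCoeff * (f.roots.map (newtonFactor v (ρ ^ m))).prod ≤ ρ ^ ν := by
    refine le_of_pow_le_pow_left₀ hn.ne' zero_le ?_
    -- The `n`-th power is bounded by the product of the values of `f` at the `n` points of the
    -- fibre. There `f` equals `G (a, b)` at `σ`, of value `ρ ^ ν`.
    have h1 := mul_prod_map_pow_le (g := v f.leadingCoeff) f.roots
      (c := newtonFactor v (ρ ^ m)) (d := fun η => ((Bt t).map fun β => v (η - β)).prod)
      (fun η hη => newtonFactor_pow_le hBr (hgood η hη))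
    rw [prod_prod_sub_comm, hcardB] at h1
    refine h1.trans (le_of_eq ?_)
    have h2 : (Bt t).map (fun β => v (f.leadingCoeff * (f.roots.map fun η => β - η).prod)) =
        (Bt t).map fun _ => ρ ^ ν := by
      refine Multiset.map_congr rfl fun β hβ => ?_
      obtain ⟨σ, hσ, rfl⟩ := Multiset.mem_map.1 hβ
      have h3 : f.leadingCoeff * (f.roots.map fun η => Polynomial.aeval σ (b t) - η).prod =
          f.eval (Polynomial.aeval σ (b t)) := by
        conv_rhs => rw [hfac]
        rw [Polynomial.eval_mul, Polynomial.eval_C, Polynomial.eval_multiset_prod,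
          Multiset.map_map]
        simp
      rw [h3, hf, eval_slicePoly]
      conv_lhs => rw [← aeval_eq_of_mem_fiberRoots hσ]
      rw [← aeval_aeval_pair, hv.aeval_eq (hv.one_lt_of_mem_fiberRoots hξ hσ) (hw t ht), hν t ht,
        hvσ σ hσ]
    rw [h2, Multiset.map_const', Multiset.prod_replicate, hcardB]
  obtain ⟨J₀, J₁, N, hN, hle, -, -, h₀, h₁, hc⟩ :=
    exists_newton_indices v hr (Polynomial.leadingCoeff_ne_zero.2 hf0) f.roots
  rw [← hfac] at hle h₀ h₁
  have hterm : ∀ j, sliceCoeff G j ≠ 0 →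
      v (f.coeff j) * (ρ ^ m) ^ j = ρ ^ (n * (sliceCoeff G j).natDegree + m * j) := by
    intro j hj
    rw [hslice j hj, ← hρn, pow_add, pow_mul, pow_mul]
  have hne : ∀ j, v (f.coeff j) * (ρ ^ m) ^ j = N → sliceCoeff G j ≠ 0 := by
    intro j hj h
    rw [hf, coeff_slicePoly, h, map_zero, map_zero, zero_mul] at hj
    exact hN.ne hj
  have hmem : ∀ j, sliceCoeff G j ≠ 0 → expo (sliceCoeff G j).natDegree j ∈ G.support := by
    intro j hj
    rw [mem_support_iff, ← coeff_sliceCoeff, Polynomial.coeff_natDegree]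
    exact Polynomial.leadingCoeff_ne_zero.2 hj
  -- The term of index `j` has value `ρ` to the largest weight of a monomial of `G` with that
  -- exponent of `X 1`, so indices attaining the Gauss norm come from monomials of top weight.
  have htopwt : ∀ j, v (f.coeff j) * (ρ ^ m) ^ j = N →
      A ≤ (sliceCoeff G j).natDegree ∧ B ≤ j := by
    intro j hj
    have hj0 := hne j hj
    have h1 := htop _ (hmem j hj0) ?_
    · simpa using h1
    refine le_antisymm (le_wdeg (hmem j hj0)) (wdeg_le fun d hd => ?_)
    have hd0 : sliceCoeff G (d 1) ≠ 0 := by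
      intro h
      have := coeff_sliceCoeff G (d 0) (d 1)
      rw [h, Polynomial.coeff_zero, expo_self] at this
      exact mem_support_iff.1 hd this.symm
    have hd1 : d 0 ≤ (sliceCoeff G (d 1)).natDegree := by
      refine Polynomial.le_natDegree_of_ne_zero ?_
      rw [coeff_sliceCoeff, expo_self]
      exact mem_support_iff.1 hd
    have h2 := hle (d 1)
    rw [← hj, hterm _ hd0, hterm _ hj0, pow_le_pow_iff_right₀ hρ1] at h2
    rw [wt_apply, wt_apply, expo_zero, expo_one]
    exact (Nat.add_le_add_right (Nat.mul_le_mul_left n hd1) _).trans h2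
  obtain ⟨hA, -⟩ := htopwt J₁ h₁
  obtain ⟨-, hB⟩ := htopwt J₀ h₀
  -- Comparing exponents of `ρ`, the exponent of `X 0` is taken at `J₁` and that of `X 1` at `J₀`.
  have h3 : ρ ^ (n * (sliceCoeff G J₁).natDegree + m * J₁) * (ρ ^ m) ^ J₀ ≤
      ρ ^ ν * (ρ ^ m) ^ J₁ := by
    rw [← hterm _ (hne J₁ h₁), h₁, ← hc]
    exact mul_le_mul' hupper le_rfl
  rw [← pow_mul, ← pow_mul, ← pow_add, ← pow_add, pow_le_pow_iff_right₀ hρ1] at h3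
  have h4 : n * A ≤ n * (sliceCoeff G J₁).natDegree := Nat.mul_le_mul_left n hA
  have h5 : m * B ≤ m * J₀ := Nat.mul_le_mul_left m hB
  omega

end Estimate

/-! ### Algebraic independence from a nonzero Jacobian determinant. -/

theorem totalDegree_pow_eq {K : Type*} [Field K] {H : MvPolynomial (Fin 2) K} (hH : H ≠ 0) (N : ℕ) :
    (H ^ N).totalDegree = N * H.totalDegree := by
  induction N with
  | zero => simp
  | succ N ih =>
    rw [pow_succ, totalDegree_mul_of_isDomain (pow_ne_zero _ hH) hH, ih]
    ring

section AlgebraicIndependence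

variable {K : Type*} [Field K] [IsAlgClosed K]

/-- All exponents are multiples of `p`, the coefficients have `p`-th roots in `K`, and Frobenius is
additive. -/
theorem exists_pow_char_eq {p : ℕ} [Fact p.Prime] [CharP K p] {H : MvPolynomial (Fin 2) K}
    (h0 : pderiv 0 H = 0) (h1 : pderiv 1 H = 0) : ∃ L : MvPolynomial (Fin 2) K, L ^ p = H := by
  have hp : 0 < p := (Fact.out : p.Prime).pos
  have hdvd : ∀ d ∈ H.support, p ∣ d 0 ∧ p ∣ d 1 := by
    intro d hd
    have key : ∀ i : Fin 2, pderiv i H = 0 → p ∣ d i := by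
      intro i hi
      have h := coeff_X_mul_pderiv i H d
      rw [hi, mul_zero, coeff_zero] at h
      rw [← CharP.cast_eq_zero_iff K p]
      exact (mul_eq_zero.1 h.symm).resolve_right (mem_support_iff.1 hd)
    exact ⟨key 0 h0, key 1 h1⟩
  choose root hroot using fun x : K => IsAlgClosed.exists_pow_nat_eq x hp
  refine ⟨∑ d ∈ H.support, monomial (expo (d 0 / p) (d 1 / p)) (root (coeff d H)), ?_⟩
  have : CharP (MvPolynomial (Fin 2) K) p := inferInstance
  have : ExpChar (MvPolynomial (Fin 2) K) p := ExpChar.prime Fact.out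
  rw [← frobenius_def, map_sum]
  conv_rhs => rw [← support_sum_monomial_coeff H]
  refine Finset.sum_congr rfl fun d hd => ?_
  obtain ⟨⟨i, hi⟩, ⟨j, hj⟩⟩ := hdvd d hd
  have hd' : p • expo i j = d := by
    ext l
    fin_cases l
    · simp [hi]
    · simp [hj]
  rw [frobenius_def, monomial_pow, hroot, hi, hj, Nat.mul_div_cancel_left _ hp,
    Nat.mul_div_cancel_left _ hp, hd']

/-- Differentiating a relation and inverting the Jacobian matrix gives relations of smaller degree,
the partial derivatives of `H`. By induction these vanish, so `H` is a `p`-th power, and its root is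
a relation of smaller degree or a constant. -/
theorem eq_zero_of_aeval_eq_zero (p : ℕ) [Fact p.Prime] [CharP K p]
    {a b : MvPolynomial (Fin 2) K} (hJ : jacobianDet a b ≠ 0) :
    ∀ (N : ℕ) (H : MvPolynomial (Fin 2) K), H.totalDegree = N → aeval ![a, b] H = 0 → H = 0 := by
  intro N
  induction N using Nat.strong_induction_on with
  | _ N ih =>
    intro H hN hH
    have e : ∀ j, aeval ![a, b] (pderiv 0 H) * pderiv j a +
        aeval ![a, b] (pderiv 1 H) * pderiv j b = 0 := by
      intro j
      have := pderiv_aeval ![a, b] j H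
      rw [hH, map_zero] at this
      exact this.symm
    have e0 : aeval ![a, b] (pderiv 0 H) = 0 := by
      have : aeval ![a, b] (pderiv 0 H) * jacobianDet a b = 0 := by
        rw [jacobianDet]
        linear_combination pderiv 1 b * e 0 - pderiv 0 b * e 1
      exact (mul_eq_zero.1 this).resolve_right hJ
    have e1 : aeval ![a, b] (pderiv 1 H) = 0 := by
      have : aeval ![a, b] (pderiv 1 H) * jacobianDet a b = 0 := by
        rw [jacobianDet]
        linear_combination pderiv 0 a * e 1 - pderiv 1 a * e 0
      exact (mul_eq_zero.1 this).resolve_right hJ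
    have h0 : pderiv 0 H = 0 := by
      by_contra h
      have h2 := wdeg_pderiv_zero 1 1 h
      rw [← totalDegree_eq_wdeg, ← totalDegree_eq_wdeg] at h2
      exact h (ih _ (by omega) _ rfl e0)
    have h1 : pderiv 1 H = 0 := by
      by_contra h
      have h2 := wdeg_pderiv_one 1 1 h
      rw [← totalDegree_eq_wdeg, ← totalDegree_eq_wdeg] at h2
      exact h (ih _ (by omega) _ rfl e1)
    obtain ⟨L, rfl⟩ := exists_pow_char_eq (p := p) h0 h1
    have hp : 2 ≤ p := (Fact.out : p.Prime).two_le
    have hL : aeval ![a, b] L = 0 := by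
      rw [map_pow] at hH
      exact eq_zero_of_pow_eq_zero hH
    by_contra hcontra
    have hdeg : (L ^ p).totalDegree = p * L.totalDegree := by
      have hL0 : L ≠ 0 := by
        rintro rfl
        exact hcontra (zero_pow (by omega))
      exact totalDegree_pow_eq hL0 p
    rcases Nat.eq_zero_or_pos L.totalDegree with h | h
    · rw [totalDegree_eq_zero_iff_eq_C] at h
      rw [h] at hL hcontra
      rw [aeval_C, map_eq_zero_iff _ (algebraMap K (MvPolynomial (Fin 2) K)).injective] at hL
      rw [hL, C_0, zero_pow (by omega)] at hcontra
      exact hcontra rfl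
    · have h2 : L = 0 := by
        refine ih L.totalDegree ?_ L rfl hL
        rw [← hN, hdeg]
        nlinarith
      exact hcontra (by rw [h2, zero_pow (by omega)])

theorem isAlgebraic_adjoin_of_jacobianDet_ne_zero (p : ℕ) [Fact p.Prime] [CharP K p]
    {a b : MvPolynomial (Fin 2) K} (hJ : jacobianDet a b ≠ 0) (f : MvPolynomial (Fin 2) K) :
    IsAlgebraic (Algebra.adjoin K (Set.range ![a, b])) f := by
  have hind : AlgebraicIndependent K ![a, b] := by
    rw [algebraicIndependent_iff]
    intro H hH
    exact eq_zero_of_aeval_eq_zero p hJ _ H rfl hH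
  have htb : IsTranscendenceBasis K ![a, b] := by
    refine hind.isTranscendenceBasis_of_lift_trdeg_le_of_finite ?_
    rw [MvPolynomial.trdeg_of_isDomain]
    simp
  have := htb.isAlgebraic
  exact Algebra.IsAlgebraic.isAlgebraic f

end AlgebraicIndependence

/-! ### Lines with disjoint images. -/

section Lines

variable {K : Type*} [Field K]

/-- Restriction to the line `X 0 = t`. -/
noncomputable def lineEval (t : K) : MvPolynomial (Fin 2) K →ₐ[K] Polynomial K :=
  aeval ![Polynomial.C t, Polynomial.X]

theorem lineEval_eq_slicePoly (t : K) (H : MvPolynomial (Fin 2) K) :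
    lineEval t H = slicePoly H t := rfl

theorem finite_lineEval_eq_zero {H : MvPolynomial (Fin 2) K} (hH : H ≠ 0) :
    {t : K | lineEval t H = 0}.Finite := by
  obtain ⟨d, hd⟩ := support_nonempty.2 hH
  have h0 : sliceCoeff H (d 1) ≠ 0 := by
    intro h
    have := coeff_sliceCoeff H (d 0) (d 1)
    rw [h, Polynomial.coeff_zero, expo_self] at this
    exact mem_support_iff.1 hd this.symm
  refine (Polynomial.finite_setOfPred_isRoot h0).subset fun t ht => ?_
  have h1 := congrArg (fun q => Polynomial.coeff q (d 1)) (show lineEval t H = 0 from ht)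
  simp only [lineEval_eq_slicePoly, coeff_slicePoly, Polynomial.coeff_zero] at h1
  rw [Set.mem_ofPred_eq, Polynomial.IsRoot]
  rwa [Polynomial.coe_aeval_eq_eval] at h1

/-- The polynomial has full degree in `X 1`. -/
def IsRegularInXOne (H : MvPolynomial (Fin 2) K) : Prop := expo 0 H.totalDegree ∈ H.support

theorem IsRegularInXOne.lineEval {H : MvPolynomial (Fin 2) K} (hH : IsRegularInXOne H) (t : K) :
    lineEval t H ≠ 0 ∧ (lineEval t H).natDegree = H.totalDegree := by
  have h1 : (_root_.lineEval t H).coeff H.totalDegree = coeff (expo 0 H.totalDegree) H := by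
    rw [lineEval_eq_slicePoly, coeff_slicePoly]
    have : sliceCoeff H H.totalDegree = Polynomial.C (coeff (expo 0 H.totalDegree) H) := by
      ext i
      rw [coeff_sliceCoeff, Polynomial.coeff_C]
      split_ifs with hi
      · rw [hi]
      · by_contra h
        have := le_totalDegree_fin_two (mem_support_iff.2 h)
        simp at this
        omega
    rw [this, Polynomial.aeval_C]; rfl
  have h2 : (_root_.lineEval t H).coeff H.totalDegree ≠ 0 := by
    rw [h1]; exact mem_support_iff.1 hH
  refine ⟨fun h => h2 (by rw [h, Polynomial.coeff_zero]), le_antisymm ?_ ?_⟩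
  · exact natDegree_slicePoly_le H t
  · exact Polynomial.le_natDegree_of_ne_zero h2

theorem lineEval_aeval (t : K) (a b G : MvPolynomial (Fin 2) K) :
    lineEval t (aeval ![a, b] G) = aeval ![lineEval t a, lineEval t b] G := by
  rw [aeval_eq_sum_fin_two, aeval_eq_sum_fin_two, map_sum]
  refine Finset.sum_congr rfl fun d _ => ?_
  rw [map_mul, map_mul, map_pow, map_pow, AlgHom.commutes]

/-- Images of two lines on which an algebraic relation takes different values are disjoint. -/
theorem aeval_lineEval_ne {Ω Γ : Type*} [Field Ω] [Algebra K Ω]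
    [LinearOrderedCommGroupWithZero Γ] {v : Valuation Ω Γ} (hv : v.TrivialOn K)
    {a b : MvPolynomial (Fin 2) K} {A : Subalgebra K (MvPolynomial (Fin 2) K)}
    (hA : A ≤ Algebra.adjoin K (Set.range ![a, b])) {q : Polynomial A}
    (hq : Polynomial.aeval (X 0 : MvPolynomial (Fin 2) K) q = 0) {t t' : K}
    (hne : Polynomial.eval₂ ((lineEval t').comp A.val).toRingHom (Polynomial.C t) q ≠ 0)
    {σ σ' : Ω} (hσ' : 1 < v σ')
    (ha : Polynomial.aeval σ (lineEval t a) = Polynomial.aeval σ' (lineEval t' a)) :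
    Polynomial.aeval σ (lineEval t b) ≠ Polynomial.aeval σ' (lineEval t' b) := by
  intro hb
  -- At a common image point the two evaluations agree on the subalgebra `A`. The relation satisfied
  -- by `X 0` on the first line then says that `q`, with coefficients restricted to the second line,
  -- vanishes at `t` after evaluation at `σ'`; a nonzero polynomial cannot vanish at a point of
  -- value above `1`.
  have hagree : ((Polynomial.aeval σ : Polynomial K →ₐ[K] Ω).comp ((lineEval t).comp A.val)) =
      ((Polynomial.aeval σ' : Polynomial K →ₐ[K] Ω).comp ((lineEval t').comp A.val)) := by
    have hle : A ≤ AlgHom.equalizer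
        ((Polynomial.aeval σ : Polynomial K →ₐ[K] Ω).comp (lineEval t))
        ((Polynomial.aeval σ' : Polynomial K →ₐ[K] Ω).comp (lineEval t')) := by
      refine hA.trans (Algebra.adjoin_le ?_)
      rintro _ ⟨i, rfl⟩
      fin_cases i
      · exact ha
      · exact hb
    ext c
    exact hle c.2
  have hr : Polynomial.aeval σ' (Polynomial.eval₂ ((lineEval t').comp A.val).toRingHom
      (Polynomial.C t) q) = 0 := by
    have h1 : Polynomial.aeval σ' (Polynomial.eval₂ ((lineEval t').comp A.val).toRingHom
        (Polynomial.C t) q) = Polynomial.aeval σ (Polynomial.eval₂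
          ((lineEval t).comp A.val).toRingHom (Polynomial.C t) q) := by
      have e1 := Polynomial.hom_eval₂ q ((lineEval t').comp A.val).toRingHom
        (Polynomial.aeval σ' : Polynomial K →ₐ[K] Ω).toRingHom (Polynomial.C t)
      have e2 := Polynomial.hom_eval₂ q ((lineEval t).comp A.val).toRingHom
        (Polynomial.aeval σ : Polynomial K →ₐ[K] Ω).toRingHom (Polynomial.C t)
      have e3 : (Polynomial.aeval σ' : Polynomial K →ₐ[K] Ω).toRingHom (Polynomial.C t) =
          (Polynomial.aeval σ : Polynomial K →ₐ[K] Ω).toRingHom (Polynomial.C t) := by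
        simp
      have e4 : (Polynomial.aeval σ' : Polynomial K →ₐ[K] Ω).toRingHom.comp
          ((lineEval t').comp A.val).toRingHom = (Polynomial.aeval σ : Polynomial K →ₐ[K] Ω).toRingHom.comp
          ((lineEval t).comp A.val).toRingHom := by
        ext c
        exact (DFunLike.congr_fun hagree c).symm
      refine e1.trans (Eq.trans ?_ e2.symm)
      rw [e3, e4]
    rw [h1]
    have h2 : (lineEval t) (Polynomial.aeval (X 0 : MvPolynomial (Fin 2) K) q) =
        Polynomial.eval₂ ((lineEval t).comp A.val).toRingHom (Polynomial.C t) q := by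
      have e1 := Polynomial.hom_eval₂ q A.val.toRingHom (lineEval t).toRingHom (X 0)
      have e2 : (lineEval t).toRingHom (X 0) = Polynomial.C t := by
        simp [lineEval]
      rw [e2] at e1
      exact e1
    rw [← h2, hq, map_zero, map_zero]
  have := hv.aeval_eq hσ' hne
  rw [hr, map_zero] at this
  exact pow_ne_zero _ (zero_lt_one.trans hσ').ne' this.symm

/-- There are arbitrarily many lines with pairwise different values of an algebraic relation. -/
theorem exists_finset_lines [Infinite K] {A : Subalgebra K (MvPolynomial (Fin 2) K)}
    {q : Polynomial A} (hq : q ≠ 0) (N : ℕ) :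
    ∃ S : Finset K, S.card = N ∧
      (∀ t ∈ S, q.map ((lineEval t).comp A.val).toRingHom ≠ 0) ∧
      ∀ t ∈ S, ∀ t' ∈ S, t ≠ t' →
        Polynomial.eval₂ ((lineEval t').comp A.val).toRingHom (Polynomial.C t) q ≠ 0 ∨
        Polynomial.eval₂ ((lineEval t).comp A.val).toRingHom (Polynomial.C t') q ≠ 0 := by
  classical
  induction N with
  | zero => exact ⟨∅, rfl, by simp, by simp⟩
  | succ N ih =>
    obtain ⟨S, hS, hS1, hS2⟩ := ih
    -- Only finitely many `t` are excluded: zeros of the restricted leading coefficient of `q`,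
    -- roots of `q` restricted to the earlier lines, and the earlier values themselves.
    have hfin1 : {t : K | q.map ((lineEval t).comp A.val).toRingHom = 0}.Finite := by
      have hlc : (A.val q.leadingCoeff) ≠ 0 := by
        have : q.leadingCoeff ≠ 0 := Polynomial.leadingCoeff_ne_zero.2 hq
        simpa using this
      refine (finite_lineEval_eq_zero hlc).subset fun t ht => ?_
      have h1 := congrArg (fun r => Polynomial.coeff r q.natDegree)
        (show q.map ((lineEval t).comp A.val).toRingHom = 0 from ht)
      simp only [Polynomial.coeff_map, Polynomial.coeff_zero] at h1
      exact h1
    have hfin2 : (⋃ t' ∈ S, {t : K | Polynomial.eval₂ ((lineEval t').comp A.val).toRingHom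
        (Polynomial.C t) q = 0}).Finite := by
      refine Set.Finite.biUnion S.finite_toSet fun t' ht' => ?_
      have h1 := Polynomial.finite_setOfPred_isRoot (hS1 t' ht')
      refine (h1.preimage Polynomial.C_injective.injOn).subset fun t ht => ?_
      rw [Set.mem_preimage, Set.mem_ofPred_eq, Polynomial.IsRoot, Polynomial.eval_map]
      exact ht
    obtain ⟨t, ht⟩ := ((hfin1.union hfin2).union S.finite_toSet).infinite_compl.nonempty
    simp only [Set.mem_compl_iff, Set.mem_union, not_or, Set.mem_ofPred_eq, Set.mem_iUnion,
      not_exists, Finset.mem_coe] at ht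
    obtain ⟨⟨h1, h2⟩, h3⟩ := ht
    refine ⟨insert t S, by rw [Finset.card_insert_of_notMem h3, hS], ?_, ?_⟩
    · intro s hs
      rcases Finset.mem_insert.1 hs with rfl | hs
      · exact h1
      · exact hS1 s hs
    · intro s hs s' hs' hne
      rcases Finset.mem_insert.1 hs with h4 | h4
      · rcases Finset.mem_insert.1 hs' with h5 | h5
        · exact absurd (h4.trans h5.symm) hne
        · rw [h4]
          exact Or.inl (h2 s' h5)
      · rcases Finset.mem_insert.1 hs' with h5 | h5
        · rw [h5]
          exact Or.inr (h2 s h4)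
        · exact hS2 s h4 s' h5 hne

end Lines

/-! ### Degree of a polynomial in the members of a Jacobian pair. -/

section LowerBound

variable {K : Type*} [Field K]

/-- Regularity keeps all degrees constant on the lines `X 0 = t`, and an algebraic relation for `X
0` over the algebra of `a` and `b` supplies enough lines with disjoint images near infinity. -/
theorem le_totalDegree_of_regular [IsAlgClosed K] (p : ℕ) [Fact p.Prime] [CharP K p]
    {a b G : MvPolynomial (Fin 2) K} (hJ : jacobianDet a b ≠ 0)
    (hn : 0 < a.totalDegree) (hm : 0 < b.totalDegree) (ha : IsRegularInXOne a)
    (hb : IsRegularInXOne b) (hGab : IsRegularInXOne (aeval ![a, b] G)) (hG : G ≠ 0) {A B : ℕ}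
    (htop : ∀ d ∈ G.support, wt a.totalDegree b.totalDegree d =
      wdeg a.totalDegree b.totalDegree G → A ≤ d 0 ∧ B ≤ d 1) :
    a.totalDegree * A + b.totalDegree * B ≤ (aeval ![a, b] G).totalDegree := by
  obtain ⟨Ω, _, _, _, Γ, _, v, ξ, hv, hξ⟩ := exists_valued_extension K
  obtain ⟨q, hq, hqx⟩ := isAlgebraic_adjoin_of_jacobianDet_ne_zero p hJ (X 0)
  obtain ⟨S, hS, -, hne⟩ := exists_finset_lines hq (G.totalDegree + 1)
  refine le_natDegree_of_disjoint_curves (S := S) (a := fun t => lineEval t a)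
    (b := fun t => lineEval t b) (G := G) hv hξ hn (fun t _ => (ha.lineEval t).2)
    (fun t _ => (hb.lineEval t).2) hm ?_ hG (by omega) ?_ ?_ htop
  · intro t ht t' ht' htt σ σ' hσ hσ' hab
    rcases hne t ht t' ht' htt with h | h
    · exact aeval_lineEval_ne hv le_rfl hqx h hσ' hab
    · exact (aeval_lineEval_ne hv le_rfl hqx h hσ hab.symm).symm
  · intro t _
    rw [← lineEval_aeval]
    exact (hGab.lineEval t).1
  · intro t _
    rw [← lineEval_aeval]
    exact (hGab.lineEval t).2

/-- The top form, dehomogenized by `X 1 = 1`. -/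
noncomputable def topPoly (H : MvPolynomial (Fin 2) K) : Polynomial K :=
  ∑ d ∈ H.support with d 0 + d 1 = H.totalDegree, Polynomial.monomial (d 0) (coeff d H)

theorem topPoly_ne_zero {H : MvPolynomial (Fin 2) K} (hH : H ≠ 0) : topPoly H ≠ 0 := by
  obtain ⟨d, hd, hdw⟩ := exists_wt_eq_wdeg 1 1 hH
  rw [← totalDegree_eq_wdeg, wt_apply, one_mul, one_mul] at hdw
  intro h
  have h1 := congrArg (fun q => Polynomial.coeff q (d 0)) h
  simp only [topPoly, Polynomial.finsetSum_coeff, Polynomial.coeff_zero] at h1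
  rw [Finset.sum_eq_single d] at h1
  · rw [Polynomial.coeff_monomial_same] at h1
    exact mem_support_iff.1 hd h1
  · intro e he hne
    rw [Polynomial.coeff_monomial, if_neg]
    intro h2
    refine hne ?_
    have h3 := (Finset.mem_filter.1 he).2
    ext i
    fin_cases i
    · exact h2
    · change e 1 = d 1
      omega
  · intro h2
    exact absurd (Finset.mem_filter.2 ⟨hd, hdw⟩) h2

/-- Under the shear the coefficient of the pure power of `X 1` of full degree is the dehomogenized
top form evaluated at `l`. -/
theorem isRegularInXOne_of_eval_topPoly {φ : MvPolynomial (Fin 2) K →ₐ[K] MvPolynomial (Fin 2) K}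
    {l : K} (h0 : φ (X 0) = X 0 + C l * X 1) (h1 : φ (X 1) = X 1) {H : MvPolynomial (Fin 2) K}
    (hl : (topPoly H).eval l ≠ 0) :
    IsRegularInXOne (φ H) ∧ (φ H).totalDegree = H.totalDegree := by
  have haff : IsAffineMap φ := ⟨1, l, 0, 0, 1, 0, by simp, by simp [h0], by simp [h1]⟩
  have hle := haff.totalDegree_le H
  have hc : coeff (expo 0 H.totalDegree) (φ H) = (topPoly H).eval l := by
    have e1 : coeff (expo 0 H.totalDegree) (φ H) =
        (lineEval (0 : K) (φ H)).coeff H.totalDegree := by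
      rw [lineEval_eq_slicePoly, coeff_slicePoly, ← coeff_sliceCoeff, Polynomial.coeff_zero_eq_aeval_zero]
    have e2 : (lineEval (0 : K)).comp φ =
        aeval ![Polynomial.C l * Polynomial.X, Polynomial.X] := by
      ext i : 1
      fin_cases i
      · simp [h0, lineEval]
      · simp [h1, lineEval]
    have e3 : lineEval (0 : K) (φ H) =
        aeval ![Polynomial.C l * Polynomial.X, Polynomial.X] H := DFunLike.congr_fun e2 H
    rw [e1, e3, aeval_eq_sum_fin_two, Polynomial.finsetSum_coeff, topPoly,
      Polynomial.eval_finsetSum, Finset.sum_filter]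
    refine Finset.sum_congr rfl fun d _ => ?_
    have e4 : algebraMap K (Polynomial K) (coeff d H) *
        ((Polynomial.C l * Polynomial.X) ^ d 0 * Polynomial.X ^ d 1) =
        Polynomial.C (coeff d H * l ^ d 0) * Polynomial.X ^ (d 0 + d 1) := by
      rw [Polynomial.algebraMap_eq, Polynomial.C_mul, Polynomial.C_pow]
      ring
    rw [e4, Polynomial.coeff_C_mul, Polynomial.coeff_X_pow, Polynomial.eval_monomial]
    split_ifs <;> first | omega | simp
  have hmem : expo 0 H.totalDegree ∈ (φ H).support := by
    rw [mem_support_iff, hc]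
    exact hl
  have hge := le_totalDegree_fin_two hmem
  rw [expo_zero, expo_one, zero_add] at hge
  have heq := le_antisymm hle hge
  refine ⟨?_, heq⟩
  rw [IsRegularInXOne, heq]
  exact hmem

/-- As the field is infinite, one shear makes `a`, `b` and the composite regular simultaneously. -/
theorem le_totalDegree_of_isAlgClosed [IsAlgClosed K] (p : ℕ) [Fact p.Prime] [CharP K p]
    {a b G : MvPolynomial (Fin 2) K} (hJ : jacobianDet a b ≠ 0)
    (hn : 0 < a.totalDegree) (hm : 0 < b.totalDegree) (hG : G ≠ 0) {A B : ℕ}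
    (htop : ∀ d ∈ G.support, wt a.totalDegree b.totalDegree d =
      wdeg a.totalDegree b.totalDegree G → A ≤ d 0 ∧ B ≤ d 1) :
    a.totalDegree * A + b.totalDegree * B ≤ (aeval ![a, b] G).totalDegree := by
  have ha0 : a ≠ 0 := by rintro rfl; simp at hn
  have hb0 : b ≠ 0 := by rintro rfl; simp at hm
  have hg0 : aeval ![a, b] G ≠ 0 := fun h => hG (eq_zero_of_aeval_eq_zero p hJ _ G rfl h)
  obtain ⟨l, hl⟩ : ∃ l : K, (topPoly a * topPoly b * topPoly (aeval ![a, b] G)).eval l ≠ 0 := by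
    by_contra! h
    exact mul_ne_zero (mul_ne_zero (topPoly_ne_zero ha0) (topPoly_ne_zero hb0))
      (topPoly_ne_zero hg0) (Polynomial.funext fun x => by rw [h x, Polynomial.eval_zero])
  rw [Polynomial.eval_mul, Polynomial.eval_mul] at hl
  obtain ⟨φ, h0, h1⟩ := exists_endo (X 0 + C l * X 1 : MvPolynomial (Fin 2) K) (X 1)
  have haff : IsAffineMap φ := ⟨1, l, 0, 0, 1, 0, by simp, by simp [h0], by simp [h1]⟩
  obtain ⟨ra, da⟩ := isRegularInXOne_of_eval_topPoly h0 h1 (left_ne_zero_of_mul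
    (left_ne_zero_of_mul hl))
  obtain ⟨rb, db⟩ := isRegularInXOne_of_eval_topPoly h0 h1 (right_ne_zero_of_mul
    (left_ne_zero_of_mul hl))
  obtain ⟨rg, dg⟩ := isRegularInXOne_of_eval_topPoly h0 h1 (right_ne_zero_of_mul hl)
  have hcomp : φ (aeval ![a, b] G) = aeval ![φ a, φ b] G := by
    rw [aeval_eq_sum_fin_two, aeval_eq_sum_fin_two, map_sum]
    refine Finset.sum_congr rfl fun d _ => ?_
    rw [map_mul, map_mul, map_pow, map_pow, AlgHom.commutes]
  have hJ' : jacobianDet (φ a) (φ b) ≠ 0 := by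
    have h2 := jacobianDet_comp φ (aeval ![a, b])
    simp only [AlgHom.mul_apply, aeval_X, Matrix.cons_val_zero, Matrix.cons_val_one] at h2
    rw [h2]
    obtain ⟨ψ, -, h3, h4⟩ := haff.exists_inverse
    obtain ⟨c, hc, h5⟩ := haff.isJacobianPair
    refine mul_ne_zero ?_ (by rw [h5]; simpa using hc)
    rw [map_ne_zero_iff φ (bijective_of_mul_eq_one h3 h4).1]
    exact hJ
  rw [← dg, hcomp]
  have := le_totalDegree_of_regular p (A := A) (B := B) hJ' (by omega) (by omega) ra rb
    (hcomp ▸ rg) hG (by rw [da, db]; exact htop)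
  rwa [da, db] at this

/-- A lower bound for the degree of a polynomial in the members of a pair with nonvanishing
Jacobian determinant. -/
theorem le_totalDegree_aeval (p : ℕ) [Fact p.Prime] [CharP K p]
    {a b G : MvPolynomial (Fin 2) K} (hJ : jacobianDet a b ≠ 0)
    (hn : 0 < a.totalDegree) (hm : 0 < b.totalDegree) (hG : G ≠ 0) {A B : ℕ}
    (htop : ∀ d ∈ G.support, wt a.totalDegree b.totalDegree d =
      wdeg a.totalDegree b.totalDegree G → A ≤ d 0 ∧ B ≤ d 1) :
    a.totalDegree * A + b.totalDegree * B ≤ (aeval ![a, b] G).totalDegree := by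
  -- Base change to the algebraic closure preserves supports, hence degrees and top faces.
  let i := algebraMap K (AlgebraicClosure K)
  have hi : Function.Injective i := i.injective
  have hmap : Function.Injective (MvPolynomial.map i : MvPolynomial (Fin 2) K → _) :=
    map_injective i hi
  have hsupp : ∀ H : MvPolynomial (Fin 2) K, (MvPolynomial.map i H).support = H.support :=
    fun H => support_map_of_injective H hi
  have hdeg : ∀ H : MvPolynomial (Fin 2) K,
      (MvPolynomial.map i H).totalDegree = H.totalDegree := fun H => by
    rw [totalDegree, totalDegree, hsupp]
  have : CharP (AlgebraicClosure K) p := charP_of_injective_algebraMap hi p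
  have hcomp : MvPolynomial.map i (aeval ![a, b] G) =
      aeval ![MvPolynomial.map i a, MvPolynomial.map i b] (MvPolynomial.map i G) := by
    rw [aeval_eq_sum_fin_two, aeval_eq_sum_fin_two, map_sum, hsupp]
    refine Finset.sum_congr rfl fun d _ => ?_
    rw [map_mul, map_mul, map_pow, map_pow, coeff_map, MvPolynomial.algebraMap_eq,
      MvPolynomial.algebraMap_eq, map_C]
  have hJ' : jacobianDet (MvPolynomial.map i a) (MvPolynomial.map i b) ≠ 0 := by
    have : jacobianDet (MvPolynomial.map i a) (MvPolynomial.map i b) =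
        MvPolynomial.map i (jacobianDet a b) := by
      simp only [jacobianDet, pderiv_map, map_sub, map_mul]
    rw [this, map_ne_zero_iff _ hmap]
    exact hJ
  have key := le_totalDegree_of_isAlgClosed p (A := A) (B := B) hJ' (by rwa [hdeg])
    (by rwa [hdeg]) ((map_ne_zero_iff _ hmap).2 hG)
    (by rw [hsupp, hdeg, hdeg, wdeg, hsupp]; exact htop)
  rwa [← hcomp, hdeg, hdeg, hdeg] at key

end LowerBound

/-! ### The degree bound past a map of type (b). -/

section DegreeBound

variable {k : Type*} [Field k]

theorem eq_affine_of_totalDegree_le_one {f : MvPolynomial (Fin 2) k} (hf : f.totalDegree ≤ 1) :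
    f = C (coeff (expo 1 0) f) * X 0 + C (coeff (expo 0 1) f) * X 1 + C (coeff (expo 0 0) f) := by
  have key : ∀ d ∈ f.support, d ∈ ({expo 1 0, expo 0 1, expo 0 0} : Finset (Fin 2 →₀ ℕ)) := by
    intro d hd
    have h1 := (le_totalDegree_fin_two hd).trans hf
    simp only [Finset.mem_insert, Finset.mem_singleton]
    rw [← expo_self d]
    rcases Nat.eq_zero_or_pos (d 0) with h | h <;> rcases Nat.eq_zero_or_pos (d 1) with h' | h'
    · rw [h, h']; simp
    · rw [h, show d 1 = 1 by omega]; simp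
    · rw [h', show d 0 = 1 by omega]; simp
    · omega
  have hne : ∀ i j i' j' : ℕ, i ≠ i' → expo i j ≠ expo i' j' := by
    intro i j i' j' h h2
    have := DFunLike.congr_fun h2 0
    simp at this
    exact h this
  have hne' : ∀ i j i' j' : ℕ, j ≠ j' → expo i j ≠ expo i' j' := by
    intro i j i' j' h h2
    have := DFunLike.congr_fun h2 1
    simp at this
    exact h this
  have h1 : f = ∑ d ∈ ({expo 1 0, expo 0 1, expo 0 0} : Finset (Fin 2 →₀ ℕ)),
      monomial d (coeff d f) := by
    conv_lhs => rw [← support_sum_monomial_coeff f]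
    refine Finset.sum_subset key fun d _ hd => ?_
    rw [notMem_support_iff.1 hd, map_zero]
  have e1 : expo 1 0 = Finsupp.single (0 : Fin 2) 1 := by simp [expo]
  have e2 : expo 0 1 = Finsupp.single (1 : Fin 2) 1 := by simp [expo]
  have e3 : expo 0 0 = 0 := by simp [expo]
  conv_lhs => rw [h1]
  rw [Finset.sum_insert (by simp [hne 1 0 0 1, hne 1 0 0 0]),
    Finset.sum_insert (by simp [hne' 0 1 0 0]), Finset.sum_singleton, C_mul_X_eq_monomial,
    C_mul_X_eq_monomial, C_apply, e1, e2, e3, add_assoc]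

theorem totalDegree_pos_of_jacobianDet_ne_zero {a b : MvPolynomial (Fin 2) k}
    (hJ : jacobianDet a b ≠ 0) : 0 < a.totalDegree ∧ 0 < b.totalDegree := by
  constructor
  · by_contra h
    have h1 := totalDegree_eq_zero_iff_eq_C.1 (Nat.eq_zero_of_not_pos h)
    rw [h1] at hJ
    simp [jacobianDet] at hJ
  · by_contra h
    have h1 := totalDegree_eq_zero_iff_eq_C.1 (Nat.eq_zero_of_not_pos h)
    rw [h1] at hJ
    simp [jacobianDet] at hJ

theorem totalDegree_aeval_eq_of_totalDegree_le_one {a b : MvPolynomial (Fin 2) k}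
    (hJ : jacobianDet a b ≠ 0) (ha : a.totalDegree ≤ 1) (hb : b.totalDegree ≤ 1)
    (G : MvPolynomial (Fin 2) k) : (aeval ![a, b] G).totalDegree = G.totalDegree := by
  have ha' := eq_affine_of_totalDegree_le_one ha
  have hb' := eq_affine_of_totalDegree_le_one hb
  have haff : IsAffineMap (aeval ![a, b] : MvPolynomial (Fin 2) k →ₐ[k] MvPolynomial (Fin 2) k) := by
    refine ⟨_, _, _, _, _, _, ?_, by simpa using ha', by simpa using hb'⟩
    intro h
    apply hJ
    rw [ha', hb']
    simp only [jacobianDet, map_add, Derivation.leibniz, pderiv_C, pderiv_X, smul_eq_mul]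
    simp only [Pi.single_eq_same, mul_one, mul_zero, add_zero, ne_eq, one_ne_zero, zero_ne_one,
      not_false_eq_true, Pi.single_eq_of_ne, zero_add]
    rw [← C_mul, ← C_mul, ← C_sub, h, C_0]
  obtain ⟨ψ, hψ, -, h2⟩ := haff.exists_inverse
  refine le_antisymm (haff.totalDegree_le G) ?_
  have := hψ.totalDegree_le (aeval ![a, b] G)
  rwa [← AlgHom.mul_apply, h2, AlgHom.one_apply] at this

/-- An occurrence of `X 0` makes the weight of `F` at least that of `X 0 * h₁(u)`, the image with
the larger `natDegree`. Minimal exponents on the top faces of `u` and `F` give common divisors of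
the top monomials of the composite; the lower bound and the arithmetic then apply. -/
theorem le_totalDegree_of_exponent_zero_pos (p : ℕ) [Fact p.Prime] [CharP k p]
    {a b u F : MvPolynomial (Fin 2) k} {D : ℕ} {h₁ h₂ : Polynomial k} {c : k}
    (hab : jacobianDet a b ≠ 0) (hc : c ≠ 0) (hu : u ≠ 0) (hD : 0 < D) (hom : u.IsHomogeneous D)
    (hh₁ : 0 < h₁.natDegree) (hh₂ : 0 < h₂.natDegree)
    (hJ : jacobianDet (X 0 * Polynomial.aeval u h₁) (X 1 * Polynomial.aeval u h₂) = C c)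
    (hle : h₂.natDegree ≤ h₁.natDegree) {s : Fin 2 →₀ ℕ} (hs : s ∈ F.support) (hs0 : 0 < s 0) :
    p ≤ (aeval ![a, b]
      (aeval ![X 0 * Polynomial.aeval u h₁, X 1 * Polynomial.aeval u h₂] F)).totalDegree := by
  have hp : p.Prime := Fact.out
  obtain ⟨hE, hE'⟩ := typeB_exponents (p := p) hc hu hD hom hh₁ hh₂ hJ
  have h₁0 : h₁ ≠ 0 := by
    rintro rfl
    simp at hh₁
  have h₂0 : h₂ ≠ 0 := by
    rintro rfl
    simp at hh₂
  obtain ⟨hn, hm⟩ := totalDegree_pos_of_jacobianDet_ne_zero hab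
  set n := a.totalDegree with hn_def
  set m := b.totalDegree with hm_def
  set m₁ := h₁.natDegree with hm₁_def
  set m₂ := h₂.natDegree with hm₂_def
  have hDsum : ∀ e ∈ u.support, e 0 + e 1 = D := by
    intro e he
    have h := hom (mem_support_iff.1 he)
    rw [Finsupp.weight_apply, Finsupp.sum_fintype _ _ (by simp)] at h
    simpa [Fin.sum_univ_two] using h
  have hF : F ≠ 0 := by
    rintro rfl
    simp at hs
  -- exponents minimal on the top face of `u`
  obtain ⟨e, he, hew⟩ := exists_wt_eq_wdeg n m hu
  set U := wdeg n m u with hU_def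
  have hTne : (u.support.filter fun d => wt n m d = U).Nonempty :=
    ⟨e, Finset.mem_filter.2 ⟨he, hew⟩⟩
  obtain ⟨e₀, he₀, hmin₀⟩ := Finset.exists_min_image _ (fun d => d 0) hTne
  obtain ⟨e₁, he₁, hmin₁⟩ := Finset.exists_min_image _ (fun d => d 1) hTne
  rw [Finset.mem_filter] at he₀ he₁
  obtain ⟨I, hI_def⟩ : ∃ I, I = e₀ 0 := ⟨_, rfl⟩
  obtain ⟨J, hJ_def⟩ : ∃ J, J = e₁ 1 := ⟨_, rfl⟩
  have hIpos : 0 < I := hI_def ▸ (hE e₀ he₀.1).1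
  have hJpos : 0 < J := hJ_def ▸ (hE e₁ he₁.1).2.1
  -- `I` and `J` may belong to different monomials of `u`, but the exponents agree mod `p`, so the
  -- divisibility persists.
  have hdvd : p ∣ 1 + m₁ * I + m₂ * J := by
    have h1 := (hE e₀ he₀.1).2.2
    rw [← CharP.cast_eq_zero_iff k p] at h1 ⊢
    push_cast at h1 ⊢
    rw [hI_def, hJ_def, ← (hE' e₀ he₀.1 e₁ he₁.1).2]
    exact h1
  have htop : TopMin n m u U I J := by
    intro d hd
    refine ⟨le_wdeg hd, fun h => ?_⟩
    have hd' := (Finset.mem_filter (p := fun d => wt n m d = U)).2 ⟨hd, h⟩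
    exact ⟨hI_def ▸ hmin₀ d hd', hJ_def ▸ hmin₁ d hd'⟩
  have hUpos : 0 < U := by
    rw [← hew, wt_apply]
    have := (hE e he).1
    positivity
  obtain ⟨hG0, hGw, hGd⟩ := face_of_typeB_substitution (n := n) hm hu
    (h₁ := h₁) (h₂ := h₂) h₁0 h₂0
    hU_def.symm hUpos htop hF
  rw [← hm₁_def, ← hm₂_def] at hGw hGd
  set G := aeval ![X 0 * Polynomial.aeval u h₁, X 1 * Polynomial.aeval u h₂] F with hG_def
  set W := wdeg (n + m₁ * U) (m + m₂ * U) F with hW_def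
  have hWP : n + m₁ * U ≤ W := by
    have h1 : wt (n + m₁ * U) (m + m₂ * U) s ≤ W := le_wdeg hs
    rw [wt_apply] at h1
    nlinarith [Nat.zero_le ((m + m₂ * U) * s 1)]
  -- Here `(a, b)` is an affine automorphism and preserves degrees; the remaining case of equal
  -- weights then has `n ≥ 2`.
  by_cases h11 : n = 1 ∧ m = 1
  · rw [totalDegree_aeval_eq_of_totalDegree_le_one hab h11.1.le h11.2.le, totalDegree_eq_wdeg]
    rw [h11.1, h11.2] at hGw hew
    rw [h11.1] at hWP
    rw [hGw]
    refine le_trans ?_ hWP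
    rw [wt_apply] at hew
    have h2 := Nat.le_of_dvd (by omega) (hE e he).2.2
    have h3 : m₂ * e 1 ≤ m₁ * e 1 := Nat.mul_le_mul_right _ hle
    rw [← hew]
    linarith
  -- the best exponents among the top monomials of `F`
  obtain ⟨t, ht, htw⟩ := exists_wt_eq_wdeg (n + m₁ * U) (m + m₂ * U) hF
  have hT'ne : (F.support.filter fun d => wt (n + m₁ * U) (m + m₂ * U) d = W).Nonempty :=
    ⟨t, Finset.mem_filter.2 ⟨ht, htw⟩⟩
  obtain ⟨s₁, hs₁, hsmin₁⟩ := Finset.exists_min_image _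
    (fun s => s 0 + (s 0 * m₁ + s 1 * m₂) * I) hT'ne
  obtain ⟨s₂, hs₂, hsmin₂⟩ := Finset.exists_min_image _
    (fun s => s 1 + (s 0 * m₁ + s 1 * m₂) * J) hT'ne
  rw [Finset.mem_filter] at hs₁ hs₂
  have hbound := le_totalDegree_aeval p (A := s₁ 0 + (s₁ 0 * m₁ + s₁ 1 * m₂) * I)
    (B := s₂ 1 + (s₂ 0 * m₁ + s₂ 1 * m₂) * J) hab hn hm hG0 (by
      intro d hd hdw
      obtain ⟨s', hs', hsw', h1, h2⟩ := hGd d hd (hdw.trans hGw)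
      have hmem := (Finset.mem_filter
        (p := fun d => wt (n + m₁ * U) (m + m₂ * U) d = W)).2 ⟨hs', hsw'⟩
      exact ⟨(hsmin₁ s' hmem).trans h1, (hsmin₂ s' hmem).trans h2⟩)
  refine le_trans ?_ hbound
  have hw₁ := hs₁.2
  have hw₂ := hs₂.2
  rw [wt_apply] at hw₁ hw₂
  by_cases hnm : n = m
  · have hUD : U = n * D := by
      rw [← hew, wt_apply, ← hDsum e he, ← hnm]
      ring
    have hD2 : 2 ≤ D := by
      have h1 := hE e he
      have h2 := hDsum e he
      omega
    have hconv : ∀ r : Fin 2 →₀ ℕ, (n + m₁ * U) * r 0 + (m + m₂ * U) * r 1 = W →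
        1 + m₁ * D ≤ r 0 * (1 + m₁ * D) + r 1 * (1 + m₂ * D) := by
      intro r hr
      rw [← hr, hUD, ← hnm] at hWP
      refine Nat.le_of_mul_le_mul_left ?_ hn
      linarith
    rw [← hm_def, ← hnm]
    exact le_of_weights_eq (by omega) hh₁ hh₂ hle hD2 hIpos hJpos hdvd (hconv s₁ hw₁) (hconv s₂ hw₂)
  -- A form has at most one monomial of a given weight when `n ≠ m`, so `I` and `J` come from the
  -- same monomial.
  · have huniq : ∀ d ∈ u.support, wt n m d = U → d 0 = e 0 ∧ d 1 = e 1 := by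
      intro d hd hdw
      have h1 := hDsum d hd
      have h2 := hDsum e he
      have h3 := hdw.trans hew.symm
      rw [wt_apply, wt_apply] at h3
      have h4 : ((n : ℤ) - m) * (d 0 - e 0) = 0 := by
        have h5 : (d 1 : ℤ) = D - d 0 := by omega
        have h6 : (e 1 : ℤ) = D - e 0 := by omega
        zify at h3
        rw [h5, h6] at h3
        linarith
      rcases mul_eq_zero.1 h4 with h5 | h5 <;> omega
    have hUIJ : U = n * I + m * J := by
      rw [← hew, wt_apply, hI_def, hJ_def, (huniq e₀ he₀.1 he₀.2).1, (huniq e₁ he₁.1 he₁.2).2]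
    rw [hUIJ] at hw₁ hw₂ hWP
    exact le_of_weights_ne hp hn hm hnm hh₁ hh₂ hle hIpos hJpos hdvd
      (by rw [← hw₁]; ring) (by rw [← hw₂]; ring) hWP

/-- Follows from the previous bound by exchanging the two variables. -/
theorem le_totalDegree_of_exponent_one_pos (p : ℕ) [Fact p.Prime] [CharP k p]
    {a b u F : MvPolynomial (Fin 2) k} {D : ℕ} {h₁ h₂ : Polynomial k} {c : k}
    (hab : jacobianDet a b ≠ 0) (hc : c ≠ 0) (hu : u ≠ 0) (hD : 0 < D) (hom : u.IsHomogeneous D)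
    (hh₁ : 0 < h₁.natDegree) (hh₂ : 0 < h₂.natDegree)
    (hJ : jacobianDet (X 0 * Polynomial.aeval u h₁) (X 1 * Polynomial.aeval u h₂) = C c)
    (hle : h₁.natDegree ≤ h₂.natDegree) {s : Fin 2 →₀ ℕ} (hs : s ∈ F.support) (hs1 : 0 < s 1) :
    p ≤ (aeval ![a, b]
      (aeval ![X 0 * Polynomial.aeval u h₁, X 1 * Polynomial.aeval u h₂] F)).totalDegree := by
  let sw : MvPolynomial (Fin 2) k →ₐ[k] MvPolynomial (Fin 2) k := rename (Equiv.swap 0 1)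
  have hinj : Function.Injective (Equiv.swap (0 : Fin 2) 1) := (Equiv.swap 0 1).injective
  have hsw0 : sw (X 0) = X 1 := by simp [sw]
  have hsw1 : sw (X 1) = X 0 := by simp [sw]
  have haeval : ∀ h : Polynomial k, Polynomial.aeval (sw u) h = sw (Polynomial.aeval u h) :=
    fun h => Polynomial.aeval_algHom_apply sw u h
  have hJ' : jacobianDet (X 0 * Polynomial.aeval (sw u) h₂) (X 1 * Polynomial.aeval (sw u) h₁) =
      C c := by
    have h1 := jacobianDet_comp sw
      (aeval ![X 0 * Polynomial.aeval u h₁, X 1 * Polynomial.aeval u h₂])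
    simp only [AlgHom.mul_apply, aeval_X, Matrix.cons_val_zero, Matrix.cons_val_one, hJ, hsw0, hsw1,
      endo_C, map_mul, ← haeval] at h1
    have h2 : jacobianDet (X 1 : MvPolynomial (Fin 2) k) (X 0) = -1 := by
      simp [jacobianDet, pderiv_X]
    have h3 : ∀ f g : MvPolynomial (Fin 2) k, jacobianDet f g = - jacobianDet g f := by
      intro f g
      simp only [jacobianDet]
      ring
    rw [h3, h1, h2]
    ring
  have hmem : Finsupp.mapDomain (Equiv.swap 0 1) s ∈ (sw F).support := by
    rw [mem_support_iff]
    change coeff _ (rename _ F) ≠ 0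
    rw [coeff_rename_mapDomain _ hinj]
    exact mem_support_iff.1 hs
  have hval : 0 < Finsupp.mapDomain (Equiv.swap (0 : Fin 2) 1) s 0 := by
    have := Finsupp.mapDomain_apply hinj s 1
    rw [Equiv.swap_apply_right] at this
    rwa [this]
  have key := le_totalDegree_of_exponent_zero_pos p (a := b) (b := a) (u := sw u) (F := sw F)
    (c := c) (by
      intro h
      apply hab
      have : jacobianDet a b = - jacobianDet b a := by
        simp only [jacobianDet]
        ring
      rw [this, h, neg_zero]) hc ((map_ne_zero_iff sw (rename_injective _ hinj)).2 hu) hD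
    hom.rename_isHomogeneous hh₂ hh₁ hJ' hle hmem hval
  have e1 : (aeval ![b, a] : MvPolynomial (Fin 2) k →ₐ[k] MvPolynomial (Fin 2) k).comp
      ((aeval ![X 0 * Polynomial.aeval (sw u) h₂, X 1 * Polynomial.aeval (sw u) h₁]).comp sw) =
      (aeval ![a, b] : MvPolynomial (Fin 2) k →ₐ[k] MvPolynomial (Fin 2) k).comp
        (aeval ![X 0 * Polynomial.aeval u h₁, X 1 * Polynomial.aeval u h₂]) := by
    have e2 : (aeval ![b, a] : MvPolynomial (Fin 2) k →ₐ[k] MvPolynomial (Fin 2) k).comp sw =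
        aeval ![a, b] := by
      ext1 i
      fin_cases i
      · simp [hsw0]
      · simp [hsw1]
    have e3 : ∀ f, aeval ![b, a] (sw f) = aeval ![a, b] f := DFunLike.congr_fun e2
    ext1 i
    fin_cases i
    · simp only [Fin.zero_eta, AlgHom.comp_apply, hsw0, aeval_X, Matrix.cons_val_zero,
        Matrix.cons_val_one, map_mul, haeval, e3]
    · simp only [Fin.mk_one, AlgHom.comp_apply, hsw1, aeval_X, Matrix.cons_val_zero,
        Matrix.cons_val_one, map_mul, haeval, e3]
  have e4 := DFunLike.congr_fun e1 F
  simp only [AlgHom.comp_apply] at e4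
  rwa [e4] at key

end DegreeBound

/-! ### Conclusion. -/

section Main

variable {k : Type*} [Field k]

theorem pderiv_eq_zero_of_forall_support {i : Fin 2} {F : MvPolynomial (Fin 2) k}
    (h : ∀ s ∈ F.support, s i = 0) : pderiv i F = 0 := by
  by_contra h0
  obtain ⟨d, hd⟩ := support_nonempty.2 h0
  have h1 := h _ (add_single_mem_support_of_pderiv hd)
  simp at h1

/-- The components of `ρ₂` have nonzero Jacobian determinant, so each variable occurs in one of
them. The variable whose multiplier has the larger `natDegree` is used. -/
theorem IsTypeB.le_totalDegree_of_factor (p : ℕ) [Fact p.Prime] [CharP k p]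
    {ρ₁ β ρ₂ : MvPolynomial (Fin 2) k →ₐ[k] MvPolynomial (Fin 2) k}
    (h₁ : IsJacobianPair (ρ₁ (X 0)) (ρ₁ (X 1))) (hβ : IsTypeB β)
    (h₂ : IsJacobianPair (ρ₂ (X 0)) (ρ₂ (X 1))) :
    ∃ i, p ≤ ((ρ₁ * β * ρ₂) (X i)).totalDegree := by
  obtain ⟨u, D, q₁, q₂, hu, hD, hom, hq₁, hq₂, hβ0, hβ1, c, hc, hJ⟩ := hβ
  obtain ⟨e, he, hJ₁⟩ := h₁
  obtain ⟨r, hr, hJ₂⟩ := h₂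
  have hab : jacobianDet (ρ₁ (X 0)) (ρ₁ (X 1)) ≠ 0 := by
    rw [hJ₁]
    simpa using he
  rw [hβ0, hβ1] at hJ
  have hρ₁ : ρ₁ = aeval ![ρ₁ (X 0), ρ₁ (X 1)] := by
    ext1 i
    fin_cases i
    · rw [Fin.zero_eta, aeval_X, Matrix.cons_val_zero]
    · rw [Fin.mk_one, aeval_X, Matrix.cons_val_one, Matrix.cons_val_zero]
  have hβ' : β = aeval ![X 0 * Polynomial.aeval u q₁, X 1 * Polynomial.aeval u q₂] := by
    ext1 i
    fin_cases i
    · rw [Fin.zero_eta, aeval_X, Matrix.cons_val_zero, hβ0]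
    · rw [Fin.mk_one, aeval_X, Matrix.cons_val_one, Matrix.cons_val_zero, hβ1]
  by_contra! hlow
  have key : ∀ i, ¬ p ≤ (aeval ![ρ₁ (X 0), ρ₁ (X 1)] (aeval
      ![X 0 * Polynomial.aeval u q₁, X 1 * Polynomial.aeval u q₂] (ρ₂ (X i)))).totalDegree := by
    intro i
    rw [← hρ₁, ← hβ']
    exact (hlow i).not_ge
  have hr' : (C r : MvPolynomial (Fin 2) k) ≠ 0 := by simpa using hr
  rcases le_total q₂.natDegree q₁.natDegree with hle | hle
  · have hz : ∀ i, pderiv 0 (ρ₂ (X i)) = 0 := fun i =>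
      pderiv_eq_zero_of_forall_support fun s hs => by
        by_contra h0
        exact key i (le_totalDegree_of_exponent_zero_pos p hab hc hu hD hom hq₁ hq₂ hJ hle hs
          (Nat.pos_of_ne_zero h0))
    rw [jacobianDet, hz, hz, zero_mul, mul_zero, sub_zero] at hJ₂
    exact hr' hJ₂.symm
  · have hz : ∀ i, pderiv 1 (ρ₂ (X i)) = 0 := fun i =>
      pderiv_eq_zero_of_forall_support fun s hs => by
        by_contra h0
        exact key i (le_totalDegree_of_exponent_one_pos p hab hc hu hD hom hq₁ hq₂ hJ hle hs
          (Nat.pos_of_ne_zero h0))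
    rw [jacobianDet, hz, hz, zero_mul, mul_zero, sub_zero] at hJ₂
    exact hr' hJ₂.symm

theorem IsCompositeAB.bijective_of_totalDegree_lt {p : ℕ} [Fact p.Prime] [CharP k p]
    {ρ : MvPolynomial (Fin 2) k →ₐ[k] MvPolynomial (Fin 2) k} (hρ : IsCompositeAB p ρ)
    (hlow : ∀ i, (ρ (X i)).totalDegree < p) : Function.Bijective ρ := by
  rcases hρ.isPMorphism_or_factor with h | ⟨ρ₁, β, ρ₂, h₁, hβ, h₂, rfl⟩
  · exact h.bijective_of_totalDegree_lt hlow
  · obtain ⟨i, hi⟩ := hβ.le_totalDegree_of_factor p h₁.isJacobianPair h₂.isJacobianPair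
    exact absurd (hlow i) hi.not_gt

end Main

theorem proposition4p11 {k : Type*} [Field k] (p : ℕ) [Fact p.Prime] [CharP k p]
    (ρ : MvPolynomial (Fin 2) k →ₐ[k] MvPolynomial (Fin 2) k) (hρ : IsCompositeAB p ρ) :
    (¬ Function.Bijective ρ → p ≤ max (ρ (X 0)).totalDegree (ρ (X 1)).totalDegree) ∧
    ((ρ (X 0)).totalDegree < p → (ρ (X 1)).totalDegree < p →
      (IsJacobianPair (ρ (X 0)) (ρ (X 1)) ↔
        Algebra.adjoin k {ρ (X 0), ρ (X 1)} = ⊤)) := by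
  refine ⟨fun h => ?_, fun h0 h1 => ⟨fun _ => ?_, fun _ => hρ.isJacobianPair⟩⟩
  · by_contra! hlt
    obtain ⟨h0, h1⟩ := max_lt_iff.1 hlt
    exact h (hρ.bijective_of_totalDegree_lt (Fin.forall_fin_two.2 ⟨h0, h1⟩))
  · have hbij := hρ.bijective_of_totalDegree_lt (Fin.forall_fin_two.2 ⟨h0, h1⟩)
    have hset : ({ρ (X 0), ρ (X 1)} : Set (MvPolynomial (Fin 2) k)) =
        ρ '' Set.range (X : Fin 2 → MvPolynomial (Fin 2) k) := by
      ext f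
      simp [Fin.exists_fin_two, eq_comm]
    rw [hset, ← AlgHom.map_adjoin, adjoin_range_X, Algebra.map_top]
    exact (AlgHom.range_eq_top ρ).2 hbij.2
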